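/- Let $\mathcal{M}$ be a complete connected (finite-dimensional, smooth, without boundary) Riemannian manifold with geodesic distance $d$. Equip the tangent bundle $T\mathcal{M}$ with the geodesic distance $d$ of the Sasaki metric, and $T^2\mathcal{M} := \{(x,v_1,v_2) : x \in \mathcal{M},\ v_1,v_2 \in T_x\mathcal{M}\}$ with the distance given by $d^2((x,v_1,v_2),(x',v_1',v_2')) = d^2((x,v_1),(x',v_1')) + d^2((x,v_2),(x',v_2'))$. Let $\pi : T\mathcal{M} \to \mathcal{M}$, $\pi(x,v) = x$, and $\pi_i : T^2\mathcal{M} \to T\mathcal{M}$, $\pi_i(x,v_1,v_2) = (x,v_i)$, $i=1,2$. For a complete separable metric space $X$, let $\mathcal{P}_2(X)$ be the space of Borel probability measures on $X$ with finite second moment, with the Wasserstein distance $\mathrm{W}_2$, and let $\mathcal{P}_2^{(0)}(X) = X$, $\mathcal{P}_2^{(n+1)}(X) = \mathcal{P}_2(\mathcal{P}_2^{(n)}(X))$. For a $1$-Lipschitz map $f : X \to Y$, let $[f]^{(n)} : \mathcal{P}_2^{(n)}(X) \to \mathcal{P}_2^{(n)}(Y)$ be defined by $[f]^{(0)} = f$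 and $[f]^{(n+1)}(\mathbb{P}) = ([f]^{(n)})_\#\mathbb{P}$. For a Borel function $f : X \to [0,+\infty)$ and $\mu \in \mathcal{P}_2^{(n)}(X)$, let $\mathbb{E}^{(0)}_x[f] = f(x)$ and $\mathbb{E}^{(n+1)}_{\mathbb{P}}[f] = \int \mathbb{E}^{(n)}_{\mu}[f]\,\mathrm{d}\mathbb{P}(\mu)$. Let $n \ge 0$ and $\mu \in \mathcal{P}_2^{(n)}(\mathcal{M})$. Let $\mathcal{P}_2^{(n)}(T\mathcal{M})_\mu := \{\gamma \in \mathcal{P}_2^{(n)}(T\mathcal{M}) : [\pi]^{(n)}(\gamma) = \mu\}$ be the set of velocity plans with base $\mu$, and, for $\gamma_1,\gamma_2$ in this set, let $\Gamma_\mu(\gamma_1,\gamma_2) := \{\alpha \in \mathcal{P}_2^{(n)}(T^2\mathcal{M}) : [\pi_1]^{(n)}(\alpha) = \gamma_1,\ [\pi_2]^{(n)}(\alpha) = \gamma_2\}$ and $$\mathrm{W}_\mu(\gamma_1,\gamma_2) := \Big(\inf_{\alpha \in \Gamma_\mu(\gamma_1,\gamma_2)} \mathbb{E}^{(n)}_\alpha\big[\|v_1-v_2\|_x^2\big]\Big)^{1/2}.$$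 Then, for all $\gamma_1,\gamma_2 \in \mathcal{P}_2^{(n)}(T\mathcal{M})_\mu$, the set $\Gamma_\mu(\gamma_1,\gamma_2)$ is non-empty and compact in $\mathcal{P}_2^{(n)}(T^2\mathcal{M})$ (for the topology of $\mathrm{W}_2$, or of $d$ if $n=0$), and the infimum is finite and attained. Moreover $\mathrm{W}_\mu$ is a distance on $\mathcal{P}_2^{(n)}(T\mathcal{M})_\mu$: it is finite, symmetric, satisfies the triangle inequality, and $\mathrm{W}_\mu(\gamma_1,\gamma_2) = 0$ if and only if $\gamma_1 = \gamma_2$. -/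

import Mathlib

open MeasureTheory Set
open scoped ENNReal

/-! ### Spaces with a distance, and the functor `P₂` -/

/-- A type with a (possibly infinite) distance function. The axioms of a distance are not recorded:
this structure only serves to iterate the construction `P₂` below, starting from honest metric
spaces. -/
structure DistSpace.{u} where
  /-- the underlying type -/
  carrier : Type u
  /-- the distance function -/
  edist : carrier → carrier → ℝ≥0∞

namespace DistSpace

universe u v w

instance instCoeSort : CoeSort DistSpace.{u} (Type u) := ⟨DistSpace.carrier⟩

/-- The topology of a distance: a set is open if it contains a ball around each of its points. -/
instance instTopologicalSpace (X : DistSpace.{u}) : TopologicalSpace X where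
  IsOpen U := ∀ x ∈ U, ∃ r : ℝ≥0∞, 0 < r ∧ {y | X.edist x y < r} ⊆ U
  isOpen_univ := fun _ _ => ⟨1, one_pos, subset_univ _⟩
  isOpen_inter := by
    rintro s t hs ht x ⟨hxs, hxt⟩
    obtain ⟨r, hr, hrs⟩ := hs x hxs
    obtain ⟨r', hr', hrt⟩ := ht x hxt
    exact ⟨min r r', lt_min hr hr', fun y hy =>
      ⟨hrs (lt_of_lt_of_le (show X.edist x y < min r r' from hy) (min_le_left _ _)),
        hrt (lt_of_lt_of_le (show X.edist x y < min r r' from hy) (min_le_right _ _))⟩⟩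
  isOpen_sUnion := by
    rintro S hS x ⟨U, hU, hxU⟩
    obtain ⟨r, hr, hrU⟩ := hS U hU x hxU
    exact ⟨r, hr, hrU.trans (subset_sUnion_of_mem hU)⟩

/-- The Borel `σ`-algebra of the topology of the distance. -/
instance instMeasurableSpace (X : DistSpace.{u}) : MeasurableSpace X := borel X

instance instBorelSpace (X : DistSpace.{u}) : BorelSpace X := ⟨rfl⟩

/-- The optimal transport distance of order two between two Borel measures `μ`, `ν`: the square root
of the infimum, over all transport plans `π` between `μ` and `ν`, of `∫ d(x, y)² dπ(x, y)`. -/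
noncomputable def wasserstein (X : DistSpace.{u}) (μ ν : Measure X) : ℝ≥0∞ :=
  (⨅ π : Measure (X × X), ⨅ _ : π.map Prod.fst = μ ∧ π.map Prod.snd = ν,
    ∫⁻ p, X.edist p.1 p.2 ^ 2 ∂π) ^ (1 / 2 : ℝ)

/-- The Wasserstein space `P₂(X)`: Borel probability measures on `X` with finite second moment,
with the distance `W₂`. -/
noncomputable def P2 (X : DistSpace.{u}) : DistSpace.{u} where
  carrier := {μ : Measure X // IsProbabilityMeasure μ ∧ ∃ x₀ : X, ∫⁻ x, X.edist x₀ x ^ 2 ∂μ < ⊤}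
  edist μ ν := X.wasserstein μ.1 ν.1

/-- A nonexpansive (that is, `1`-Lipschitz) map. -/
structure NonexpMap (X : DistSpace.{u}) (Y : DistSpace.{v}) where
  /-- the underlying function -/
  toFun : X → Y
  edist_le : ∀ x x', Y.edist (toFun x) (toFun x') ≤ X.edist x x'

theorem NonexpMap.measurable {X : DistSpace.{u}} {Y : DistSpace.{v}} (f : NonexpMap X Y) :
    Measurable f.toFun := by
  apply Continuous.measurable
  refine continuous_def.2 fun U hU x hx => ?_
  obtain ⟨r, hr, hrU⟩ := hU _ hx
  exact ⟨r, hr, fun y hy => hrU (lt_of_le_of_lt (f.edist_le x y) hy)⟩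

theorem wasserstein_map_le {X : DistSpace.{u}} {Y : DistSpace.{v}} (f : NonexpMap X Y)
    (μ ν : Measure X) :
    Y.wasserstein (μ.map f.toFun) (ν.map f.toFun) ≤ X.wasserstein μ ν := by
  refine ENNReal.rpow_le_rpow ?_ (by norm_num)
  refine le_iInf₂ fun π hπ => ?_
  have hf := f.measurable
  have hff : Measurable (Prod.map f.toFun f.toFun) := hf.prodMap hf
  have h1 : (π.map (Prod.map f.toFun f.toFun)).map Prod.fst = μ.map f.toFun := by
    rw [← hπ.1, Measure.map_map measurable_fst hff, Measure.map_map hf measurable_fst]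
    rfl
  have h2 : (π.map (Prod.map f.toFun f.toFun)).map Prod.snd = ν.map f.toFun := by
    rw [← hπ.2, Measure.map_map measurable_snd hff, Measure.map_map hf measurable_snd]
    rfl
  refine (iInf₂_le (π.map (Prod.map f.toFun f.toFun)) ⟨h1, h2⟩).trans ?_
  refine (lintegral_map_le _ _).trans (lintegral_mono fun p => ?_)
  exact pow_le_pow_left' (f.edist_le _ _) 2

/-- The pushforward `[f] : P₂(X) → P₂(Y)`, `μ ↦ f_# μ`. -/
noncomputable def NonexpMap.push {X : DistSpace.{u}} {Y : DistSpace.{v}} (f : NonexpMap X Y) :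
    NonexpMap X.P2 Y.P2 where
  toFun μ := ⟨μ.1.map f.toFun, by
    obtain ⟨μ, hμ, x₀, hx₀⟩ := μ
    refine ⟨Measure.isProbabilityMeasure_map f.measurable.aemeasurable, f.toFun x₀, ?_⟩
    refine lt_of_le_of_lt ((lintegral_map_le _ _).trans (lintegral_mono fun x => ?_)) hx₀
    exact pow_le_pow_left' (f.edist_le _ _) 2⟩
  edist_le μ ν := wasserstein_map_le f μ.1 ν.1

/-- The iterated Wasserstein space `P₂⁽ⁿ⁾(X) = P₂(⋯P₂(X)⋯)`. -/
noncomputable def hier : ℕ → DistSpace.{u} → DistSpace.{u}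
  | 0, X => X
  | n + 1, X => (hier n X).P2

/-- The iterated pushforward `[f]⁽ⁿ⁾ : P₂⁽ⁿ⁾(X) → P₂⁽ⁿ⁾(Y)`. -/
noncomputable def NonexpMap.hierPush {X : DistSpace.{u}} {Y : DistSpace.{v}} (f : NonexpMap X Y) :
    (n : ℕ) → NonexpMap (hier n X) (hier n Y)
  | 0 => f
  | n + 1 => (f.hierPush n).push

/-- The `n`-level expectation `𝔼⁽ⁿ⁾_μ[f] = ∫⋯∫ f(x) dμ¹(x) dμ²(μ¹) ⋯ dμ(μⁿ⁻¹)` of a nonnegative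
function `f` on `X` with respect to `μ ∈ P₂⁽ⁿ⁾(X)`; for `n = 0` it is the value of `f` at `μ`. -/
noncomputable def nExpect {X : DistSpace.{u}} (f : X → ℝ≥0∞) : (n : ℕ) → hier n X → ℝ≥0∞
  | 0, x => f x
  | n + 1, P => ∫⁻ μ, nExpect f n μ ∂P.1

end DistSpace

theorem le_sqrt_sq_add_sq_left (a b : ℝ≥0∞) : a ≤ (a ^ 2 + b ^ 2) ^ (1 / 2 : ℝ) := by
  calc a = (a ^ 2) ^ (1 / 2 : ℝ) := by
        rw [← ENNReal.rpow_natCast_mul]; norm_num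
    _ ≤ _ := ENNReal.rpow_le_rpow le_self_add (by norm_num)

theorem le_sqrt_sq_add_sq_right (a b : ℝ≥0∞) : b ≤ (a ^ 2 + b ^ 2) ^ (1 / 2 : ℝ) := by
  rw [add_comm]
  exact le_sqrt_sq_add_sq_left b a

/-- The Christoffel symbols of the first kind, at the point `y`, of a field `g` of bilinear forms on
`E`: the linear form `w ↦ ½ (∂_a g(b, w) + ∂_b g(a, w) - ∂_w g(a, b))`, with derivatives at `y`. -/
noncomputable def christoffelFirst {E : Type*} [NormedAddCommGroup E] [NormedSpace ℝ E]
    (g : E → E →L[ℝ] E →L[ℝ] ℝ) (y : E) (a b : E) : E →L[ℝ] ℝ :=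
  (1 / 2 : ℝ) •
    (fderiv ℝ g y a b + fderiv ℝ g y b a - ((fderiv ℝ g y).flip a).flip b)

open Bundle Manifold
open scoped ContDiff

/-! ### The Sasaki distance on the tangent bundle -/

section Riemannian

variable {E : Type*} [NormedAddCommGroup E] [NormedSpace ℝ E] [FiniteDimensional ℝ E]
  {M : Type*} [MetricSpace M] [ChartedSpace E M] [IsManifold 𝓘(ℝ, E) ∞ M]
  [RiemannianBundle (fun x : M => TangentSpace 𝓘(ℝ, E) x)]

/-- The Riemannian metric in the preferred chart `φ` at `x`: for `y ∈ E` in the target of `φ`,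
`chartMetric x y v w = g(D(φ⁻¹)_y v, D(φ⁻¹)_y w)`. -/
noncomputable def chartMetric (x : M) (y : E) : E →L[ℝ] E →L[ℝ] ℝ :=
  (innerSL ℝ (E := TangentSpace 𝓘(ℝ, E) ((extChartAt 𝓘(ℝ, E) x).symm y))).bilinearComp
    (mfderiv 𝓘(ℝ, E) 𝓘(ℝ, E) (extChartAt 𝓘(ℝ, E) x).symm y)
    (mfderiv 𝓘(ℝ, E) 𝓘(ℝ, E) (extChartAt 𝓘(ℝ, E) x).symm y)

/-- The Christoffel symbols of the first kind of the Riemannian metric, at `x` and in the preferred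
chart `φ` at `x`. The tangent space at `x` is identified to the model space `E` by the derivative of
`φ` at `x`. -/
noncomputable def christoffelForm (x : M) (a b : TangentSpace 𝓘(ℝ, E) x) :
    TangentSpace 𝓘(ℝ, E) x →L[ℝ] ℝ :=
  christoffelFirst (E := E) (chartMetric x) (extChartAt 𝓘(ℝ, E) x x) a b

instance instFiniteDimensionalTangent (x : M) :
    FiniteDimensional ℝ (TangentSpace 𝓘(ℝ, E) x) :=
  inferInstanceAs (FiniteDimensional ℝ E)

/-- The Christoffel symbols (of the second kind) `Γ_x(a, b) = Γᵏ_{ij} aⁱ bʲ` of the Levi-Civita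
connection, at `x` and in the preferred chart at `x`. It is the vector representing the linear form
`christoffelForm x a b` for the scalar product of `T_x M`. -/
noncomputable def christoffel (x : M) (a b : TangentSpace 𝓘(ℝ, E) x) : TangentSpace 𝓘(ℝ, E) x :=
  haveI : CompleteSpace (TangentSpace 𝓘(ℝ, E) x) := FiniteDimensional.complete ℝ _
  (InnerProductSpace.toDual ℝ (TangentSpace 𝓘(ℝ, E) x)).symm (christoffelForm x a b)

/-- The horizontal part of a vector `ξ` tangent to `TM` at `p = (x, v)`: its image in `T_x M` by the
differential of the projection `TM → M`. -/
noncomputable def horizontalPart (p : TangentBundle 𝓘(ℝ, E) M)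
    (ξ : TangentSpace 𝓘(ℝ, E).tangent p) : TangentSpace 𝓘(ℝ, E) p.1 :=
  mfderiv 𝓘(ℝ, E).tangent 𝓘(ℝ, E) (TotalSpace.proj : TangentBundle 𝓘(ℝ, E) M → M) p ξ

/-- The vertical part of a vector `ξ` tangent to `TM` at `p = (x, v)`. In the coordinates of `TM`
given by the preferred chart at `x`, one has `ξ = (a, b)` and the vertical part is `b + Γ_x(a, v)`.
For the velocity of a curve `t ↦ (c(t), X(t))` it is the covariant derivative of `X` along `c`. -/
noncomputable def verticalPart (p : TangentBundle 𝓘(ℝ, E) M)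
    (ξ : TangentSpace 𝓘(ℝ, E).tangent p) : TangentSpace 𝓘(ℝ, E) p.1 :=
  letI b : TangentSpace 𝓘(ℝ, E) p.1 := (show E × E from ξ).2
  b + christoffel p.1 (horizontalPart p ξ) p.2

/-- The norm of the Sasaki metric on the tangent spaces of `TM`: horizontal and vertical vectors are
orthogonal, and both are measured by the Riemannian metric of `M`. -/
noncomputable def sasakiENorm (p : TangentBundle 𝓘(ℝ, E) M)
    (ξ : TangentSpace 𝓘(ℝ, E).tangent p) : ℝ≥0∞ :=
  (‖horizontalPart p ξ‖ₑ ^ 2 + ‖verticalPart p ξ‖ₑ ^ 2) ^ (1 / 2 : ℝ)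

/-- The geodesic distance of the Sasaki metric on `TM`: the infimum of the lengths of `C¹` paths. -/
noncomputable def sasakiEDist (p q : TangentBundle 𝓘(ℝ, E) M) : ℝ≥0∞ :=
  letI : ∀ p : TangentBundle 𝓘(ℝ, E) M, ENorm (TangentSpace 𝓘(ℝ, E).tangent p) :=
    fun p => ⟨sasakiENorm p⟩
  riemannianEDist 𝓘(ℝ, E).tangent p q

theorem riemannianEDist_proj_le (p q : TangentBundle 𝓘(ℝ, E) M) :
    riemannianEDist 𝓘(ℝ, E) p.1 q.1 ≤ sasakiEDist p q := by
  let _ : ∀ p : TangentBundle 𝓘(ℝ, E) M, ENorm (TangentSpace 𝓘(ℝ, E).tangent p) :=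
    fun p => ⟨sasakiENorm p⟩
  refine le_of_forall_gt fun r hr => ?_
  obtain ⟨γ, h0, h1, hγ, hlt⟩ := exists_lt_of_riemannianEDist_lt hr
  have hproj : ContMDiff 𝓘(ℝ, E).tangent 𝓘(ℝ, E) 1
      (TotalSpace.proj : TangentBundle 𝓘(ℝ, E) M → M) := contMDiff_proj _
  have hle : riemannianEDist 𝓘(ℝ, E) p.1 q.1 ≤
      pathELength 𝓘(ℝ, E) (TotalSpace.proj ∘ γ) 0 1 :=
    riemannianEDist_le_pathELength (hproj.comp_contMDiffOn hγ) (by simp [h0]) (by simp [h1])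
      zero_le_one
  refine (hle.trans ?_).trans_lt hlt
  rw [pathELength_eq_lintegral_mfderiv_Ioo, pathELength_eq_lintegral_mfderiv_Ioo]
  refine setLIntegral_mono' measurableSet_Ioo fun t ht => ?_
  have hγt : MDifferentiableAt 𝓘(ℝ, ℝ) 𝓘(ℝ, E).tangent γ t :=
    ((hγ t (Ioo_subset_Icc_self ht)).contMDiffAt (Icc_mem_nhds ht.1 ht.2)).mdifferentiableAt
      one_ne_zero
  rw [mfderiv_comp t (hproj.mdifferentiable one_ne_zero _) hγt]
  change ‖horizontalPart (γ t) _‖ₑ ≤ sasakiENorm (γ t) _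
  exact le_sqrt_sq_add_sq_left _ _

variable (M) in
/-- The manifold `M` with its distance. -/
def baseSpace : DistSpace := ⟨M, edist⟩

variable (E M) in
/-- The tangent bundle `TM` with the Sasaki distance. -/
noncomputable def tangentBundleSpace : DistSpace := ⟨TangentBundle 𝓘(ℝ, E) M, sasakiEDist⟩

variable (E M) in
/-- The space `T²M = {(x, v₁, v₂) : x ∈ M, v₁, v₂ ∈ T_x M}`, with the distance `d` given by
`d((x, v₁, v₂), (x', v₁', v₂'))² = d((x, v₁), (x', v₁'))² + d((x, v₂), (x', v₂'))²`. -/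
noncomputable def tangentPairSpace : DistSpace where
  carrier := Σ x : M, TangentSpace 𝓘(ℝ, E) x × TangentSpace 𝓘(ℝ, E) x
  edist p q := (sasakiEDist (⟨p.1, p.2.1⟩ : TangentBundle 𝓘(ℝ, E) M) ⟨q.1, q.2.1⟩ ^ 2 +
    sasakiEDist (⟨p.1, p.2.2⟩ : TangentBundle 𝓘(ℝ, E) M) ⟨q.1, q.2.2⟩ ^ 2) ^ (1 / 2 : ℝ)

/-! ### Velocity plans and their couplings -/

variable (E M) in
/-- The projection `π : TM → M`. -/
noncomputable def projBase [IsRiemannianManifold 𝓘(ℝ, E) M] :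
    DistSpace.NonexpMap (tangentBundleSpace E M) (baseSpace M) where
  toFun p := TotalSpace.proj p
  edist_le p q := (IsRiemannianManifold.out (I := 𝓘(ℝ, E)) (TotalSpace.proj p : M)
    (TotalSpace.proj q)).trans_le (riemannianEDist_proj_le p q)

variable (E M) in
/-- The projection `π₁ : T²M → TM`, `(x, v₁, v₂) ↦ (x, v₁)`. -/
noncomputable def projFst : DistSpace.NonexpMap (tangentPairSpace E M) (tangentBundleSpace E M) where
  toFun p := ⟨p.1, p.2.1⟩
  edist_le _ _ := le_sqrt_sq_add_sq_left _ _

variable (E M) in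
/-- The projection `π₂ : T²M → TM`, `(x, v₁, v₂) ↦ (x, v₂)`. -/
noncomputable def projSnd : DistSpace.NonexpMap (tangentPairSpace E M) (tangentBundleSpace E M) where
  toFun p := ⟨p.1, p.2.2⟩
  edist_le _ _ := le_sqrt_sq_add_sq_right _ _

/-- The set `P₂⁽ⁿ⁾(TM)_μ` of velocity plans with base `μ ∈ P₂⁽ⁿ⁾(M)`. -/
def velocityPlans [IsRiemannianManifold 𝓘(ℝ, E) M] (n : ℕ) (μ : DistSpace.hier n (baseSpace M)) :
    Set (DistSpace.hier n (tangentBundleSpace E M)) :=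
  {γ | ((projBase E M).hierPush n).toFun γ = μ}

/-- The set `Γ_μ(γ₁, γ₂)` of couplings between two velocity plans `γ₁, γ₂ ∈ P₂⁽ⁿ⁾(TM)_μ`: the
`α ∈ P₂⁽ⁿ⁾(T²M)` with `[π₁]⁽ⁿ⁾(α) = γ₁` and `[π₂]⁽ⁿ⁾(α) = γ₂`. -/
def planCouplings (n : ℕ) (γ₁ γ₂ : DistSpace.hier n (tangentBundleSpace E M)) :
    Set (DistSpace.hier n (tangentPairSpace E M)) :=
  {α | ((projFst E M).hierPush n).toFun α = γ₁ ∧ ((projSnd E M).hierPush n).toFun α = γ₂}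

variable (E M) in
/-- The function `(x, v₁, v₂) ↦ ‖v₁ - v₂‖_x²` on `T²M`. -/
noncomputable def sqDiff (p : tangentPairSpace E M) : ℝ≥0∞ :=
  letI q : Σ x : M, TangentSpace 𝓘(ℝ, E) x × TangentSpace 𝓘(ℝ, E) x := p
  ‖q.2.1 - q.2.2‖ₑ ^ 2

/-- The distance `W_μ(γ₁, γ₂)` between velocity plans with base `μ`: the square root of the infimum
of `𝔼⁽ⁿ⁾_α[‖v₁ - v₂‖²]` over the couplings `α ∈ Γ_μ(γ₁, γ₂)`. -/
noncomputable def planDist (n : ℕ) (γ₁ γ₂ : DistSpace.hier n (tangentBundleSpace E M)) : ℝ≥0∞ :=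
  (⨅ α ∈ planCouplings n γ₁ γ₂, DistSpace.nExpect (sqDiff E M) n α) ^ (1 / 2 : ℝ)

end Riemannian

/-!
The maps `M ← TM ⇇ T²M` and the cost `‖v₁ - v₂‖²` enter the statement only through a few
properties, collected in `DistSpace.IsPlanSystem`: the pair `(π₁, π₂)` is proper (preimages of
totally bounded sets are totally bounded), the cost is lower semicontinuous and grows at most
quadratically, two points over the same base point have a coupling, and couplings can be
reflected, composed, and chosen diagonal, with the evident bounds for their costs. In every system
with these properties couplings form compact sets, lower semicontinuity gives optimal ones, and
the square root of the minimal cost is a distance on each fibre (`isCompact_couplings`,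
`exists_optimal`, and the lemmas on `couplingDist`). It remains to see that the properties pass
from a system to the system of its Wasserstein spaces (`IsPlanSystem.push`), hence to all levels
of the hierarchy by induction, and that they hold at level `0`.

For the passage to measures, properness is preserved because a set of measures is totally bounded
for the Wasserstein distance if and only if its elements are uniformly close in `L²` to finite
sets (`totallyBounded_iff_lL2_netDist`, `totallyBounded_push`). The existence of couplings, and
their composition, first produce a probability measure on a fibre product by gluing
(`exists_measure_fiberProduct`); almost every point of it can be lifted to the space of couplings.
Such pointwise lifts give a lifted law (`exists_lift`): on a countable partition into small cells
one chooses a single lift for each cell, and the resulting measures have a limit point by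
properness. All this uses that the Wasserstein space of a complete separable metric space is again
one (`instIsPolishP2`).

At level `0` one needs that the Sasaki distance is a complete separable distance that controls the
norm. The vertical part of a velocity is defined by Christoffel symbols in the chart centred at
the base point; by their transformation law (`christoffelFirst_pullback`) the same formula holds
in every chart (`exists_hasDerivAt_coord`). Near a point, the Sasaki norm of a velocity is
therefore comparable with the derivatives of the coordinates (`exists_velocity_bounds`), up to a
Christoffel term proportional to the norm of the vector. This norm is nonexpansive along curves,
by the compatibility of the covariant derivative with the metric (`enorm_snd_le_add_sasakiEDist`);
so the Christoffel term is bounded along short curves, the Sasaki distance induces the topology of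
`TM` (`exists_sasakiEDist_ball_subset`, `eventually_sasakiEDist_lt`), and completeness follows
from the local compactness of the fibres and the completeness of `M` (`exists_limit_sasakiEDist`).
-/

/-! ### The `L²` seminorm of nonnegative functions -/

namespace MeasureTheory

variable {Ω Ω' : Type*} [MeasurableSpace Ω] [MeasurableSpace Ω'] {μ : Measure Ω}
  {f g : Ω → ℝ≥0∞}

/-- The `L²` seminorm `(∫ f² dμ)^{1/2}` of a function with values in `[0, ∞]`. -/
noncomputable def lL2 (μ : Measure Ω) (f : Ω → ℝ≥0∞) : ℝ≥0∞ := (∫⁻ t, f t ^ 2 ∂μ) ^ (1 / 2 : ℝ)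

theorem _root_.ENNReal.sqrt_sq (a : ℝ≥0∞) : (a ^ 2) ^ (1 / 2 : ℝ) = a := by
  rw [← ENNReal.rpow_natCast_mul]; norm_num

theorem _root_.ENNReal.sq_sqrt (a : ℝ≥0∞) : (a ^ (1 / 2 : ℝ)) ^ 2 = a := by
  rw [← ENNReal.rpow_mul_natCast]; norm_num

theorem _root_.ENNReal.sqrt_le_iff {a b : ℝ≥0∞} : a ^ (1 / 2 : ℝ) ≤ b ↔ a ≤ b ^ 2 := by
  conv_lhs => rw [← ENNReal.sqrt_sq b]
  exact ENNReal.rpow_le_rpow_iff (by norm_num)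

theorem _root_.ENNReal.sqrt_lt_iff {a b : ℝ≥0∞} : a ^ (1 / 2 : ℝ) < b ↔ a < b ^ 2 := by
  conv_lhs => rw [← ENNReal.sqrt_sq b]
  exact ENNReal.rpow_lt_rpow_iff (by norm_num)

theorem lL2_sq : lL2 μ f ^ 2 = ∫⁻ t, f t ^ 2 ∂μ := ENNReal.sq_sqrt _

theorem lL2_mono_ae (h : ∀ᵐ t ∂μ, f t ≤ g t) : lL2 μ f ≤ lL2 μ g :=
  ENNReal.rpow_le_rpow (lintegral_mono_ae (h.mono fun _ ht => pow_le_pow_left' ht 2))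
    (by norm_num)

theorem lL2_mono (h : ∀ t, f t ≤ g t) : lL2 μ f ≤ lL2 μ g := lL2_mono_ae (.of_forall h)

theorem lL2_add_le (hf : Measurable f) (hg : Measurable g) :
    lL2 μ (fun t => f t + g t) ≤ lL2 μ f + lL2 μ g := by
  have := ENNReal.lintegral_Lp_add_le (μ := μ) (p := 2) hf.aemeasurable hg.aemeasurable
    one_le_two
  simpa [lL2] using this

theorem lL2_map {T : Ω → Ω'} (hT : Measurable T) {h : Ω' → ℝ≥0∞} (hh : Measurable h) :
    lL2 (μ.map T) h = lL2 μ (fun t => h (T t)) := by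
  unfold lL2; rw [lintegral_map (hh.pow_const 2) hT]

theorem lL2_const [IsProbabilityMeasure μ] (c : ℝ≥0∞) : lL2 μ (fun _ => c) = c := by
  simpa [lL2] using ENNReal.sqrt_sq c

theorem lintegral_le_lL2 [IsProbabilityMeasure μ] (hf : Measurable f) :
    ∫⁻ t, f t ∂μ ≤ lL2 μ f := by
  have := ENNReal.lintegral_mul_le_Lp_mul_Lq μ (p := 2) (q := 2) Real.HolderConjugate.two_two
    hf.aemeasurable (aemeasurable_const (b := (1 : ℝ≥0∞)))
  simpa [lL2] using this

theorem lL2_ne_top_iff : lL2 μ f ≠ ⊤ ↔ ∫⁻ t, f t ^ 2 ∂μ < ⊤ := by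
  rw [← lL2_sq, lt_top_iff_ne_top]; simp

theorem lL2_sum_le {ι : Type*} (s : Finset ι) {F : ι → Ω → ℝ≥0∞} (hF : ∀ i, Measurable (F i)) :
    lL2 μ (fun t => ∑ i ∈ s, F i t) ≤ ∑ i ∈ s, lL2 μ (F i) := by
  classical
  induction s using Finset.induction_on with
  | empty => simp [lL2]
  | insert a s ha ih =>
    simp only [Finset.sum_insert ha]
    exact (lL2_add_le (hF a) (Finset.measurable_fun_sum s fun i _ => hF i)).trans
      (add_le_add_right ih _)

theorem lL2_tsum_le {F : ℕ → Ω → ℝ≥0∞} (hF : ∀ i, Measurable (F i)) :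
    lL2 μ (fun t => ∑' i, F i t) ≤ ∑' i, lL2 μ (F i) := by
  rw [lL2, ENNReal.sqrt_le_iff]
  have h1 : ∀ t, (∑' i, F i t) ^ 2 = ⨆ n : ℕ, (∑ i ∈ Finset.range n, F i t) ^ 2 := by
    intro t
    have hm : Monotone fun n : ℕ => (∑ i ∈ Finset.range n, F i t) ^ 2 := fun m n hmn =>
      pow_le_pow_left' (Finset.sum_le_sum_of_subset (Finset.range_mono hmn)) 2
    exact tendsto_nhds_unique
      (((ENNReal.continuous_pow 2).tendsto _).comp (ENNReal.tendsto_nat_tsum _))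
      (tendsto_atTop_iSup hm)
  simp_rw [h1]
  rw [lintegral_iSup (fun n => (Finset.measurable_fun_sum _ fun i _ => hF i).pow_const 2)
    (fun m n hmn t => pow_le_pow_left' (Finset.sum_le_sum_of_subset (Finset.range_mono hmn)) 2)]
  refine iSup_le fun n => ?_
  rw [← ENNReal.sqrt_le_iff]
  exact (lL2_sum_le _ hF).trans (ENNReal.sum_le_tsum _)

end MeasureTheory

/-! ### Polish distances -/

namespace DistSpace

universe u v w

/-- The distance of `X` is an honest, finite, complete and separable distance. -/
class IsPolish (X : DistSpace.{u}) : Prop where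
  edist_self : ∀ x, X.edist x x = 0
  edist_comm : ∀ x y, X.edist x y = X.edist y x
  edist_triangle : ∀ x y z, X.edist x z ≤ X.edist x y + X.edist y z
  eq_of_edist_eq_zero : ∀ {x y}, X.edist x y = 0 → x = y
  edist_ne_top : ∀ x y, X.edist x y ≠ ⊤
  exists_dense : ∃ s : Set X, s.Countable ∧ ∀ x, ∀ ε > 0, ∃ y ∈ s, X.edist x y < ε
  exists_limit : ∀ u : ℕ → X,
    (∀ ε > 0, ∃ N, ∀ m ≥ N, ∀ n ≥ N, X.edist (u m) (u n) < ε) →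
      ∃ x, ∀ ε > 0, ∃ N, ∀ n ≥ N, X.edist (u n) x < ε

section IsPolish

variable (X : DistSpace.{u}) [IsPolish X]

/-- The distance space `X`, as an `EMetricSpace`. Its topology is, by definition, the topology of
`DistSpace.instTopologicalSpace`. -/
noncomputable instance instEMetricSpace : EMetricSpace X :=
  letI m : PseudoEMetricSpace X :=
    { edist := X.edist
      edist_self := IsPolish.edist_self
      edist_comm := IsPolish.edist_comm
      edist_triangle := IsPolish.edist_triangle }
  have h : X.instTopologicalSpace = m.toUniformSpace.toTopologicalSpace := by
    refine TopologicalSpace.ext_iff.2 fun U => ?_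
    rw [EMetric.isOpen_iff]
    refine forall₂_congr fun x _ => exists_congr fun r => and_congr Iff.rfl ?_
    simp only [subset_def, Metric.mem_eball, mem_ofPred_eq]
    exact forall_congr' fun y => by rw [edist_comm]; rfl
  { edist := X.edist
    edist_self := IsPolish.edist_self
    edist_comm := IsPolish.edist_comm
    edist_triangle := IsPolish.edist_triangle
    toUniformSpace := m.toUniformSpace.replaceTopology h
    uniformity_edist := m.uniformity_edist
    eq_of_edist_eq_zero := IsPolish.eq_of_edist_eq_zero }

variable {X}

theorem edist_def (x y : X) : EDist.edist x y = X.edist x y := rfl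

theorem edist_ne_top (x y : X) : EDist.edist x y ≠ ⊤ := IsPolish.edist_ne_top x y

instance : SecondCountableTopology X := by
  obtain ⟨s, hs, hd⟩ := IsPolish.exists_dense (X := X)
  have : TopologicalSpace.SeparableSpace X := by
    refine ⟨s, hs, fun x => EMetric.mem_closure_iff.2 fun ε hε => ?_⟩
    exact hd x ε hε
  exact UniformSpace.secondCountable_of_separable X

instance : CompleteSpace X := by
  refine EMetric.complete_of_cauchySeq_tendsto fun u hu => ?_
  obtain ⟨x, hx⟩ := IsPolish.exists_limit u (EMetric.cauchySeq_iff.1 hu)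
  exact ⟨x, EMetric.tendsto_atTop.2 hx⟩

theorem NonexpMap.lipschitz {Y : DistSpace.{v}} [IsPolish Y] (f : NonexpMap X Y) :
    LipschitzWith 1 f.toFun := fun x y => by simpa using! f.edist_le x y

end IsPolish

end DistSpace

/-! ### Gluing of measures -/

namespace MeasureTheory

open ProbabilityTheory

/-- Two probability measures whose images in a common space coincide are the marginals of a
measure on the fibre product. -/
theorem exists_measure_fiberProduct {X Y₁ Y₂ : Type*} [MeasurableSpace X]
    [MeasurableEq X] [MeasurableSpace Y₁] [MeasurableSpace Y₂] [StandardBorelSpace Y₂]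
    {ν₁ : Measure Y₁} {ν₂ : Measure Y₂} [IsProbabilityMeasure ν₁] [IsProbabilityMeasure ν₂]
    {f₁ : Y₁ → X} {f₂ : Y₂ → X} (hf₁ : Measurable f₁) (hf₂ : Measurable f₂)
    (h : ν₁.map f₁ = ν₂.map f₂) :
    ∃ β : Measure (Y₁ × Y₂), IsProbabilityMeasure β ∧ β.map Prod.fst = ν₁ ∧
      β.map Prod.snd = ν₂ ∧ ∀ᵐ p ∂β, f₁ p.1 = f₂ p.2 := by
  have : Nonempty Y₂ := nonempty_of_isProbabilityMeasure ν₂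
  set ρ : Measure (X × Y₂) := ν₂.map (fun y => (f₂ y, y)) with hρ
  have hm : Measurable fun y => (f₂ y, y) := hf₂.prodMk measurable_id
  have : IsProbabilityMeasure ρ := Measure.isProbabilityMeasure_map hm.aemeasurable
  have hfst : ρ.fst = ν₂.map f₂ := by
    rw [Measure.fst, hρ, Measure.map_map measurable_fst hm]; rfl
  -- the law of `(f₁ y₁, y₂)` under `β` is the law of `(f₂ y₂, y₂)` under `ν₂`
  have key : (ν₁ ⊗ₘ (ρ.condKernel.comap f₁ hf₁)).map (Prod.map f₁ id) = ρ := by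
    conv_rhs => rw [← ρ.disintegrate ρ.condKernel, hfst, ← h]
    ext s hs
    rw [Measure.map_apply (hf₁.prodMap measurable_id) hs,
      Measure.compProd_apply (hf₁.prodMap measurable_id hs), Measure.compProd_apply hs,
      lintegral_map (Kernel.measurable_kernel_prodMk_left hs) hf₁]
    rfl
  refine ⟨ν₁ ⊗ₘ (ρ.condKernel.comap f₁ hf₁), inferInstance, Measure.fst_compProd _ _, ?_, ?_⟩
  · have h2 : ρ.map Prod.snd = ν₂ := by
      rw [hρ, Measure.map_map measurable_snd hm]; exact Measure.map_id
    refine Eq.trans ?_ ((congrArg (Measure.map Prod.snd) key).trans h2)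
    rw [Measure.map_map measurable_snd (hf₁.prodMap measurable_id)]
    rfl
  · have h3 : ∀ᵐ q ∂ρ, q.1 = f₂ q.2 := by
      have hs : MeasurableSet {q : X × Y₂ | q.1 = f₂ q.2} :=
        measurableSet_eq_fun measurable_fst (hf₂.comp measurable_snd)
      exact (ae_map_iff hm.aemeasurable hs).2 (.of_forall fun _ => rfl)
    rw [← key] at h3
    exact ae_of_ae_map (hf₁.prodMap measurable_id).aemeasurable h3

end MeasureTheory

/-! ### The Wasserstein distance -/

namespace DistSpace

universe u v w

variable {X : DistSpace.{u}}

instance (μ : X.P2) : IsProbabilityMeasure μ.1 := μ.2.1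

theorem wasserstein_le_lL2 {μ ν : Measure X} (θ : Measure (X × X)) (h₁ : θ.map Prod.fst = μ)
    (h₂ : θ.map Prod.snd = ν) : X.wasserstein μ ν ≤ lL2 θ (fun p => X.edist p.1 p.2) :=
  ENNReal.rpow_le_rpow (iInf₂_le θ ⟨h₁, h₂⟩) (by norm_num)

theorem exists_plan_of_wasserstein_lt {μ ν : Measure X} {r : ℝ≥0∞} (h : X.wasserstein μ ν < r) :
    ∃ θ : Measure (X × X), θ.map Prod.fst = μ ∧ θ.map Prod.snd = ν ∧
      lL2 θ (fun p => X.edist p.1 p.2) < r := by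
  rw [wasserstein, ENNReal.sqrt_lt_iff] at h
  simp only [iInf_lt_iff] at h
  obtain ⟨θ, hθ, hlt⟩ := h
  exact ⟨θ, hθ.1, hθ.2, ENNReal.sqrt_lt_iff.2 hlt⟩

theorem isProbabilityMeasure_of_map {α β : Type*} [MeasurableSpace α] [MeasurableSpace β]
    {θ : Measure α} {f : α → β} (hf : Measurable f) {μ : Measure β} [IsProbabilityMeasure μ]
    (h : θ.map f = μ) : IsProbabilityMeasure θ := by
  constructor
  rw [← preimage_univ (f := f), ← Measure.map_apply hf .univ, h, measure_univ]

variable [IsPolish X] {Ω : Type*} [MeasurableSpace Ω]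

theorem wasserstein_map_map_le {β : Measure Ω} {f g : Ω → X} (hf : Measurable f)
    (hg : Measurable g) :
    X.wasserstein (β.map f) (β.map g) ≤ lL2 β (fun t => EDist.edist (f t) (g t)) := by
  have hfg : Measurable fun t => (f t, g t) := hf.prodMk hg
  refine (wasserstein_le_lL2 (β.map fun t => (f t, g t)) ?_ ?_).trans_eq ?_
  · rw [Measure.map_map measurable_fst hfg]; rfl
  · rw [Measure.map_map measurable_snd hfg]; rfl
  · exact lL2_map hfg (h := fun p : X × X => EDist.edist p.1 p.2) (by fun_prop)

theorem wasserstein_self (μ : Measure X) : X.wasserstein μ μ = 0 := by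
  have h := wasserstein_map_map_le (β := μ) (f := id) (g := id) measurable_id measurable_id
  simpa [lL2] using h

theorem wasserstein_comm (μ ν : Measure X) : X.wasserstein μ ν = X.wasserstein ν μ := by
  suffices H : ∀ μ ν : Measure X, X.wasserstein μ ν ≤ X.wasserstein ν μ from
    le_antisymm (H _ _) (H _ _)
  intro μ ν
  refine le_of_forall_gt fun r hr => ?_
  obtain ⟨θ, h₁, h₂, hlt⟩ := exists_plan_of_wasserstein_lt hr
  refine lt_of_le_of_lt ?_ hlt
  rw [← h₁, ← h₂]
  refine (wasserstein_map_map_le measurable_snd measurable_fst).trans_eq ?_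
  congr 1; ext p; rw [edist_comm]; rfl

theorem wasserstein_triangle (μ ν ρ : Measure X) [IsProbabilityMeasure ν] :
    X.wasserstein μ ρ ≤ X.wasserstein μ ν + X.wasserstein ν ρ := by
  refine le_of_forall_gt fun r hr => ?_
  obtain ⟨a, ha, b, hb, hab⟩ := ENNReal.exists_add_lt_of_add_lt hr
  obtain ⟨θ, h₁, h₂, hθ⟩ := exists_plan_of_wasserstein_lt ha
  obtain ⟨θ', h₁', h₂', hθ'⟩ := exists_plan_of_wasserstein_lt hb
  have := isProbabilityMeasure_of_map measurable_snd h₂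
  have := isProbabilityMeasure_of_map measurable_fst h₁'
  obtain ⟨β, hβ, hβ₁, hβ₂, hβe⟩ := exists_measure_fiberProduct (ν₁ := θ) (ν₂ := θ')
    measurable_snd measurable_fst (h₂.trans h₁'.symm)
  have hd : Measurable fun p : X × X => EDist.edist p.1 p.2 := by fun_prop
  have e1 : μ = β.map (fun q => q.1.1) := by
    rw [← h₁, ← hβ₁, Measure.map_map measurable_fst measurable_fst]; rfl
  have e2 : ρ = β.map (fun q => q.2.2) := by
    rw [← h₂', ← hβ₂, Measure.map_map measurable_snd measurable_snd]; rfl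
  have hc : lL2 β (fun q => EDist.edist q.1.1 q.1.2) < a := by
    refine lt_of_eq_of_lt ?_ hθ
    rw [← hβ₁]
    exact (lL2_map measurable_fst hd).symm
  have hc' : lL2 β (fun q => EDist.edist q.2.1 q.2.2) < b := by
    refine lt_of_eq_of_lt ?_ hθ'
    rw [← hβ₂]
    exact (lL2_map measurable_snd hd).symm
  rw [e1, e2]
  refine (wasserstein_map_map_le (by fun_prop) (by fun_prop)).trans_lt
    (lt_of_le_of_lt ?_ hab)
  refine (lL2_mono_ae (g := fun q => EDist.edist q.1.1 q.1.2 + EDist.edist q.2.1 q.2.2) ?_).trans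
    ((lL2_add_le (by fun_prop) (by fun_prop)).trans (add_le_add hc.le hc'.le))
  filter_upwards [hβe] with q hq
  rw [← hq]
  exact edist_triangle _ _ _

theorem wasserstein_dirac (x₀ : X) (μ : Measure X) [IsProbabilityMeasure μ] :
    X.wasserstein (Measure.dirac x₀) μ = lL2 μ (fun x => EDist.edist x₀ x) := by
  apply le_antisymm
  · have h := wasserstein_map_map_le (β := μ) (f := fun _ => x₀) (g := id) measurable_const
      measurable_id
    simpa [Measure.map_const] using! h
  · refine le_of_forall_gt fun r hr => ?_
    obtain ⟨θ, h₁, h₂, hθ⟩ := exists_plan_of_wasserstein_lt hr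
    refine lt_of_eq_of_lt ?_ hθ
    rw [← h₂, lL2_map measurable_snd (by fun_prop)]
    have : ∀ᵐ p ∂θ, p.1 = x₀ := by
      have h : ∀ᵐ x ∂(Measure.dirac x₀ : Measure X), x = x₀ := by simp [ae_dirac_eq]
      rw [← h₁] at h
      exact ae_of_ae_map measurable_fst.aemeasurable h
    unfold lL2
    congr 1
    refine lintegral_congr_ae (this.mono fun p hp => ?_)
    dsimp only
    rw [← hp]; rfl

/-- The integral of a `C`-Lipschitz function is `C`-Lipschitz for the Wasserstein distance. -/
theorem lintegral_le_add_mul_wasserstein {g : X → ℝ≥0∞} (hg : Measurable g) {C : ℝ≥0∞}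
    (hC : C ≠ ⊤) (h : ∀ x y, g x ≤ g y + C * EDist.edist x y) {μ ν : Measure X}
    [IsProbabilityMeasure μ] (htop : X.wasserstein μ ν ≠ ⊤) :
    ∫⁻ x, g x ∂μ ≤ ∫⁻ x, g x ∂ν + C * X.wasserstein μ ν := by
  refine ENNReal.le_of_forall_pos_le_add fun ε hε _ => ?_
  obtain ⟨r, hr, hr'⟩ : ∃ r, X.wasserstein μ ν < r ∧ C * r ≤ C * X.wasserstein μ ν + ε := by
    refine ⟨X.wasserstein μ ν + ε / (C + 1), ENNReal.lt_add_right htop ?_, ?_⟩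
    · simp [hε.ne', hC]
    · rw [mul_add]
      gcongr
      rw [← mul_div_assoc, mul_comm, mul_div_assoc]
      exact mul_le_of_le_one_right' (ENNReal.div_le_of_le_mul (by simp))
  obtain ⟨θ, h₁, h₂, hθ⟩ := exists_plan_of_wasserstein_lt hr
  have := isProbabilityMeasure_of_map measurable_fst h₁
  calc ∫⁻ x, g x ∂μ = ∫⁻ p, g p.1 ∂θ := by rw [← h₁, lintegral_map hg measurable_fst]
    _ ≤ ∫⁻ p, g p.2 + C * EDist.edist p.1 p.2 ∂θ := lintegral_mono fun p => h _ _
    _ = ∫⁻ p, g p.2 ∂θ + C * ∫⁻ p, EDist.edist p.1 p.2 ∂θ := by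
      rw [lintegral_add_left (by fun_prop), lintegral_const_mul _ (by fun_prop)]
    _ ≤ ∫⁻ x, g x ∂ν + C * r := by
      rw [← h₂, lintegral_map hg measurable_snd]
      gcongr
      exact (lintegral_le_lL2 (by fun_prop)).trans hθ.le
    _ ≤ _ := by rw [add_assoc]; gcongr

end DistSpace

/-! ### Lower semicontinuity of integrals -/

namespace DistSpace

universe u v w

section LowerSemicontinuity

variable {X : DistSpace.{u}} [IsPolish X]

/-- The inf-convolution `x ↦ inf_y (c(y) + j d(x, y))`. It is the largest `j`-Lipschitz function
below `c`. -/
noncomputable def infConv (c : X → ℝ≥0∞) (j : ℕ) (x : X) : ℝ≥0∞ := ⨅ y, c y + j * EDist.edist x y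

theorem infConv_le_add (c : X → ℝ≥0∞) (j : ℕ) (x y : X) :
    infConv c j x ≤ infConv c j y + j * EDist.edist x y := by
  rw [infConv, infConv, ENNReal.iInf_add]
  refine le_iInf fun z => (iInf_le _ z).trans ?_
  rw [add_assoc, ← mul_add, add_comm (EDist.edist y z)]
  gcongr
  exact edist_triangle x y z

theorem measurable_infConv (c : X → ℝ≥0∞) (j : ℕ) : Measurable (infConv c j) :=
  (continuous_of_le_add_edist j (ENNReal.natCast_ne_top j) (infConv_le_add c j)).measurable

theorem infConv_mono (c : X → ℝ≥0∞) : Monotone (infConv c) := fun i j hij x =>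
  iInf_mono fun y => by gcongr

theorem iSup_infConv {c : X → ℝ≥0∞} (hc : LowerSemicontinuous c) (x : X) :
    ⨆ j, infConv c j x = c x := by
  apply le_antisymm
  · refine iSup_le fun j => (iInf_le _ x).trans ?_
    simp
  · refine le_of_forall_lt fun t ht => ?_
    obtain ⟨t', htt', ht'⟩ := exists_between ht
    refine htt'.trans_le ?_
    obtain ⟨r, hr, hball⟩ := EMetric.mem_nhds_iff.1 (hc x t' ht')
    obtain ⟨j, hj⟩ := ENNReal.exists_nat_mul_gt hr.ne' ht'.ne_top
    refine le_iSup_of_le j (le_iInf fun y => ?_)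
    rcases lt_or_ge (EDist.edist y x) r with h | h
    · exact (hball h).le.trans le_self_add
    · rw [edist_comm x y]
      exact (hj.le.trans (by gcongr)).trans le_add_self

theorem lintegral_eq_iSup_infConv {c : X → ℝ≥0∞} (hc : LowerSemicontinuous c) (μ : Measure X) :
    ∫⁻ x, c x ∂μ = ⨆ j, ∫⁻ x, infConv c j x ∂μ := by
  rw [← lintegral_iSup (measurable_infConv c) (infConv_mono c)]
  simp_rw [iSup_infConv hc]

/-- Integration of a lower semicontinuous function is lower semicontinuous: it is a supremum of
integrals of Lipschitz functions, which are continuous for the Wasserstein distance. -/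
theorem lowerSemicontinuous_lintegral {c : X → ℝ≥0∞} (hc : LowerSemicontinuous c) :
    LowerSemicontinuous (fun μ : X.P2 => ∫⁻ x, c x ∂μ.1) := by
  refine lowerSemicontinuous_iff_isOpen_preimage.2 fun t => ?_
  intro μ hμ
  change t < ∫⁻ x, c x ∂μ.1 at hμ
  rw [lintegral_eq_iSup_infConv hc, lt_iSup_iff] at hμ
  obtain ⟨j, hj⟩ := hμ
  obtain ⟨ε, hε, hlt⟩ : ∃ ε : ℝ≥0∞, 0 < ε ∧ t + j * ε < ∫⁻ x, infConv c j x ∂μ.1 := by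
    obtain ⟨b, hb, hb'⟩ := ENNReal.lt_iff_exists_add_pos_lt.1 hj
    refine ⟨b / (j + 1), ENNReal.div_pos (by simpa using hb.ne') (by finiteness), ?_⟩
    refine lt_of_le_of_lt ?_ hb'
    gcongr
    rw [← mul_div_assoc, mul_comm, mul_div_assoc]
    exact mul_le_of_le_one_right' (ENNReal.div_le_of_le_mul (by simp))
  refine ⟨ε, hε, fun ν hν => ?_⟩
  change t < ∫⁻ x, c x ∂ν.1
  change X.wasserstein μ.1 ν.1 < ε at hν
  rw [lintegral_eq_iSup_infConv hc, lt_iSup_iff]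
  refine ⟨j, ?_⟩
  have h := lintegral_le_add_mul_wasserstein (measurable_infConv c j) (ENNReal.natCast_ne_top j)
    (infConv_le_add c j) hν.ne_top
  have h' := (hlt.trans_le h).trans_le (add_le_add_right (mul_le_mul_right hν.le _) _)
  exact (ENNReal.add_lt_add_iff_right (by
    intro htop
    rw [htop] at hlt
    simp at hlt)).1 h'

theorem lintegral_le_of_wasserstein_eq_zero {c : X → ℝ≥0∞} (hc : LowerSemicontinuous c)
    {μ ν : Measure X} [IsProbabilityMeasure μ] (h : X.wasserstein μ ν = 0) :
    ∫⁻ x, c x ∂μ ≤ ∫⁻ x, c x ∂ν := by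
  rw [lintegral_eq_iSup_infConv hc, lintegral_eq_iSup_infConv hc]
  refine iSup_mono fun j => ?_
  simpa [h] using lintegral_le_add_mul_wasserstein (measurable_infConv c j)
    (ENNReal.natCast_ne_top j) (infConv_le_add c j) (μ := μ) (ν := ν) (by simp [h])

/-- Since the cost of a plan is an infimum not known to be attained here, this is derived from the
integrals of the indicators of open sets, which are lower semicontinuous. -/
theorem eq_of_wasserstein_eq_zero {μ ν : Measure X} [IsProbabilityMeasure μ]
    [IsProbabilityMeasure ν] (h : X.wasserstein μ ν = 0) : μ = ν := by
  have key : ∀ (μ ν : Measure X) [IsProbabilityMeasure μ], X.wasserstein μ ν = 0 →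
      ∀ U, IsOpen U → μ U ≤ ν U := by
    intro μ ν _ h U hU
    have := lintegral_le_of_wasserstein_eq_zero
      (hU.lowerSemicontinuous_indicator (zero_le (a := (1 : ℝ≥0∞)))) h
    simpa [lintegral_indicator hU.measurableSet] using this
  refine ext_of_generate_finite {U | IsOpen U} rfl
    isPiSystem_isOpen (fun U hU => ?_) (by simp)
  exact le_antisymm (key _ _ h U hU) (key _ _ (wasserstein_comm μ ν ▸ h) U hU)

end LowerSemicontinuity

/-! ### Finitely supported measures -/

section Net

variable {X : DistSpace.{u}} [IsPolish X]

theorem lL2_edist_ne_top (μ : X.P2) (x₀ : X) : lL2 μ.1 (fun x => EDist.edist x₀ x) ≠ ⊤ := by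
  obtain ⟨μ, hμ, x₁, hx₁⟩ := μ
  have h1 : lL2 μ (fun x => EDist.edist x₁ x) ≠ ⊤ := lL2_ne_top_iff.2 hx₁
  refine ne_top_of_le_ne_top (b := EDist.edist x₀ x₁ + lL2 μ (fun x => EDist.edist x₁ x))
    (ENNReal.add_ne_top.2 ⟨edist_ne_top _ _, h1⟩) ?_
  refine (lL2_mono fun x => edist_triangle x₀ x₁ x).trans ((lL2_add_le (by fun_prop)
    (by fun_prop)).trans_eq ?_)
  rw [lL2_const]

theorem exists_P2 {β : Type*} [MeasurableSpace β] (μ : Measure β) [IsProbabilityMeasure μ]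
    {f : β → X} (hf : Measurable f) {x₀ : X}
    (h : lL2 μ (fun t => EDist.edist x₀ (f t)) ≠ ⊤) : ∃ ν : X.P2, ν.1 = μ.map f := by
  refine ⟨⟨μ.map f, Measure.isProbabilityMeasure_map hf.aemeasurable, x₀, ?_⟩, rfl⟩
  rw [lL2_ne_top_iff] at h
  exact (lintegral_map (f := fun x => EDist.edist x₀ x ^ 2) (by fun_prop) hf).trans_lt h

/-- If `μ ≥ c ν`, then all of `c ν` may stay in place when `μ` is transported to `ν`. -/
theorem wasserstein_sq_le_of_eq_add {μ ν ρ : Measure X} [IsProbabilityMeasure μ]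
    [IsProbabilityMeasure ν] [IsFiniteMeasure ρ] {c : ℝ≥0∞} (h : μ = c • ν + ρ) :
    X.wasserstein μ ν ^ 2 ≤ ∫⁻ x, ∫⁻ y, EDist.edist x y ^ 2 ∂ν ∂ρ := by
  have h1 : c + ρ univ = 1 := by
    have := congrArg (fun m : Measure X => m univ) h
    simpa using this.symm
  have hd : Measurable fun x : X => (x, x) := by fun_prop
  have hle := wasserstein_le_lL2 (μ := μ) (ν := ν) (c • ν.map (fun x => (x, x)) + ρ.prod ν) ?_ ?_
  · refine (pow_le_pow_left' hle 2).trans_eq ?_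
    have hm : Measurable fun p : X × X => X.edist p.1 p.2 ^ 2 :=
      (measurable_edist (α := X)).pow_const 2
    rw [lL2_sq, lintegral_add_measure, lintegral_smul_measure, lintegral_map hm hd,
      lintegral_prod _ hm.aemeasurable]
    simp [IsPolish.edist_self, edist_def]
  · rw [Measure.map_add _ _ measurable_fst, Measure.map_smul, Measure.map_map measurable_fst hd,
      Measure.map_fst_prod, measure_univ, one_smul, h]
    congr 2; exact Measure.map_id
  · rw [Measure.map_add _ _ measurable_snd, Measure.map_smul, Measure.map_map measurable_snd hd,
      Measure.map_snd_prod]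
    have : ν.map (Prod.snd ∘ fun x => (x, x)) = ν := Measure.map_id
    rw [this, ← add_smul, h1, one_smul]

/-- The probability measure on `X` with weights `w` at the points `e`. -/
noncomputable def weighted {n : ℕ} (e : Fin n → X) (w : Fin n → ℝ) : Measure X :=
  ∑ i, ENNReal.ofReal (w i) • Measure.dirac (e i)

theorem isProbabilityMeasure_weighted {X : DistSpace.{u}} {n : ℕ} (e : Fin n → X) {w : Fin n → ℝ}
    (hw : w ∈ stdSimplex ℝ (Fin n)) : IsProbabilityMeasure (weighted e w) := by
  constructor
  simp only [weighted, Measure.coe_finsetSum, Finset.sum_apply, Measure.smul_apply, measure_univ,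
    smul_eq_mul, mul_one]
  rw [← ENNReal.ofReal_sum_of_nonneg fun i _ => hw.1 i, hw.2, ENNReal.ofReal_one]

/-- If the weights `a` exceed a fraction `1 - δ` of the weights `b`, then only mass `δ` has to be
moved, over distances at most `D`. -/
theorem wasserstein_weighted_sq_le {n : ℕ} (e : Fin n → X) {a b : Fin n → ℝ}
    (ha : a ∈ stdSimplex ℝ (Fin n)) (hb : b ∈ stdSimplex ℝ (Fin n)) {δ : ℝ}
    (hδ1 : δ ≤ 1) (hab : ∀ i, (1 - δ) * b i ≤ a i) {D : ℝ≥0∞}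
    (hD : ∀ i j, EDist.edist (e i) (e j) ≤ D) :
    X.wasserstein (weighted e a) (weighted e b) ^ 2 ≤ ENNReal.ofReal δ * D ^ 2 := by
  have := isProbabilityMeasure_weighted e ha
  have := isProbabilityMeasure_weighted e hb
  set r : Fin n → ℝ := fun i => a i - (1 - δ) * b i with hr
  have hr0 : ∀ i, 0 ≤ r i := fun i => sub_nonneg.2 (hab i)
  have hrs : ∑ i, r i = δ := by
    simp only [hr, Finset.sum_sub_distrib, ← Finset.mul_sum, ha.2, hb.2]; ring
  have hfin : IsFiniteMeasure (weighted e r) := by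
    constructor
    simp only [weighted, Measure.coe_finsetSum, Finset.sum_apply, Measure.smul_apply,
      measure_univ, smul_eq_mul, mul_one]
    exact ENNReal.sum_lt_top.2 fun i _ => ENNReal.ofReal_lt_top
  have h : weighted e a = ENNReal.ofReal (1 - δ) • weighted e b + weighted e r := by
    simp only [weighted, Finset.smul_sum, ← Finset.sum_add_distrib, smul_smul, ← add_smul]
    refine Finset.sum_congr rfl fun i _ => ?_
    rw [← ENNReal.ofReal_mul (by linarith),
      ← ENNReal.ofReal_add (mul_nonneg (by linarith) (hb.1 i)) (hr0 i)]
    congr 2; simp [hr]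
  refine (wasserstein_sq_le_of_eq_add h).trans ?_
  have hm : ∀ x, Measurable fun y : X => EDist.edist x y ^ 2 := fun x => by fun_prop
  have hm' : Measurable fun x : X => ∫⁻ y, EDist.edist x y ^ 2 ∂(weighted e b) :=
    Measurable.lintegral_prod_right' (f := fun p : X × X => EDist.edist p.1 p.2 ^ 2) (by fun_prop)
  have hin : ∀ i, ∫⁻ y, EDist.edist (e i) y ^ 2 ∂(weighted e b) ≤ D ^ 2 := by
    intro i
    rw [weighted, lintegral_finsetSum_measure]
    simp only [lintegral_smul_measure, lintegral_dirac' _ (hm _)]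
    calc ∑ j, ENNReal.ofReal (b j) • EDist.edist (e i) (e j) ^ 2
        ≤ ∑ j, ENNReal.ofReal (b j) * D ^ 2 := by
          refine Finset.sum_le_sum fun j _ => ?_
          rw [smul_eq_mul]; gcongr; exact hD i j
      _ = D ^ 2 := by
          rw [← Finset.sum_mul, ← ENNReal.ofReal_sum_of_nonneg fun i _ => hb.1 i, hb.2]; simp
  rw [weighted, lintegral_finsetSum_measure]
  simp only [lintegral_smul_measure, lintegral_dirac' _ hm']
  calc _ ≤ ∑ i, ENNReal.ofReal (r i) * D ^ 2 := by
        refine Finset.sum_le_sum fun j _ => ?_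
        rw [smul_eq_mul]; gcongr; exact hin j
    _ = _ := by rw [← Finset.sum_mul, ← ENNReal.ofReal_sum_of_nonneg fun i _ => hr0 i, hrs]

/-- The measures supported in a given finite set are totally bounded for the Wasserstein
distance. -/
theorem exists_finite_net_weighted {n : ℕ} (e : Fin n → X) {ε : ℝ≥0∞} (hε : 0 < ε) :
    ∃ t : Finset (Fin n → ℝ), (∀ b ∈ t, b ∈ stdSimplex ℝ (Fin n)) ∧
      ∀ a ∈ stdSimplex ℝ (Fin n), ∃ b ∈ t, X.wasserstein (weighted e a) (weighted e b) < ε := by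
  set D : ℝ≥0∞ := ∑ i, ∑ j, EDist.edist (e i) (e j) with hD
  have hDtop : D ≠ ⊤ := ENNReal.sum_ne_top.2 fun i _ => ENNReal.sum_ne_top.2 fun j _ =>
    edist_ne_top _ _
  have hDle : ∀ i j, EDist.edist (e i) (e j) ≤ D := fun i j =>
    (Finset.single_le_sum (f := fun j => EDist.edist (e i) (e j)) (fun _ _ => zero_le)
      (Finset.mem_univ j)).trans (Finset.single_le_sum
        (f := fun i => ∑ j, EDist.edist (e i) (e j)) (fun _ _ => zero_le) (Finset.mem_univ i))
  obtain ⟨δ, hδ, hδ1, hlt⟩ : ∃ δ : ℝ, 0 < δ ∧ δ ≤ 1 ∧ ENNReal.ofReal δ * D ^ 2 < ε ^ 2 := by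
    have h : Filter.Tendsto (fun δ : ℝ => ENNReal.ofReal δ * D ^ 2) (nhdsWithin 0 (Ioi 0))
        (nhds (ENNReal.ofReal 0 * D ^ 2)) := by
      refine (ENNReal.Tendsto.mul_const (ENNReal.tendsto_ofReal Filter.tendsto_id)
        (Or.inr ?_)).mono_left nhdsWithin_le_nhds
      finiteness
    have hev := h.eventually_lt_const (u := ε ^ 2) (by simpa using (ENNReal.pow_pos hε 2))
    obtain ⟨δ, h1, h2⟩ := (hev.and (Ioc_mem_nhdsGT one_pos)).exists
    exact ⟨δ, h2.1, h2.2, h1⟩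
  -- the sets `{a | (1 - δ) b ≤ a}` are neighbourhoods of `b` in the simplex, which is compact
  obtain ⟨t, ht, hcov⟩ := (isCompact_stdSimplex ℝ (Fin n)).elim_nhds_subcover
    (fun b => {a | ∀ i, b i = 0 ∨ (1 - δ) * b i < a i}) (fun b hb => by
      refine IsOpen.mem_nhds ?_ fun i => ?_
      · simp only [ofPred_forall, ofPred_or]
        exact isOpen_iInter_of_finite fun i => isOpen_const.union
          (isOpen_lt continuous_const (continuous_apply i))
      · rcases (hb.1 i).eq_or_lt with h | h
        · exact Or.inl h.symm
        · right; nlinarith)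
  refine ⟨t, ht, fun a ha => ?_⟩
  obtain ⟨b, hb, hab⟩ := mem_iUnion₂.1 (hcov ha)
  refine ⟨b, hb, ?_⟩
  have h := wasserstein_weighted_sq_le e ha (ht b hb) hδ1 (fun i => ?_) hDle
  · exact (ENNReal.pow_lt_pow_left_iff two_ne_zero).1 (h.trans_lt hlt)
  · rcases hab i with h | h
    · rw [h, mul_zero]; exact ha.1 i
    · exact h.le

end Net
end DistSpace

/-! ### The Wasserstein space is Polish -/

namespace DistSpace

universe u v w

section Complete

open ProbabilityTheory

variable {X : DistSpace.{u}} [IsPolish X]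

/-- A sequence of probability measures, with prescribed transport plans between consecutive
terms, is the sequence of marginals of a stochastic process. -/
theorem exists_process (μ : ℕ → Measure X) [∀ n, IsProbabilityMeasure (μ n)]
    (θ : ℕ → Measure (X × X)) (h₁ : ∀ n, (θ n).map Prod.fst = μ n)
    (h₂ : ∀ n, (θ n).map Prod.snd = μ (n + 1)) :
    ∃ P : Measure (ℕ → X), IsProbabilityMeasure P ∧ (∀ n, P.map (fun x => x n) = μ n) ∧
      ∀ n, P.map (fun x => (x n, x (n + 1))) = θ n := by
  have : Nonempty X := nonempty_of_isProbabilityMeasure (μ 0)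
  have := fun n => isProbabilityMeasure_of_map measurable_fst (h₁ n)
  -- a Markov chain whose `n`-th transition kernel is the disintegration of `θ n`
  let κ : (n : ℕ) → Kernel (Π _ : Finset.Iic n, X) X := fun n =>
    (θ n).condKernel.comap (fun x => x ⟨n, Finset.mem_Iic.2 le_rfl⟩) (measurable_pi_apply _)
  have : ∀ n, IsMarkovKernel (κ n) := fun n => by dsimp only [κ]; infer_instance
  let P := Kernel.trajMeasure (X := fun _ => X) (μ 0) κ
  have hP : IsProbabilityMeasure P := by dsimp only [P]; infer_instance
  have step : ∀ n, P.map (fun x => x n) = μ n → P.map (fun x => (x n, x (n + 1))) = θ n := by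
    intro n hn
    have h := Kernel.map_frestrictLe_trajMeasure_compProd_eq_map_trajMeasure (X := fun _ => X)
      (κ := κ) (μ₀ := μ 0) (a := n)
    have hev : Measurable fun x : Π _ : Finset.Iic n, X => x ⟨n, Finset.mem_Iic.2 le_rfl⟩ :=
      measurable_pi_apply _
    have h' := congrArg (Measure.map (Prod.map
      (fun x : Π _ : Finset.Iic n, X => x ⟨n, Finset.mem_Iic.2 le_rfl⟩) id)) h
    rw [Measure.map_map (hev.prodMap measurable_id) (by fun_prop)] at h'
    refine h'.symm.trans ?_
    have hlaw : (P.map (Preorder.frestrictLe n : (ℕ → X) → Π _ : Finset.Iic n, X)).map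
        (fun x => x ⟨n, Finset.mem_Iic.2 le_rfl⟩) = (θ n).fst := by
      rw [Measure.map_map hev (by fun_prop), Measure.fst, h₁, ← hn]; rfl
    conv_rhs => rw [← (θ n).disintegrate (θ n).condKernel, ← hlaw]
    ext s hs
    rw [Measure.map_apply (hev.prodMap measurable_id) hs,
      Measure.compProd_apply (hev.prodMap measurable_id hs), Measure.compProd_apply hs,
      lintegral_map (Kernel.measurable_kernel_prodMk_left hs) hev]
    rfl
  have law : ∀ n, P.map (fun x => x n) = μ n := by
    intro n
    induction n with
    | zero =>
      have hev : Measurable fun x : Π _ : Finset.Iic 0, X => x ⟨0, Finset.mem_Iic.2 le_rfl⟩ :=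
        measurable_pi_apply _
      have h0 : P.map (Preorder.frestrictLe 0 : (ℕ → X) → Π _ : Finset.Iic 0, X) =
          (μ 0).map (MeasurableEquiv.piUnique fun _ : Finset.Iic 0 => (X : Type u)).symm := by
        dsimp only [P]
        rw [Kernel.trajMeasure, Measure.map_comp _ _ (by fun_prop), Kernel.traj_map_frestrictLe,
          Kernel.partialTraj_self, Measure.id_comp]
      have h := congrArg (Measure.map
        (fun x : Π _ : Finset.Iic 0, X => x ⟨0, Finset.mem_Iic.2 le_rfl⟩)) h0
      rw [Measure.map_map hev (by fun_prop), Measure.map_map hev (by fun_prop)] at h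
      exact h.trans Measure.map_id
    | succ n ih =>
      rw [← h₂ n, ← step n ih, Measure.map_map measurable_snd
        (show Measurable fun x : ℕ → X => (x n, x (n + 1)) by fun_prop)]
      rfl
  exact ⟨P, hP, law, fun n => step n (law n)⟩

/-- A fast Cauchy sequence of measures converges: realize it by a process with `L²`-summable
increments, and take the law of the limit. -/
theorem exists_limit_P2 (μ : ℕ → X.P2)
    (hμ : ∀ n, X.wasserstein (μ n).1 (μ (n + 1)).1 < 2⁻¹ ^ n) :
    ∃ ν : X.P2, Filter.Tendsto (fun n => X.wasserstein (μ n).1 ν.1) Filter.atTop (nhds 0) := by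
  choose θ h₁ h₂ hθ using fun n => exists_plan_of_wasserstein_lt (hμ n)
  obtain ⟨P, hP, law, law2⟩ := exists_process (fun n => (μ n).1) θ h₁ h₂
  have : Nonempty X := nonempty_of_isProbabilityMeasure (μ 0).1
  have hinc : ∀ n, lL2 P (fun x => EDist.edist (x n) (x (n + 1))) ≤ 2⁻¹ ^ n := by
    intro n
    refine le_trans (le_of_eq ?_) (hθ n).le
    rw [← law2 n]
    exact (lL2_map (h := fun p : X × X => EDist.edist p.1 p.2)
      (show Measurable fun x : ℕ → X => (x n, x (n + 1)) by fun_prop) (by fun_prop)).symm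
  have htail : ∀ n, lL2 P (fun x => ∑' m, EDist.edist (x (n + m)) (x (n + m + 1))) ≤
      2 * 2⁻¹ ^ n := by
    intro n
    refine (lL2_tsum_le fun m => by fun_prop).trans
      ((ENNReal.tsum_le_tsum fun m => hinc (n + m)).trans_eq ?_)
    simp_rw [pow_add]
    rw [ENNReal.tsum_mul_left, ENNReal.tsum_geometric, ENNReal.one_sub_inv_two, inv_inv, mul_comm]
  have hfin : ∀ᵐ x ∂P, ∑' m, EDist.edist (x m) (x (m + 1)) ≠ ⊤ := by
    have h := htail 0
    simp only [zero_add, pow_zero, mul_one] at h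
    have hne := lL2_ne_top_iff.1 (ne_top_of_le_ne_top (by simp) h)
    filter_upwards [ae_lt_top (by fun_prop) hne.ne] with x hx
    intro htop
    simp [htop] at hx
  obtain ⟨f, hf, hlim⟩ := measurable_limit_of_tendsto_metrizable_ae (μ := P)
    (f := fun (n : ℕ) (x : ℕ → X) => x n) (L := Filter.atTop)
    (fun n => (measurable_pi_apply n).aemeasurable)
    (hfin.mono fun x hx => cauchySeq_tendsto_of_complete
      (cauchySeq_of_edist_le_of_tsum_ne_top _ (fun n => le_rfl) hx))
  have hdist : ∀ n, lL2 P (fun x => EDist.edist (x n) (f x)) ≤ 2 * 2⁻¹ ^ n := fun n =>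
    (lL2_mono_ae (hlim.mono fun x hx =>
      edist_le_tsum_of_edist_le_of_tendsto _ (fun n => le_rfl) hx n)).trans (htail n)
  obtain ⟨x₀⟩ := this
  obtain ⟨ν, hν⟩ := exists_P2 P hf (x₀ := x₀) (by
    refine ne_top_of_le_ne_top (ENNReal.add_ne_top.2 ⟨lL2_edist_ne_top (μ 0) x₀, ?_⟩)
      ((lL2_mono fun x => edist_triangle x₀ (x 0) (f x)).trans
        ((lL2_add_le (by fun_prop) (by fun_prop)).trans
          (add_le_add (le_of_eq ?_) (hdist 0))))
    · simp
    · rw [← law 0, lL2_map (by fun_prop) (by fun_prop)])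
  refine ⟨ν, tendsto_of_tendsto_of_tendsto_of_le_of_le (h := fun n : ℕ => (2 : ℝ≥0∞) * 2⁻¹ ^ n)
    tendsto_const_nhds ?_ (fun _ => zero_le) fun n => ?_⟩
  · have h := ENNReal.Tendsto.const_mul (a := 2) (ENNReal.tendsto_pow_atTop_nhds_zero_of_lt_one
      (r := 2⁻¹) (by simp)) (Or.inr (by simp))
    simpa using h
  · rw [hν, ← law n]
    exact (wasserstein_map_map_le (by fun_prop) hf).trans (hdist n)

end Complete

section Net

variable (X : DistSpace.{u}) [IsPolish X] [Nonempty X]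

/-- The `n`-th point of a dense sequence. -/
noncomputable def pt (n : ℕ) : X := TopologicalSpace.denseSeq X n

/-- The closest to `x` among the first `N + 1` points of the dense sequence `X.pt`. -/
noncomputable def proj (N : ℕ) : SimpleFunc X X := SimpleFunc.nearestPt X.pt N

/-- The distance to the first `N + 1` points of the dense sequence `X.pt`. -/
noncomputable def netDist (N : ℕ) (x : X) : ℝ≥0∞ := EDist.edist (X.proj N x) x

variable {X}

theorem measurable_netDist (N : ℕ) : Measurable (X.netDist N) :=
  (X.proj N).measurable.edist measurable_id

theorem exists_proj_eq (N : ℕ) (x : X) : ∃ k ≤ N, X.proj N x = X.pt k :=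
  ⟨_, SimpleFunc.nearestPtInd_le _ _ _, rfl⟩

theorem netDist_le_edist {k N : ℕ} (hk : k ≤ N) (x : X) : X.netDist N x ≤ EDist.edist (X.pt k) x :=
  SimpleFunc.edist_nearestPt_le _ _ hk

theorem netDist_le_add (N : ℕ) (x y : X) : X.netDist N x ≤ X.netDist N y + EDist.edist x y := by
  obtain ⟨k, hk, he⟩ := exists_proj_eq N y
  refine (netDist_le_edist hk x).trans ?_
  rw [netDist, he, edist_comm x y]
  exact edist_triangle _ _ _

theorem tendsto_netDist (x : X) :
    Filter.Tendsto (fun N => X.netDist N x) Filter.atTop (nhds 0) := by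
  have h : Filter.Tendsto (fun N => X.proj N x) Filter.atTop (nhds x) :=
    SimpleFunc.tendsto_nearestPt (TopologicalSpace.denseRange_denseSeq X x)
  exact tendsto_iff_edist_tendsto_0.1 h

theorem tendsto_lL2_netDist (μ : X.P2) :
    Filter.Tendsto (fun N => lL2 μ.1 (X.netDist N)) Filter.atTop (nhds 0) := by
  have h := tendsto_lintegral_of_dominated_convergence (μ := μ.1)
    (F := fun N x => X.netDist N x ^ 2) (f := fun _ => 0) (fun x => EDist.edist (X.pt 0) x ^ 2)
    (fun N => (measurable_netDist N).pow_const 2)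
    (fun N => .of_forall fun x => pow_le_pow_left' (netDist_le_edist (zero_le) x) 2)
    (lL2_ne_top_iff.1 (lL2_edist_ne_top μ (X.pt 0))).ne
    (.of_forall fun x => by
      simpa [Function.comp_def] using
        ((ENNReal.continuous_pow 2).tendsto _).comp (tendsto_netDist x))
  have h2 := ((ENNReal.continuous_rpow_const (y := 1 / 2)).tendsto _).comp h
  simpa [Function.comp_def, lL2] using h2

theorem map_proj_eq_weighted (μ : Measure X) [IsProbabilityMeasure μ] (N : ℕ) :
    ∃ w ∈ stdSimplex ℝ (Fin (N + 1)),
      μ.map (X.proj N) = weighted (fun i : Fin (N + 1) => X.pt i) w := by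
  let I : X → Fin (N + 1) := fun x => Fin.ofNat (N + 1) (SimpleFunc.nearestPtInd X.pt N x)
  have hI : Measurable I :=
    (measurable_of_countable (Fin.ofNat (N + 1))).comp (SimpleFunc.measurable _)
  have hproj : (X.proj N : X → X) = (fun i : Fin (N + 1) => X.pt i) ∘ I := by
    funext x
    have : ((I x : Fin (N + 1)) : ℕ) = SimpleFunc.nearestPtInd X.pt N x :=
      Nat.mod_eq_of_lt (Nat.lt_succ_of_le (SimpleFunc.nearestPtInd_le _ _ _))
    rw [Function.comp_apply, this]; rfl
  have hP : IsProbabilityMeasure (μ.map I) := Measure.isProbabilityMeasure_map hI.aemeasurable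
  refine ⟨fun i => (μ.map I).real {i}, ⟨fun i => measureReal_nonneg, ?_⟩, ?_⟩
  · simp
  · have he : Measurable fun i : Fin (N + 1) => X.pt i := measurable_of_countable _
    rw [hproj, ← Measure.map_map he hI, weighted]
    conv_lhs => rw [← Measure.sum_smul_dirac (μ.map I), Measure.sum_fintype,
      ← Measure.mapₗ_apply_of_measurable he, map_sum]
    refine Finset.sum_congr rfl fun i _ => ?_
    rw [map_smul, Measure.mapₗ_apply_of_measurable he, Measure.map_dirac' he,
      ofReal_measureReal]

variable (X) in
/-- The measures supported by the first `N + 1` points of `X.pt` have finite nets, and the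
Wasserstein distance from `μ` to its projection on them is at most the `L²` norm of `X.netDist N`.
-/
theorem exists_finite_net (N : ℕ) {ε : ℝ≥0∞} (hε : 0 < ε) :
    ∃ t : Set X.P2, t.Finite ∧
      ∀ μ : X.P2, ∃ ν ∈ t, X.wasserstein μ.1 ν.1 < lL2 μ.1 (X.netDist N) + ε := by
  obtain ⟨t, ht, hcov⟩ := exists_finite_net_weighted (fun i : Fin (N + 1) => X.pt i) hε
  have hmem : ∀ b ∈ t, ∃ ν : X.P2, ν.1 = weighted (fun i : Fin (N + 1) => X.pt i) b := by
    intro b hb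
    refine ⟨⟨_, isProbabilityMeasure_weighted _ (ht b hb), X.pt 0, ?_⟩, rfl⟩
    rw [weighted, lintegral_finsetSum_measure]
    refine ENNReal.sum_lt_top.2 fun i _ => ?_
    have hd := lintegral_dirac' (X.pt i) (f := fun x => EDist.edist (X.pt 0) x ^ 2) (by fun_prop)
    rw [lintegral_smul_measure]
    refine ENNReal.mul_lt_top ENNReal.ofReal_lt_top (hd.trans_lt ?_)
    exact ENNReal.pow_lt_top (edist_ne_top _ _).lt_top
  choose F hF using hmem
  refine ⟨range fun b : t => F b.1 b.2, finite_range _, fun μ => ?_⟩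
  obtain ⟨w, hw, hμw⟩ := map_proj_eq_weighted μ.1 N
  obtain ⟨b, hb, hlt⟩ := hcov w hw
  refine ⟨F b hb, ⟨⟨b, hb⟩, rfl⟩, ?_⟩
  rw [hF b hb]
  have : IsProbabilityMeasure (weighted (fun i : Fin (N + 1) => X.pt i) w) :=
    isProbabilityMeasure_weighted _ hw
  have h1 : X.wasserstein μ.1 (weighted (fun i : Fin (N + 1) => X.pt i) w) ≤
      lL2 μ.1 (X.netDist N) := by
    rw [← hμw, wasserstein_comm]
    refine le_of_eq_of_le ?_
      (wasserstein_map_map_le (g := id) (X.proj N).measurable measurable_id)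
    rw [Measure.map_id]
  have h2 : lL2 μ.1 (X.netDist N) ≠ ⊤ := ne_top_of_le_ne_top (lL2_edist_ne_top μ (X.pt 0))
    (lL2_mono fun x => netDist_le_edist zero_le x)
  exact (wasserstein_triangle _ _ _).trans_lt
    (ENNReal.add_lt_add_of_le_of_lt (ne_top_of_le_ne_top h2 h1) h1 hlt)

/-- `μ ↦ ‖netDist N‖_{L²(μ)}` is nonexpansive for the Wasserstein distance. -/
theorem lL2_netDist_le_add (N : ℕ) {μ ν : Measure X} [IsProbabilityMeasure μ] :
    lL2 μ (X.netDist N) ≤ lL2 ν (X.netDist N) + X.wasserstein μ ν := by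
  rcases eq_or_ne (X.wasserstein μ ν) ⊤ with h | h
  · simp [h]
  refine ENNReal.le_of_forall_pos_le_add fun ε hε _ => ?_
  obtain ⟨θ, h₁, h₂, hθ⟩ := exists_plan_of_wasserstein_lt
    (ENNReal.lt_add_right h (ENNReal.coe_pos.2 hε).ne')
  have hm := measurable_netDist (X := X) N
  calc lL2 μ (X.netDist N) = lL2 θ (fun p => X.netDist N p.1) := by
        rw [← lL2_map measurable_fst hm, h₁]
    _ ≤ lL2 θ (fun p => X.netDist N p.2 + EDist.edist p.1 p.2) :=
        lL2_mono fun p => netDist_le_add N p.1 p.2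
    _ ≤ lL2 θ (fun p => X.netDist N p.2) + lL2 θ (fun p => EDist.edist p.1 p.2) :=
        lL2_add_le (hm.comp measurable_snd) (by fun_prop)
    _ ≤ lL2 ν (X.netDist N) + (X.wasserstein μ ν + ε) := by
        rw [← lL2_map measurable_snd hm, h₂]
        exact add_le_add_right hθ.le _
    _ = _ := (add_assoc _ _ _).symm

end Net

instance instIsPolishP2 (X : DistSpace.{u}) [IsPolish X] : IsPolish X.P2 where
  edist_self μ := wasserstein_self μ.1
  edist_comm μ ν := wasserstein_comm μ.1 ν.1
  edist_triangle μ ν ρ := wasserstein_triangle μ.1 ν.1 ρ.1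
  eq_of_edist_eq_zero h := Subtype.ext (eq_of_wasserstein_eq_zero h)
  edist_ne_top μ ν := by
    obtain ⟨x₀⟩ : Nonempty X := nonempty_of_isProbabilityMeasure μ.1
    refine ne_top_of_le_ne_top (ENNReal.add_ne_top.2 ⟨lL2_edist_ne_top μ x₀,
      lL2_edist_ne_top ν x₀⟩) ((wasserstein_triangle μ.1 (Measure.dirac x₀) ν.1).trans_eq ?_)
    rw [wasserstein_comm μ.1, wasserstein_dirac, wasserstein_dirac]
  exists_dense := by
    rcases isEmpty_or_nonempty X with hX | hX
    · exact ⟨∅, countable_empty, fun μ => absurd (nonempty_of_isProbabilityMeasure μ.1)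
        (not_nonempty_iff.2 hX)⟩
    choose t ht hcov using fun N k : ℕ =>
      exists_finite_net X N (ε := ((k : ℝ≥0∞) + 1)⁻¹) (by simp)
    refine ⟨⋃ N, ⋃ k, t N k, countable_iUnion fun N => countable_iUnion fun k =>
      (ht N k).countable, fun μ ε hε => ?_⟩
    obtain ⟨N, hN⟩ := ((tendsto_lL2_netDist μ).eventually_lt_const
      (ENNReal.half_pos hε.ne')).exists
    obtain ⟨k, hk⟩ := ENNReal.exists_inv_nat_lt (ENNReal.half_pos hε.ne').ne'
    obtain ⟨ν, hν, hlt⟩ := hcov N k μ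
    refine ⟨ν, mem_iUnion.2 ⟨N, mem_iUnion.2 ⟨k, hν⟩⟩, hlt.trans_le ?_⟩
    rw [← ENNReal.add_halves ε]
    exact add_le_add hN.le ((ENNReal.inv_le_inv.2 le_self_add).trans hk.le)
  exists_limit μ hμ := by
    let m : PseudoEMetricSpace X.P2 :=
      { edist := X.P2.edist
        edist_self := fun μ => wasserstein_self μ.1
        edist_comm := fun μ ν => wasserstein_comm μ.1 ν.1
        edist_triangle := fun μ ν ρ => wasserstein_triangle μ.1 ν.1 ρ.1 }
    have hc : CompleteSpace X.P2 := by
      refine EMetric.complete_of_convergent_controlled_sequences (fun n => 2⁻¹ ^ n)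
        (fun n => ENNReal.pow_pos (by simp) n) fun u hu => ?_
      obtain ⟨ν, hν⟩ := exists_limit_P2 u fun n => hu n n (n + 1) le_rfl n.le_succ
      exact ⟨ν, tendsto_iff_edist_tendsto_0.2 hν⟩
    obtain ⟨ν, hν⟩ := cauchySeq_tendsto_of_complete (u := μ) (EMetric.cauchySeq_iff.2 hμ)
    exact ⟨ν, EMetric.tendsto_atTop.1 hν⟩

instance instIsPolishHier (X : DistSpace.{u}) [IsPolish X] : ∀ n, IsPolish (hier n X)
  | 0 => ‹IsPolish X›
  | n + 1 => have := instIsPolishHier X n; instIsPolishP2 (hier n X)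

/-! ### Totally bounded sets of measures -/

section TotallyBounded

variable {X : DistSpace.{u}} [IsPolish X]

theorem edist_P2 (μ ν : X.P2) : EDist.edist μ ν = X.wasserstein μ.1 ν.1 := rfl

variable [Nonempty X]

theorem totallyBounded_iff_netDist {A : Set X} :
    TotallyBounded A ↔ ∀ ε > 0, ∃ N, ∀ x ∈ A, X.netDist N x < ε := by
  rw [EMetric.totallyBounded_iff]
  constructor
  · intro h ε hε
    obtain ⟨t, ht, hA⟩ := h (ε / 2) (ENNReal.half_pos hε.ne')
    have hev : ∀ y ∈ t, ∀ᶠ N in Filter.atTop, X.netDist N y < ε / 2 := fun y _ =>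
      (tendsto_netDist y).eventually_lt_const (ENNReal.half_pos hε.ne')
    obtain ⟨N, hN⟩ := ((Filter.eventually_all_finite ht).2 hev).exists
    refine ⟨N, fun x hx => ?_⟩
    obtain ⟨y, hy, hxy⟩ := mem_iUnion₂.1 (hA hx)
    exact (netDist_le_add N x y).trans_lt
      ((ENNReal.add_lt_add (hN y hy) hxy).trans_eq (ENNReal.add_halves ε))
  · intro h ε hε
    obtain ⟨N, hN⟩ := h ε hε
    refine ⟨range (X.proj N), (X.proj N).finite_range, fun x hx => ?_⟩
    refine mem_iUnion₂.2 ⟨X.proj N x, mem_range_self _, ?_⟩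
    rw [Metric.mem_eball, edist_comm]
    exact hN x hx

/-- A set of measures is totally bounded for the Wasserstein distance if and only if its elements
are uniformly close, in `L²`, to finite sets. -/
theorem totallyBounded_iff_lL2_netDist {S : Set X.P2} :
    TotallyBounded S ↔ ∀ ε > 0, ∃ N, ∀ μ ∈ S, lL2 μ.1 (X.netDist N) < ε := by
  rw [EMetric.totallyBounded_iff]
  constructor
  · intro h ε hε
    obtain ⟨t, ht, hA⟩ := h (ε / 2) (ENNReal.half_pos hε.ne')
    have hev : ∀ ν ∈ t, ∀ᶠ N in Filter.atTop, lL2 ν.1 (X.netDist N) < ε / 2 := fun y _ =>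
      (tendsto_lL2_netDist y).eventually_lt_const (ENNReal.half_pos hε.ne')
    obtain ⟨N, hN⟩ := ((Filter.eventually_all_finite ht).2 hev).exists
    refine ⟨N, fun μ hμ => ?_⟩
    obtain ⟨ν, hν, hμν⟩ := mem_iUnion₂.1 (hA hμ)
    exact (lL2_netDist_le_add N).trans_lt
      ((ENNReal.add_lt_add (hN ν hν) hμν).trans_eq (ENNReal.add_halves ε))
  · intro h ε hε
    obtain ⟨N, hN⟩ := h (ε / 2) (ENNReal.half_pos hε.ne')
    obtain ⟨t, ht, hcov⟩ := exists_finite_net X N (ENNReal.half_pos hε.ne')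
    refine ⟨t, ht, fun μ hμ => ?_⟩
    obtain ⟨ν, hν, hlt⟩ := hcov μ
    refine mem_iUnion₂.2 ⟨ν, hν, hlt.trans_le ?_⟩
    conv_rhs => rw [← ENNReal.add_halves ε]
    exact add_le_add_left (hN μ hμ).le _

end TotallyBounded

end DistSpace

/-! ### Systems of plans -/

namespace DistSpace

universe u v w

/-- An abstract version of the maps `M ← TM ⇇ T²M` and of the cost `‖v₁ - v₂‖²`, by properties that
pass from the spaces to their Wasserstein spaces. -/
structure IsPlanSystem {X : DistSpace.{u}} {Y : DistSpace.{v}} {Z : DistSpace.{w}} [IsPolish Y]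
    [IsPolish Z] (b : NonexpMap Y X) (p q : NonexpMap Z Y) (c : Z → ℝ≥0∞) : Prop where
  /-- a quantitative form of the properness of `(p, q) : Z → Y × Y` -/
  totallyBounded : ∀ A : Set Y, TotallyBounded A →
    TotallyBounded {z : Z | p.toFun z ∈ A ∧ q.toFun z ∈ A}
  /-- linear growth of distances and quadratic growth of the cost, in terms of `p` and `q` -/
  growth : ∃ (z₀ : Z) (y₀ : Y), ∀ z,
    EDist.edist z₀ z ≤ EDist.edist y₀ (p.toFun z) + EDist.edist y₀ (q.toFun z) ∧
      c z ≤ (EDist.edist y₀ (p.toFun z) + EDist.edist y₀ (q.toFun z)) ^ 2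
  lowerSemicontinuous : LowerSemicontinuous c
  /-- `(p, q)` is onto the fibre product of `Y` with itself over `X` -/
  exists_of_base_eq : ∀ y y', b.toFun y = b.toFun y' → ∃ z, p.toFun z = y ∧ q.toFun z = y'
  diag : ∀ y, ∃ z, p.toFun z = y ∧ q.toFun z = y ∧ c z = 0
  swap : ∀ z, ∃ z', p.toFun z' = q.toFun z ∧ q.toFun z' = p.toFun z ∧ c z' ≤ c z
  /-- couplings can be composed, and the square root of the cost is then subadditive -/
  comp : ∀ z z', q.toFun z = p.toFun z' → ∃ w, p.toFun w = p.toFun z ∧ q.toFun w = q.toFun z' ∧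
    c w ≤ (c z ^ (1 / 2 : ℝ) + c z' ^ (1 / 2 : ℝ)) ^ 2
  eq_of_cost_eq_zero : ∀ z, c z = 0 → p.toFun z = q.toFun z

/-! ### Uniform tightness -/

section Tight

variable {Y : DistSpace.{v}} [IsPolish Y] [Nonempty Y]

/-- Totally bounded sets of measures are uniformly tight. -/
theorem exists_totallyBounded_measure_compl_le {S : Set Y.P2} (hS : TotallyBounded S) {η : ℝ≥0∞}
    (hη : η ≠ 0) : ∃ A : Set Y, TotallyBounded A ∧ MeasurableSet A ∧ ∀ μ ∈ S, μ.1 Aᶜ ≤ η := by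
  obtain ⟨δ, hδ, hsum⟩ := ENNReal.exists_pos_sum_of_countable' hη ℕ
  rw [totallyBounded_iff_lL2_netDist] at hS
  have hpos : ∀ k : ℕ, (0 : ℝ≥0∞) < 2⁻¹ ^ k := fun k => ENNReal.pow_pos (by simp) k
  have htop : ∀ k : ℕ, (2⁻¹ : ℝ≥0∞) ^ k ≠ ⊤ := fun k => by finiteness
  choose N hN using fun k : ℕ => hS (2⁻¹ ^ k * δ k) (ENNReal.mul_pos (hpos k).ne' (hδ k).ne')
  refine ⟨{y | ∀ k, Y.netDist (N k) y < 2⁻¹ ^ k}, ?_, ?_, fun μ hμ => ?_⟩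
  · refine totallyBounded_iff_netDist.2 fun ε hε => ?_
    obtain ⟨k, hk⟩ := ((ENNReal.tendsto_pow_atTop_nhds_zero_of_lt_one
      (r := 2⁻¹) (by simp)).eventually_lt_const hε).exists
    exact ⟨N k, fun y hy => (hy k).trans hk⟩
  · simp only [ofPred_forall]
    exact .iInter fun k => measurableSet_lt (measurable_netDist _) measurable_const
  · have hsub : {y | ∀ k, Y.netDist (N k) y < 2⁻¹ ^ k}ᶜ ⊆
        ⋃ k, {y | 2⁻¹ ^ k ≤ Y.netDist (N k) y} := by
      intro y hy
      simpa using! hy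
    refine (measure_mono hsub).trans ((measure_iUnion_le _).trans
      ((ENNReal.tsum_le_tsum fun k => ?_).trans hsum.le))
    refine (meas_ge_le_lintegral_div (measurable_netDist _).aemeasurable (hpos k).ne'
      (htop k)).trans ?_
    refine ENNReal.div_le_of_le_mul ?_
    rw [mul_comm]
    exact (lintegral_le_lL2 (measurable_netDist _)).trans (hN k μ hμ).le

theorem edist_le_sum_add_netDist (y₀ y : Y) (N : ℕ) :
    EDist.edist y₀ y ≤ (∑ k ∈ Finset.range (N + 1), EDist.edist y₀ (Y.pt k)) + Y.netDist N y := by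
  obtain ⟨k, hk, he⟩ := exists_proj_eq N y
  refine (edist_triangle y₀ (Y.pt k) y).trans (add_le_add ?_ ?_)
  · exact Finset.single_le_sum (f := fun k => EDist.edist y₀ (Y.pt k)) (fun _ _ => zero_le)
      (Finset.mem_range.2 (by lia))
  · rw [netDist, he]

variable (Y) in
/-- A countable measurable partition into sets of small diameter. -/
theorem exists_measurable_index {ε : ℝ≥0∞} (hε : 0 < ε) :
    ∃ J : Y → ℕ, Measurable J ∧ ∀ y y', J y = J y' → EDist.edist y y' ≤ ε := by
  classical
  have hex : ∀ y : Y, ∃ n, EDist.edist (Y.pt n) y < ε / 2 := by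
    intro y
    obtain ⟨_, ⟨n, rfl⟩, hn⟩ := EMetric.mem_closure_iff.1
      (TopologicalSpace.denseRange_denseSeq Y y) (ε / 2) (ENNReal.half_pos hε.ne')
    exact ⟨n, by rwa [edist_comm]⟩
  refine ⟨fun y => Nat.find (hex y), measurable_find hex fun k =>
    measurableSet_lt (by fun_prop) measurable_const, fun y y' h => ?_⟩
  have h1 := Nat.find_spec (hex y)
  have h2 := Nat.find_spec (hex y')
  dsimp only at h
  rw [← h] at h2
  rw [← ENNReal.add_halves ε]
  rw [edist_comm] at h1
  exact (edist_triangle _ _ _).trans (add_le_add h1.le h2.le)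

end Tight

namespace IsPlanSystem

variable {X : DistSpace.{u}} {Y : DistSpace.{v}} {Z : DistSpace.{w}} [IsPolish Y]
    [IsPolish Z] {b : NonexpMap Y X} {p q : NonexpMap Z Y} {c : Z → ℝ≥0∞}

theorem measurable_cost (h : IsPlanSystem b p q c) : Measurable c :=
  h.lowerSemicontinuous.measurable

/-- Properness of `(p, q)` passes to measures. Given `S`, let `A` be totally bounded and of almost
full mass for the elements of `S`, and let `B` be the set of the `z` with `p z, q z ∈ A`, which is
totally bounded. The distance to a finite net of `Z` is small on `B`. Off `B`, by `growth`, it is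
at most a constant, which contributes little since `B` has almost full mass, plus the distances of
`p z` and `q z` to a finite net of `Y`, which are small in `L²` since `S` is totally bounded. -/
theorem totallyBounded_push (h : IsPlanSystem b p q c) (S : Set Y.P2) (hS : TotallyBounded S) :
    TotallyBounded {ζ : Z.P2 | p.push.toFun ζ ∈ S ∧ q.push.toFun ζ ∈ S} := by
  obtain ⟨z₀, y₀, hgrowth⟩ := h.growth
  have : Nonempty Y := ⟨y₀⟩
  have : Nonempty Z := ⟨z₀⟩
  refine totallyBounded_iff_lL2_netDist.2 fun ε hε => ?_
  obtain ⟨r, hr, hr'⟩ : ∃ r : ℝ≥0∞, 0 < r ∧ r + r + (r + r) < ε := by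
    obtain ⟨r, h1, h2⟩ := ENNReal.lt_iff_exists_nnreal_btwn.1 hε
    refine ⟨r / 4, ENNReal.div_pos h1.ne' (by simp), lt_of_eq_of_lt ?_ h2⟩
    rw [← ENNReal.add_div, ← ENNReal.add_div]
    refine (ENNReal.eq_div_iff (by simp) (by simp)).2 ?_ |>.symm
    ring
  obtain ⟨M, hM⟩ := totallyBounded_iff_lL2_netDist.1 hS r hr
  set R := ∑ k ∈ Finset.range (M + 1), EDist.edist y₀ (Y.pt k) with hR
  set K : ℝ≥0∞ := EDist.edist (Z.pt 0) z₀ + (R + R) + 1 with hK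
  have hRtop : R ≠ ⊤ := ENNReal.sum_ne_top.2 fun k _ => edist_ne_top _ _
  have hKtop : K ≠ ⊤ := by
    have := edist_ne_top (Z.pt 0) z₀
    finiteness
  obtain ⟨A, hA, hAm, hAS⟩ := exists_totallyBounded_measure_compl_le hS
    (η := (r / K) ^ 2 / 2) (ENNReal.div_pos (ENNReal.pow_pos
      (ENNReal.div_pos hr.ne' hKtop) 2).ne' (by simp)).ne'
  -- `η` is such that the constant `K`, on a set of measure at most `2 η`, has `L²` norm at most `r`
  set B := {z : Z | p.toFun z ∈ A ∧ q.toFun z ∈ A} with hB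
  have hBm : MeasurableSet B := (p.measurable hAm).inter (q.measurable hAm)
  obtain ⟨N, hN⟩ := totallyBounded_iff_netDist.1 (h.totallyBounded A hA) r hr
  refine ⟨N, fun ζ hζ => lt_of_le_of_lt ?_ hr'⟩
  have hBζ : ζ.1 Bᶜ ≤ (r / K) ^ 2 := by
    have hsub : Bᶜ ⊆ p.toFun ⁻¹' Aᶜ ∪ q.toFun ⁻¹' Aᶜ := by
      intro z hz
      by_contra hcon
      simp only [mem_union, mem_preimage, mem_compl_iff, not_or, not_not] at hcon
      exact hz hcon
    refine (measure_mono hsub).trans ((measure_union_le _ _).trans ?_)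
    rw [← ENNReal.add_halves ((r / K) ^ 2), ← Measure.map_apply p.measurable hAm.compl,
      ← Measure.map_apply q.measurable hAm.compl]
    exact add_le_add (hAS _ hζ.1) (hAS _ hζ.2)
  have hpt : ∀ z, Z.netDist N z ≤ (r + Bᶜ.indicator (fun _ => K) z) +
      (Y.netDist M (p.toFun z) + Y.netDist M (q.toFun z)) := by
    intro z
    by_cases hz : z ∈ B
    · exact ((hN z hz).le.trans le_self_add).trans le_self_add
    · rw [indicator_of_mem (show z ∈ Bᶜ from hz)]
      calc Z.netDist N z ≤ Z.netDist N z₀ + EDist.edist z z₀ := netDist_le_add _ _ _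
        _ ≤ EDist.edist (Z.pt 0) z₀ +
            (EDist.edist y₀ (p.toFun z) + EDist.edist y₀ (q.toFun z)) := by
          rw [edist_comm z]
          exact add_le_add (netDist_le_edist zero_le z₀) (hgrowth z).1
        _ ≤ EDist.edist (Z.pt 0) z₀ + ((R + Y.netDist M (p.toFun z)) +
            (R + Y.netDist M (q.toFun z))) := by
          gcongr <;> exact edist_le_sum_add_netDist _ _ _
        _ = EDist.edist (Z.pt 0) z₀ + (R + R) +
            (Y.netDist M (p.toFun z) + Y.netDist M (q.toFun z)) := by ring
        _ ≤ _ := add_le_add ((le_self_add : _ ≤ K).trans le_add_self) le_rfl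
  have hnp : Measurable fun z => Y.netDist M (p.toFun z) := (measurable_netDist M).comp p.measurable
  have hnq : Measurable fun z => Y.netDist M (q.toFun z) := (measurable_netDist M).comp q.measurable
  have hind : Measurable (Bᶜ.indicator fun _ => K) := measurable_const.indicator hBm.compl
  refine (lL2_mono hpt).trans ((lL2_add_le (by fun_prop) (by fun_prop)).trans ?_)
  refine add_le_add ((lL2_add_le (by fun_prop) (by fun_prop)).trans (add_le_add ?_ ?_))
    ((lL2_add_le (by fun_prop) (by fun_prop)).trans (add_le_add ?_ ?_))
  · rw [lL2_const]
  · have h1 : ∀ z, Bᶜ.indicator (fun _ => K) z ^ 2 = Bᶜ.indicator (fun _ => K ^ 2) z := by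
      intro z; by_cases hz : z ∈ Bᶜ <;> simp [hz]
    rw [lL2, ENNReal.sqrt_le_iff]
    simp_rw [h1]
    rw [lintegral_indicator_const hBm.compl]
    calc K ^ 2 * ζ.1 Bᶜ ≤ K ^ 2 * (r / K) ^ 2 := by gcongr
      _ = (K * (r / K)) ^ 2 := by ring
      _ ≤ r ^ 2 := by
        gcongr
        exact ENNReal.mul_div_le
  · rw [← lL2_map p.measurable (measurable_netDist M)]
    exact (hM _ hζ.1).le
  · rw [← lL2_map q.measurable (measurable_netDist M)]
    exact (hM _ hζ.2).le

/-- Approximate lifts: random pairs `(f, g)` that can be lifted to `Z` pointwise have, up to a small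
error, a common measurable lift with countably many values. -/
theorem exists_approx_lift (h : IsPlanSystem b p q c) {Ω : Type*} [MeasurableSpace Ω]
    {β : Measure Ω} [IsProbabilityMeasure β] {f g : Ω → Y} (hf : Measurable f) (hg : Measurable g)
    {γ₁ γ₂ : Y.P2} (h₁ : β.map f = γ₁.1) (h₂ : β.map g = γ₂.1) {a : Ω → ℝ≥0∞}
    (H : ∀ᵐ t ∂β, ∃ z, p.toFun z = f t ∧ q.toFun z = g t ∧ c z ≤ a t) {ε : ℝ≥0∞} (hε : 0 < ε)
    (hε' : ε ≠ ⊤) :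
    ∃ ζ : Z.P2, EDist.edist (p.push.toFun ζ) γ₁ ≤ ε ∧ EDist.edist (q.push.toFun ζ) γ₂ ≤ ε ∧
      ∫⁻ z, c z ∂ζ.1 ≤ ∫⁻ t, a t ∂β + ε := by
  obtain ⟨z₀, y₀, hgrowth⟩ := h.growth
  have : Nonempty Y := ⟨y₀⟩
  obtain ⟨J, hJ, hJe⟩ := exists_measurable_index Y hε
  set G := {t | ∃ z, p.toFun z = f t ∧ q.toFun z = g t ∧ c z ≤ a t} with hG
  have key : ∀ n : ℕ × ℕ, ∃ z : Z, ∀ t ∈ G, (J (f t), J (g t)) = n →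
      EDist.edist (p.toFun z) (f t) ≤ ε ∧ EDist.edist (q.toFun z) (g t) ≤ ε ∧ c z ≤ a t + ε := by
    intro n
    by_cases hne : ∃ t ∈ G, (J (f t), J (g t)) = n
    swap
    · exact ⟨z₀, fun t ht htn => absurd ⟨t, ht, htn⟩ hne⟩
    -- lift the values of `f` and `g` at a point of the cell where `a` is almost minimal
    obtain ⟨t₀, ht₀, hmin⟩ : ∃ t₀, (t₀ ∈ G ∧ (J (f t₀), J (g t₀)) = n) ∧
        ∀ t, (t ∈ G ∧ (J (f t), J (g t)) = n) → a t₀ ≤ a t + ε := by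
      set m := ⨅ t : {t // t ∈ G ∧ (J (f t), J (g t)) = n}, a t with hm
      obtain ⟨s, hs⟩ := hne
      rcases eq_or_ne m ⊤ with hmt | hmt
      · refine ⟨s, hs, fun t ht => ?_⟩
        have : m ≤ a t := iInf_le (fun t : {t // t ∈ G ∧ (J (f t), J (g t)) = n} => a t) ⟨t, ht⟩
        rw [hmt, top_le_iff] at this
        simp [this]
      · obtain ⟨t, ht⟩ := iInf_lt_iff.1 (ENNReal.lt_add_right hmt hε.ne')
        exact ⟨t, t.2, fun t' ht' => ht.le.trans (add_le_add_left
          (iInf_le (fun t : {t // t ∈ G ∧ (J (f t), J (g t)) = n} => a t) ⟨t', ht'⟩) _)⟩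
    obtain ⟨⟨z, hz1, hz2, hz3⟩, hn⟩ := ht₀
    refine ⟨z, fun t ht htn => ⟨?_, ?_, hz3.trans (hmin t ⟨ht, htn⟩)⟩⟩
    · rw [hz1]; exact hJe _ _ (congrArg Prod.fst (hn.trans htn.symm))
    · rw [hz2]; exact hJe _ _ (congrArg Prod.snd (hn.trans htn.symm))
  -- each cell of the countable partition of `Ω` is sent to a single point of `Z`
  choose s hs using key
  set T : Ω → Z := fun t => s (J (f t), J (g t)) with hT
  have hTm : Measurable T := (measurable_of_countable s).comp
    ((hJ.comp hf).prodMk (hJ.comp hg))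
  have hTs : ∀ᵐ t ∂β, EDist.edist (p.toFun (T t)) (f t) ≤ ε ∧
      EDist.edist (q.toFun (T t)) (g t) ≤ ε ∧ c (T t) ≤ a t + ε :=
    H.mono fun t ht => hs _ t ht rfl
  have hpT : Measurable fun t => p.toFun (T t) := p.measurable.comp hTm
  have hqT : Measurable fun t => q.toFun (T t) := q.measurable.comp hTm
  have e1 : lL2 β (fun t => EDist.edist (p.toFun (T t)) (f t)) ≤ ε :=
    (lL2_mono_ae (hTs.mono fun t ht => ht.1)).trans_eq (lL2_const ε)
  have e2 : lL2 β (fun t => EDist.edist (q.toFun (T t)) (g t)) ≤ ε :=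
    (lL2_mono_ae (hTs.mono fun t ht => ht.2.1)).trans_eq (lL2_const ε)
  have hmom : ∀ {φ ψ : Ω → Y} {γ : Y.P2}, Measurable φ → Measurable ψ → β.map φ = γ.1 →
      lL2 β (fun t => EDist.edist (ψ t) (φ t)) ≤ ε → lL2 β (fun t => EDist.edist y₀ (ψ t)) ≠ ⊤ := by
    intro φ ψ γ hφ hψ hφγ hφψ
    refine ne_top_of_le_ne_top (ENNReal.add_ne_top.2 ⟨lL2_edist_ne_top γ y₀, hε'⟩)
      ((lL2_mono fun t => edist_triangle_right y₀ (ψ t) (φ t)).trans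
        ((lL2_add_le (by fun_prop) (by fun_prop)).trans (add_le_add (le_of_eq ?_) hφψ)))
    rw [← hφγ, lL2_map hφ (by fun_prop)]
  obtain ⟨ζ, hζ⟩ := exists_P2 β hTm (x₀ := z₀) (ne_top_of_le_ne_top
    (ENNReal.add_ne_top.2 ⟨hmom hf hpT h₁ e1, hmom hg hqT h₂ e2⟩)
    ((lL2_mono fun t => (hgrowth (T t)).1).trans (lL2_add_le (by fun_prop) (by fun_prop))))
  refine ⟨ζ, ?_, ?_, ?_⟩
  · rw [edist_P2, ← h₁]
    change Y.wasserstein (ζ.1.map p.toFun) _ ≤ ε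
    rw [hζ, Measure.map_map p.measurable hTm]
    exact (wasserstein_map_map_le hpT hf).trans e1
  · rw [edist_P2, ← h₂]
    change Y.wasserstein (ζ.1.map q.toFun) _ ≤ ε
    rw [hζ, Measure.map_map q.measurable hTm]
    exact (wasserstein_map_map_le hqT hg).trans e2
  · rw [hζ, lintegral_map h.measurable_cost hTm]
    refine (lintegral_mono_ae (hTs.mono fun t ht => ht.2.2)).trans_eq ?_
    rw [lintegral_add_right _ measurable_const]; simp

/-- Random pairs that can be lifted to `Z` pointwise have laws that lift to `Z`. No measurable
selection is needed: by `totallyBounded_push`, the approximate lifts of `exists_approx_lift` have a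
limit point. -/
theorem exists_lift (h : IsPlanSystem b p q c) {Ω : Type*} [MeasurableSpace Ω]
    {β : Measure Ω} [IsProbabilityMeasure β] {f g : Ω → Y} (hf : Measurable f) (hg : Measurable g)
    {γ₁ γ₂ : Y.P2} (h₁ : β.map f = γ₁.1) (h₂ : β.map g = γ₂.1) {a : Ω → ℝ≥0∞}
    (H : ∀ᵐ t ∂β, ∃ z, p.toFun z = f t ∧ q.toFun z = g t ∧ c z ≤ a t) :
    ∃ ζ : Z.P2, p.push.toFun ζ = γ₁ ∧ q.push.toFun ζ = γ₂ ∧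
      ∫⁻ z, c z ∂ζ.1 ≤ ∫⁻ t, a t ∂β := by
  choose ζ h1 h2 h3 using fun k : ℕ => h.exists_approx_lift hf hg h₁ h₂ H
    (ε := ((k : ℝ≥0∞) + 1)⁻¹) (by simp) (by simp)
  have hlim0 : Filter.Tendsto (fun k : ℕ => ((k : ℝ≥0∞) + 1)⁻¹) Filter.atTop (nhds 0) := by
    have := (Filter.tendsto_add_atTop_iff_nat 1).2 ENNReal.tendsto_inv_nat_nhds_zero
    simpa using this
  have t1 : Filter.Tendsto (fun k => p.push.toFun (ζ k)) Filter.atTop (nhds γ₁) :=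
    tendsto_iff_edist_tendsto_0.2 (tendsto_of_tendsto_of_tendsto_of_le_of_le tendsto_const_nhds
      hlim0 (fun _ => zero_le) h1)
  have t2 : Filter.Tendsto (fun k => q.push.toFun (ζ k)) Filter.atTop (nhds γ₂) :=
    tendsto_iff_edist_tendsto_0.2 (tendsto_of_tendsto_of_tendsto_of_le_of_le tendsto_const_nhds
      hlim0 (fun _ => zero_le) h2)
  have htb := h.totallyBounded_push _
    ((t1.cauchySeq.totallyBounded_range).union t2.cauchySeq.totallyBounded_range)
  have hcomp : IsCompact (closure (range ζ)) := by
    refine (TotallyBounded.closure (htb.subset ?_)).isCompact_of_isClosed isClosed_closure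
    rintro _ ⟨k, rfl⟩
    exact ⟨Or.inl ⟨k, rfl⟩, Or.inr ⟨k, rfl⟩⟩
  obtain ⟨ξ, -, φ, hφ, hξ⟩ := hcomp.tendsto_subseq fun k => subset_closure (mem_range_self k)
  refine ⟨ξ, ?_, ?_, ?_⟩
  · exact tendsto_nhds_unique ((p.push.lipschitz.continuous.tendsto ξ).comp hξ)
      (t1.comp hφ.tendsto_atTop)
  · exact tendsto_nhds_unique ((q.push.lipschitz.continuous.tendsto ξ).comp hξ)
      (t2.comp hφ.tendsto_atTop)
  · refine le_of_forall_lt_imp_le_of_dense fun r hr => ?_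
    have hev := hξ.eventually (lowerSemicontinuous_lintegral h.lowerSemicontinuous ξ r hr)
    have hlim : Filter.Tendsto (fun k : ℕ => ∫⁻ t, a t ∂β + ((φ k : ℝ≥0∞) + 1)⁻¹) Filter.atTop
        (nhds (∫⁻ t, a t ∂β + 0)) :=
      tendsto_const_nhds.add (hlim0.comp hφ.tendsto_atTop)
    rw [add_zero] at hlim
    exact ge_of_tendsto hlim (hev.mono fun k hk => hk.le.trans (h3 (φ k)))

/-- The properties of a system of plans pass to Wasserstein spaces. -/
theorem push [IsPolish X] (h : IsPlanSystem b p q c) :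
    IsPlanSystem b.push p.push q.push (fun ζ : Z.P2 => ∫⁻ z, c z ∂ζ.1) where
  totallyBounded := h.totallyBounded_push
  growth := by
    obtain ⟨z₀, y₀, hgrowth⟩ := h.growth
    obtain ⟨ζ₀, hζ₀⟩ := exists_P2 (Measure.dirac z₀) measurable_id (x₀ := z₀)
      (by simp [lL2, lintegral_dirac])
    obtain ⟨γ₀, hγ₀⟩ := exists_P2 (Measure.dirac y₀) measurable_id (x₀ := y₀)
      (by simp [lL2, lintegral_dirac])
    rw [Measure.map_id] at hζ₀ hγ₀
    have hp : ∀ ζ : Z.P2, EDist.edist γ₀ (p.push.toFun ζ) =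
        lL2 ζ.1 (fun z => EDist.edist y₀ (p.toFun z)) := fun ζ => by
      rw [edist_P2, hγ₀, wasserstein_dirac]
      exact lL2_map p.measurable (by fun_prop)
    have hq : ∀ ζ : Z.P2, EDist.edist γ₀ (q.push.toFun ζ) =
        lL2 ζ.1 (fun z => EDist.edist y₀ (q.toFun z)) := fun ζ => by
      rw [edist_P2, hγ₀, wasserstein_dirac]
      exact lL2_map q.measurable (by fun_prop)
    have mp : Measurable fun z => EDist.edist y₀ (p.toFun z) :=
      measurable_const.edist p.measurable
    have mq : Measurable fun z => EDist.edist y₀ (q.toFun z) :=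
      measurable_const.edist q.measurable
    refine ⟨ζ₀, γ₀, fun ζ => ⟨?_, ?_⟩⟩
    · rw [edist_P2, hζ₀, wasserstein_dirac, hp, hq]
      exact (lL2_mono fun z => (hgrowth z).1).trans (lL2_add_le mp mq)
    · rw [hp, hq]
      refine (lintegral_mono fun z => (hgrowth z).2).trans ?_
      rw [← lL2_sq]
      exact pow_le_pow_left' (lL2_add_le mp mq) 2
  lowerSemicontinuous := lowerSemicontinuous_lintegral h.lowerSemicontinuous
  exists_of_base_eq γ γ' hγ := by
    obtain ⟨β, hβ, hβ₁, hβ₂, hβe⟩ := exists_measure_fiberProduct b.measurable b.measurable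
      (congrArg Subtype.val hγ : γ.1.map b.toFun = γ'.1.map b.toFun)
    obtain ⟨ζ, hζ₁, hζ₂, -⟩ := h.exists_lift measurable_fst measurable_snd hβ₁ hβ₂
      (a := fun _ => ⊤) (hβe.mono fun t ht => by
        obtain ⟨z, hz₁, hz₂⟩ := h.exists_of_base_eq _ _ ht
        exact ⟨z, hz₁, hz₂, le_top⟩)
    exact ⟨ζ, hζ₁, hζ₂⟩
  diag γ := by
    obtain ⟨ζ, hζ₁, hζ₂, hζ⟩ := h.exists_lift measurable_id measurable_id
      (Measure.map_id (μ := γ.1)) Measure.map_id (a := fun _ => 0) (.of_forall fun y => by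
        obtain ⟨z, hz₁, hz₂, hz⟩ := h.diag y
        exact ⟨z, hz₁, hz₂, hz.le⟩)
    exact ⟨ζ, hζ₁, hζ₂, by simpa using hζ⟩
  swap ζ := h.exists_lift (β := ζ.1) (γ₁ := q.push.toFun ζ) (γ₂ := p.push.toFun ζ) q.measurable
    p.measurable rfl rfl (.of_forall h.swap)
  comp ζ ζ' hζ := by
    obtain ⟨β, hβ, hβ₁, hβ₂, hβe⟩ := exists_measure_fiberProduct q.measurable p.measurable
      (congrArg Subtype.val hζ : ζ.1.map q.toFun = ζ'.1.map p.toFun)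
    have hc := h.measurable_cost
    have m₁ : Measurable fun t : Z × Z => p.toFun t.1 := p.measurable.comp measurable_fst
    have m₂ : Measurable fun t : Z × Z => q.toFun t.2 := q.measurable.comp measurable_snd
    obtain ⟨ξ, hξ₁, hξ₂, hξ⟩ := h.exists_lift (β := β) (γ₁ := p.push.toFun ζ)
      (γ₂ := q.push.toFun ζ') m₁ m₂
      ((Measure.map_map p.measurable measurable_fst).symm.trans
        (congrArg (Measure.map p.toFun) hβ₁))
      ((Measure.map_map q.measurable measurable_snd).symm.trans
        (congrArg (Measure.map q.toFun) hβ₂))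
      (hβe.mono fun t ht => h.comp t.1 t.2 ht)
    refine ⟨ξ, hξ₁, hξ₂, hξ.trans ?_⟩
    rw [← lL2_sq]
    refine pow_le_pow_left' ((lL2_add_le (by fun_prop) (by fun_prop)).trans_eq ?_) 2
    simp only [lL2, ENNReal.sq_sqrt]
    rw [← hβ₁, ← hβ₂, lintegral_map hc measurable_fst, lintegral_map hc measurable_snd]
  eq_of_cost_eq_zero ζ hζ := by
    have h0 := (lintegral_eq_zero_iff h.measurable_cost).1 hζ
    refine Subtype.ext (Measure.map_congr ?_)
    filter_upwards [h0] with z hz using h.eq_of_cost_eq_zero z hz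

/-- The properties of a system of plans hold at all levels of the hierarchy. -/
theorem hierPush [IsPolish X] (h : IsPlanSystem b p q c) : ∀ n : ℕ,
    IsPlanSystem (b.hierPush n) (p.hierPush n) (q.hierPush n) (nExpect c n)
  | 0 => h
  | n + 1 => (h.hierPush n).push

/-! ### The distance defined by a system of plans -/

/-- The square root of the infimum of the costs of the couplings of `y` and `y'`. -/
noncomputable def couplingDist {Y : DistSpace.{v}} {Z : DistSpace.{w}} (p q : NonexpMap Z Y)
    (c : Z → ℝ≥0∞) (y y' : Y) : ℝ≥0∞ :=
  (⨅ z ∈ {z | p.toFun z = y ∧ q.toFun z = y'}, c z) ^ (1 / 2 : ℝ)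

theorem couplingDist_le {Y : DistSpace.{v}} {Z : DistSpace.{w}} {p q : NonexpMap Z Y}
    {c : Z → ℝ≥0∞} {z : Z} {y y' : Y} (h₁ : p.toFun z = y) (h₂ : q.toFun z = y') :
    couplingDist p q c y y' ≤ c z ^ (1 / 2 : ℝ) :=
  ENNReal.rpow_le_rpow (iInf₂_le z ⟨h₁, h₂⟩) (by norm_num)

theorem isCompact_couplings (h : IsPlanSystem b p q c) (y y' : Y) :
    IsCompact {z | p.toFun z = y ∧ q.toFun z = y'} := by
  have hsub : {z | p.toFun z = y ∧ q.toFun z = y'} ⊆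
      {z | p.toFun z ∈ ({y, y'} : Set Y) ∧ q.toFun z ∈ ({y, y'} : Set Y)} :=
    fun z hz => ⟨Or.inl hz.1, Or.inr hz.2⟩
  refine ((h.totallyBounded {y, y'} (toFinite _).totallyBounded).subset
    hsub).isCompact_of_isClosed ?_
  exact (isClosed_eq p.lipschitz.continuous continuous_const).inter
    (isClosed_eq q.lipschitz.continuous continuous_const)

theorem cost_ne_top (h : IsPlanSystem b p q c) (z : Z) : c z ≠ ⊤ := by
  obtain ⟨z₀, y₀, hgrowth⟩ := h.growth
  have h1 := edist_ne_top y₀ (p.toFun z)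
  have h2 := edist_ne_top y₀ (q.toFun z)
  exact ne_top_of_le_ne_top (by finiteness) (hgrowth z).2

theorem exists_optimal (h : IsPlanSystem b p q c) {y y' : Y} (hy : b.toFun y = b.toFun y') :
    ∃ z ∈ {z | p.toFun z = y ∧ q.toFun z = y'}, couplingDist p q c y y' ^ 2 = c z := by
  obtain ⟨z, hz, hmin⟩ := (h.lowerSemicontinuous.lowerSemicontinuousOn _).exists_isMinOn
    (h.exists_of_base_eq y y' hy) (h.isCompact_couplings y y')
  refine ⟨z, hz, ?_⟩
  rw [couplingDist, ENNReal.sq_sqrt]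
  exact le_antisymm (iInf₂_le z hz) (le_iInf₂ fun w hw => hmin hw)

theorem couplingDist_ne_top (h : IsPlanSystem b p q c) {y y' : Y} (hy : b.toFun y = b.toFun y') :
    couplingDist p q c y y' ≠ ⊤ := by
  obtain ⟨z, hz, -⟩ := h.exists_optimal hy
  exact ne_top_of_le_ne_top (ENNReal.rpow_ne_top_of_nonneg (by norm_num) (h.cost_ne_top z))
    (couplingDist_le hz.1 hz.2)

theorem couplingDist_eq_zero_iff (h : IsPlanSystem b p q c) {y y' : Y}
    (hy : b.toFun y = b.toFun y') : couplingDist p q c y y' = 0 ↔ y = y' := by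
  constructor
  · intro h0
    obtain ⟨z, hz, he⟩ := h.exists_optimal hy
    rw [h0, zero_pow two_ne_zero] at he
    exact hz.1.symm.trans ((h.eq_of_cost_eq_zero z he.symm).trans hz.2)
  · rintro rfl
    obtain ⟨z, hz₁, hz₂, hz⟩ := h.diag y
    have := couplingDist_le (c := c) hz₁ hz₂
    rw [hz] at this
    simpa using this

theorem couplingDist_comm (h : IsPlanSystem b p q c) {y y' : Y} :
    couplingDist p q c y y' = couplingDist p q c y' y := by
  have key : ∀ y y', couplingDist p q c y y' ≤ couplingDist p q c y' y := by
    intro y y'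
    refine ENNReal.rpow_le_rpow (le_iInf₂ fun z hz => ?_) (by norm_num)
    obtain ⟨z', h₁, h₂, hle⟩ := h.swap z
    exact (iInf₂_le z' ⟨h₁.trans hz.2, h₂.trans hz.1⟩).trans hle
  exact le_antisymm (key _ _) (key _ _)

theorem couplingDist_triangle (h : IsPlanSystem b p q c) {y₁ y₂ y₃ : Y}
    (h₁₂ : b.toFun y₁ = b.toFun y₂) (h₂₃ : b.toFun y₂ = b.toFun y₃) :
    couplingDist p q c y₁ y₃ ≤ couplingDist p q c y₁ y₂ + couplingDist p q c y₂ y₃ := by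
  obtain ⟨z, hz, he⟩ := h.exists_optimal h₁₂
  obtain ⟨z', hz', he'⟩ := h.exists_optimal h₂₃
  obtain ⟨w, hw₁, hw₂, hw⟩ := h.comp z z' (hz.2.trans hz'.1.symm)
  rw [← he, ← he', ENNReal.sqrt_sq, ENNReal.sqrt_sq] at hw
  exact (couplingDist_le (hw₁.trans hz.1) (hw₂.trans hz'.2)).trans (ENNReal.sqrt_le_iff.2 hw)

end IsPlanSystem

end DistSpace

/-! ### Christoffel symbols in coordinates -/

-- needed to find the norm of trilinear forms, such as derivatives of the metric
set_option maxSynthPendingDepth 3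

section Christoffel

variable {E : Type*} [NormedAddCommGroup E] [NormedSpace ℝ E]

theorem christoffelFirst_apply (g : E → E →L[ℝ] E →L[ℝ] ℝ) (y a b w : E) :
    christoffelFirst g y a b w =
      1 / 2 * (fderiv ℝ g y a b w + fderiv ℝ g y b a w - fderiv ℝ g y w a b) := by
  simp [christoffelFirst]

theorem abs_christoffelFirst_le (g : E → E →L[ℝ] E →L[ℝ] ℝ) (y a b w : E) :
    |christoffelFirst g y a b w| ≤ 3 / 2 * ‖fderiv ℝ g y‖ * ‖a‖ * ‖b‖ * ‖w‖ := by
  have h : ∀ a b w : E, |fderiv ℝ g y a b w| ≤ ‖fderiv ℝ g y‖ * ‖a‖ * ‖b‖ * ‖w‖ := fun a b w => by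
    refine ((fderiv ℝ g y a b).le_opNorm w).trans ?_
    gcongr
    refine ((fderiv ℝ g y a).le_opNorm b).trans ?_
    gcongr
    exact (fderiv ℝ g y).le_opNorm a
  rw [christoffelFirst_apply]
  have h1 := abs_le.1 (h a b w)
  have h2 := abs_le.1 (h b a w)
  have h3 := abs_le.1 (h w a b)
  rw [abs_le]
  constructor <;> nlinarith

/-- The transformation law of the Christoffel symbols under a change of coordinates `ψ`. -/
theorem christoffelFirst_pullback {g g' : E → E →L[ℝ] E →L[ℝ] ℝ} {ψ : E → E} {y : E}
    (hψ : ContDiffAt ℝ 2 ψ y) (hg : DifferentiableAt ℝ g (ψ y)) (hg' : DifferentiableAt ℝ g' y)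
    (hsymm : ∀ a b, g (ψ y) a b = g (ψ y) b a)
    (h : ∀ᶠ z in nhds y, ∀ a b, g' z a b = g (ψ z) (fderiv ℝ ψ z a) (fderiv ℝ ψ z b)) (a b w : E) :
    christoffelFirst g' y a b w =
      christoffelFirst g (ψ y) (fderiv ℝ ψ y a) (fderiv ℝ ψ y b) (fderiv ℝ ψ y w) +
        g (ψ y) (fderiv ℝ (fderiv ℝ ψ) y a b) (fderiv ℝ ψ y w) := by
  have hψ1 : DifferentiableAt ℝ ψ y := hψ.differentiableAt two_ne_zero
  have hψ2 : DifferentiableAt ℝ (fderiv ℝ ψ) y :=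
    (hψ.fderiv_right (m := 1) le_rfl).differentiableAt one_ne_zero
  have hD : ∀ u v x : E, fderiv ℝ g' y u v x =
      fderiv ℝ g (ψ y) (fderiv ℝ ψ y u) (fderiv ℝ ψ y v) (fderiv ℝ ψ y x) +
        g (ψ y) (fderiv ℝ (fderiv ℝ ψ) y u v) (fderiv ℝ ψ y x) +
        g (ψ y) (fderiv ℝ ψ y v) (fderiv ℝ (fderiv ℝ ψ) y u x) := by
    intro u v x
    have h1 : HasFDerivAt (fun z => g' z v x) _ y :=
      (hg'.hasFDerivAt.clm_apply (hasFDerivAt_const v y)).clm_apply (hasFDerivAt_const x y)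
    have hgψ := hg.hasFDerivAt.comp y hψ1.hasFDerivAt
    have h2 : HasFDerivAt (fun z => g (ψ z) (fderiv ℝ ψ z v) (fderiv ℝ ψ z x)) _ y :=
      (hgψ.clm_apply (hψ2.hasFDerivAt.clm_apply (hasFDerivAt_const v y))).clm_apply
        (hψ2.hasFDerivAt.clm_apply (hasFDerivAt_const x y))
    have h3 := (h2.congr_of_eventuallyEq (h.mono fun z hz => hz v x)).unique h1
    have h4 := congrArg (fun L : E →L[ℝ] ℝ => L u) h3
    simp at h4
    linarith
  have hs : ∀ u v, fderiv ℝ (fderiv ℝ ψ) y u v = fderiv ℝ (fderiv ℝ ψ) y v u := fun u v =>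
    (hψ.isSymmSndFDerivAt (by simp)) u v
  rw [christoffelFirst_apply, christoffelFirst_apply, hD, hD, hD, hs b a, hs w a, hs w b,
    hsymm (fderiv ℝ ψ y a), hsymm (fderiv ℝ ψ y b)]
  ring_nf

end Christoffel

section Coordinates

variable {E : Type*} [NormedAddCommGroup E] [NormedSpace ℝ E]
  {M : Type*} [MetricSpace M] [ChartedSpace E M] [IsManifold 𝓘(ℝ, E) ∞ M]

/-- The vector component of `p ∈ TM` in the coordinates of the preferred chart at `x`. -/
noncomputable def vecCoord (x : M) (p : TangentBundle 𝓘(ℝ, E) M) : E :=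
  tangentCoordChange 𝓘(ℝ, E) p.1 x p.1 p.2

theorem extChartAt_tangent (p₀ p : TangentBundle 𝓘(ℝ, E) M) :
    extChartAt 𝓘(ℝ, E).tangent p₀ p = (extChartAt 𝓘(ℝ, E) p₀.1 p.1, vecCoord p₀.1 p) := rfl

theorem vecCoord_self (p : TangentBundle 𝓘(ℝ, E) M) : vecCoord p.1 p = p.2 :=
  tangentCoordChange_self (mem_extChartAt_source p.1)

theorem tangentCoordChange_leftInv {x₀ x : M} (h : x ∈ (extChartAt 𝓘(ℝ, E) x₀).source) (u : E) :
    tangentCoordChange 𝓘(ℝ, E) x₀ x x (tangentCoordChange 𝓘(ℝ, E) x x₀ x u) = u := by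
  rw [tangentCoordChange_comp ⟨⟨mem_extChartAt_source x, h⟩, mem_extChartAt_source x⟩]
  exact tangentCoordChange_self (mem_extChartAt_source x)

theorem tangentCoordChange_rightInv {x₀ x : M} (h : x ∈ (extChartAt 𝓘(ℝ, E) x₀).source) (u : E) :
    tangentCoordChange 𝓘(ℝ, E) x x₀ x (tangentCoordChange 𝓘(ℝ, E) x₀ x x u) = u := by
  rw [tangentCoordChange_comp ⟨⟨h, mem_extChartAt_source x⟩, h⟩]
  exact tangentCoordChange_self h

theorem fderiv_transition (x₀ x₁ x : M) :
    fderiv ℝ (extChartAt 𝓘(ℝ, E) x₀ ∘ (extChartAt 𝓘(ℝ, E) x₁).symm) (extChartAt 𝓘(ℝ, E) x₁ x) =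
      tangentCoordChange 𝓘(ℝ, E) x₁ x₀ x := by
  rw [tangentCoordChange_def, modelWithCornersSelf_coe, range_id, fderivWithin_univ]

theorem vecCoord_change {x₀ x₁ : M} {p : TangentBundle 𝓘(ℝ, E) M}
    (h₀ : p.1 ∈ (extChartAt 𝓘(ℝ, E) x₀).source) (h₁ : p.1 ∈ (extChartAt 𝓘(ℝ, E) x₁).source) :
    vecCoord x₀ p = tangentCoordChange 𝓘(ℝ, E) x₁ x₀ p.1 (vecCoord x₁ p) :=
  (tangentCoordChange_comp ⟨⟨mem_extChartAt_source p.1, h₁⟩, h₀⟩).symm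

theorem contDiffAt_transition {x₀ x₁ x : M} (h₀ : x ∈ (extChartAt 𝓘(ℝ, E) x₀).source)
    (h₁ : x ∈ (extChartAt 𝓘(ℝ, E) x₁).source) :
    ContDiffAt ℝ ∞ (extChartAt 𝓘(ℝ, E) x₀ ∘ (extChartAt 𝓘(ℝ, E) x₁).symm)
      (extChartAt 𝓘(ℝ, E) x₁ x) := by
  have h' : extChartAt 𝓘(ℝ, E) x₁ x ∈
      ((extChartAt 𝓘(ℝ, E) x₁).symm ≫ (extChartAt 𝓘(ℝ, E) x₀)).source := by
    rw [PartialEquiv.trans_source'', PartialEquiv.symm_symm, PartialEquiv.symm_target]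
    exact mem_image_of_mem _ ⟨h₁, h₀⟩
  have := contDiffWithinAt_ext_coord_change (I := 𝓘(ℝ, E)) (n := ∞) x₀ x₁ h'
  rwa [modelWithCornersSelf_coe, range_id, contDiffWithinAt_univ] at this

variable [RiemannianBundle (fun x : M => TangentSpace 𝓘(ℝ, E) x)]

/-- In the chart at `x₀`, the form `chartMetric x₀` expresses the Riemannian scalar product. -/
theorem chartMetric_apply {x₀ x : M} (h : x ∈ (extChartAt 𝓘(ℝ, E) x₀).source)
    (u u' : TangentSpace 𝓘(ℝ, E) x) :
    chartMetric x₀ (extChartAt 𝓘(ℝ, E) x₀ x) (tangentCoordChange 𝓘(ℝ, E) x x₀ x u)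
      (tangentCoordChange 𝓘(ℝ, E) x x₀ x u') = inner ℝ u u' := by
  have hx : (extChartAt 𝓘(ℝ, E) x₀).symm (extChartAt 𝓘(ℝ, E) x₀ x) = x :=
    (extChartAt 𝓘(ℝ, E) x₀).left_inv h
  have hD : ∀ a : E, mfderiv 𝓘(ℝ, E) 𝓘(ℝ, E) (extChartAt 𝓘(ℝ, E) x₀).symm
      (extChartAt 𝓘(ℝ, E) x₀ x) a = tangentCoordChange 𝓘(ℝ, E) x₀ x x a := by
    intro a
    have h1 := TangentBundle.symmL_trivializationAt (I := 𝓘(ℝ, E)) (x₀ := x₀) (x := x)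
      (by simpa using h)
    rw [TangentBundle.symmL_trivializationAt_eq_core (by simpa using h)] at h1
    rw [modelWithCornersSelf_coe, range_id, mfderivWithin_univ] at h1
    exact (congrArg (fun L : E →L[ℝ] E => L a) h1).symm
  have key : ∀ z : M, z = x → ∀ a b a' b' : E, a = a' → b = b' →
      (inner ℝ (show TangentSpace 𝓘(ℝ, E) z from a) (show TangentSpace 𝓘(ℝ, E) z from b) : ℝ) =
        inner ℝ (show TangentSpace 𝓘(ℝ, E) x from a') (show TangentSpace 𝓘(ℝ, E) x from b') := by
    rintro z rfl a b a' b' rfl rfl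
    rfl
  exact key _ hx _ _ _ _ ((hD _).trans (tangentCoordChange_leftInv h u))
    ((hD _).trans (tangentCoordChange_leftInv h u'))

end Coordinates

/-! ### Local control of the metric in a chart -/

section ChartMetric

variable {E : Type*} [NormedAddCommGroup E] [NormedSpace ℝ E]
  {M : Type*} [MetricSpace M] [ChartedSpace E M] [IsManifold 𝓘(ℝ, E) ∞ M]

theorem contMDiffOn_mfderiv_extChartAt_symm (x₀ : M) (a : E) :
    ContMDiffOn 𝓘(ℝ, E) 𝓘(ℝ, E).tangent 1
      (fun y : E => (⟨(extChartAt 𝓘(ℝ, E) x₀).symm y,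
        mfderiv 𝓘(ℝ, E) 𝓘(ℝ, E) (extChartAt 𝓘(ℝ, E) x₀).symm y a⟩ : TangentBundle 𝓘(ℝ, E) M))
      (extChartAt 𝓘(ℝ, E) x₀).target := by
  have ho : IsOpen (extChartAt 𝓘(ℝ, E) x₀).target := isOpen_extChartAt_target x₀
  have h1 : ContMDiffOn 𝓘(ℝ, E).tangent 𝓘(ℝ, E).tangent 1
      (tangentMapWithin 𝓘(ℝ, E) 𝓘(ℝ, E) (extChartAt 𝓘(ℝ, E) x₀).symm
        (extChartAt 𝓘(ℝ, E) x₀).target) _ :=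
    (contMDiffOn_extChartAt_symm (n := 2) x₀).contMDiffOn_tangentMapWithin
      (by norm_num) ho.uniqueMDiffOn
  have h2 : ContMDiff 𝓘(ℝ, E) 𝓘(ℝ, E).tangent 1
      (fun y : E => (⟨y, a⟩ : TangentBundle 𝓘(ℝ, E) E)) := fun y =>
    (contMDiffAt_vectorSpace_iff_contDiffAt (V := fun _ : E => a)).2 contDiffAt_const
  refine (h1.comp h2.contMDiffOn (fun y hy => hy)).congr fun y hy => ?_
  simp only [Function.comp, tangentMapWithin]
  rw [mfderivWithin_of_isOpen ho hy]

variable [RiemannianBundle (fun x : M => TangentSpace 𝓘(ℝ, E) x)]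
  [IsContMDiffRiemannianBundle 𝓘(ℝ, E) ∞ E (fun x : M => TangentSpace 𝓘(ℝ, E) x)]

theorem contDiffOn_chartMetric [FiniteDimensional ℝ E] (x₀ : M) :
    ContDiffOn ℝ 1 (chartMetric x₀) (extChartAt 𝓘(ℝ, E) x₀).target := by
  refine contDiffOn_clm_apply.2 fun a => contDiffOn_clm_apply.2 fun b => ?_
  rw [← contMDiffOn_iff_contDiffOn]
  exact ContMDiffOn.inner_bundle (IB := 𝓘(ℝ, E)) (F := E)
    (E := fun x : M => TangentSpace 𝓘(ℝ, E) x) (b := (extChartAt 𝓘(ℝ, E) x₀).symm)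
    (v := fun y => mfderiv 𝓘(ℝ, E) 𝓘(ℝ, E) (extChartAt 𝓘(ℝ, E) x₀).symm y a)
    (w := fun y => mfderiv 𝓘(ℝ, E) 𝓘(ℝ, E) (extChartAt 𝓘(ℝ, E) x₀).symm y b)
    (contMDiffOn_mfderiv_extChartAt_symm x₀ a) (contMDiffOn_mfderiv_extChartAt_symm x₀ b)

theorem isContinuousRiemannianBundle_tangent :
    IsContinuousRiemannianBundle E (fun x : M => TangentSpace 𝓘(ℝ, E) x) := by
  obtain ⟨g, hg, h⟩ := IsContMDiffRiemannianBundle.exists_contMDiff (IB := 𝓘(ℝ, E)) (n := ∞)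
    (F := E) (E := fun x : M => TangentSpace 𝓘(ℝ, E) x)
  exact ⟨g, hg.continuous, h⟩

/-- Near `x₀`, the norm of a tangent vector is comparable with the norm of its coordinates, and the
metric and its Christoffel symbols are bounded in the chart at `x₀`. -/
theorem eventually_chartMetric_bounds [FiniteDimensional ℝ E] (x₀ : M) :
    ∃ C : ℝ, 0 < C ∧ ∀ᶠ x in nhds x₀, x ∈ (extChartAt 𝓘(ℝ, E) x₀).source ∧
      (∀ u : TangentSpace 𝓘(ℝ, E) x, ‖u‖ ≤ C * ‖tangentCoordChange 𝓘(ℝ, E) x x₀ x u‖) ∧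
      (∀ u : TangentSpace 𝓘(ℝ, E) x, ‖tangentCoordChange 𝓘(ℝ, E) x x₀ x u‖ ≤ C * ‖u‖) ∧
      (∀ a b : E, |chartMetric x₀ (extChartAt 𝓘(ℝ, E) x₀ x) a b| ≤ C * ‖a‖ * ‖b‖) ∧
      ∀ a b w : E, |christoffelFirst (chartMetric x₀) (extChartAt 𝓘(ℝ, E) x₀ x) a b w| ≤
        C * ‖a‖ * ‖b‖ * ‖w‖ := by
  have := isContinuousRiemannianBundle_tangent (E := E) (M := M)
  obtain ⟨C₁, hC₁, h₁⟩ :=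
    eventually_norm_trivializationAt_lt E (fun x : M => TangentSpace 𝓘(ℝ, E) x) x₀
  obtain ⟨C₂, hC₂, h₂⟩ :=
    eventually_norm_symmL_trivializationAt_lt E (fun x : M => TangentSpace 𝓘(ℝ, E) x) x₀
  have hmem : (extChartAt 𝓘(ℝ, E) x₀).target ∈ nhds (extChartAt 𝓘(ℝ, E) x₀ x₀) :=
    extChartAt_target_mem_nhds x₀
  have hg : ContDiffAt ℝ 1 (chartMetric x₀) (extChartAt 𝓘(ℝ, E) x₀ x₀) :=
    (contDiffOn_chartMetric x₀).contDiffAt hmem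
  set C₃ := ‖chartMetric x₀ (extChartAt 𝓘(ℝ, E) x₀ x₀)‖ + 1
  set C₄ := ‖fderiv ℝ (chartMetric x₀) (extChartAt 𝓘(ℝ, E) x₀ x₀)‖ + 1
  have h₃ : ∀ᶠ y in nhds (extChartAt 𝓘(ℝ, E) x₀ x₀), ‖chartMetric x₀ y‖ < C₃ :=
    hg.continuousAt.norm.eventually_lt_const (lt_add_one _)
  have h₄ : ∀ᶠ y in nhds (extChartAt 𝓘(ℝ, E) x₀ x₀), ‖fderiv ℝ (chartMetric x₀) y‖ < C₄ :=
    ((hg.fderiv_right (m := 0) le_rfl).continuousAt.norm).eventually_lt_const (lt_add_one _)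
  have hφ : Filter.Tendsto (extChartAt 𝓘(ℝ, E) x₀) (nhds x₀) (nhds (extChartAt 𝓘(ℝ, E) x₀ x₀)) :=
    continuousAt_extChartAt x₀
  have hp₃ : 0 < C₃ := by positivity
  have hp₄ : 0 < C₄ := by positivity
  refine ⟨C₁ + C₂ + C₃ + 3 / 2 * C₄, by positivity, ?_⟩
  filter_upwards [h₁, h₂, hφ.eventually h₃, hφ.eventually h₄,
    extChartAt_source_mem_nhds (I := 𝓘(ℝ, E)) x₀] with x hx₁ hx₂ hx₃ hx₄ hx
  have hx' : x ∈ (chartAt E x₀).source := by simpa using hx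
  refine ⟨hx, fun u => ?_, fun u => ?_, fun a b => ?_, fun a b w => ?_⟩
  · have h := (((trivializationAt E (TangentSpace 𝓘(ℝ, E)) x₀).symmL ℝ x).le_opNorm
      (tangentCoordChange 𝓘(ℝ, E) x x₀ x u)).trans
      (mul_le_mul_of_nonneg_right hx₂.le (norm_nonneg _))
    rw [TangentBundle.symmL_trivializationAt_eq_core hx'] at h
    have h'' : ‖u‖ ≤ C₂ * ‖tangentCoordChange 𝓘(ℝ, E) x x₀ x u‖ := by
      conv_lhs => rw [← tangentCoordChange_leftInv hx u]
      exact h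
    refine h''.trans (mul_le_mul_of_nonneg_right ?_ (norm_nonneg _))
    linarith
  · have h := (((trivializationAt E (TangentSpace 𝓘(ℝ, E)) x₀).continuousLinearMapAt ℝ x).le_opNorm
      u).trans (mul_le_mul_of_nonneg_right hx₁.le (norm_nonneg _))
    rw [TangentBundle.continuousLinearMapAt_trivializationAt_eq_core hx'] at h
    refine le_trans h (mul_le_mul_of_nonneg_right ?_ (norm_nonneg _))
    linarith
  · have h := (chartMetric x₀ (extChartAt 𝓘(ℝ, E) x₀ x)).le_opNorm₂ a b
    rw [Real.norm_eq_abs] at h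
    refine h.trans ?_
    gcongr
    linarith
  · refine (abs_christoffelFirst_le _ _ a b w).trans ?_
    gcongr
    linarith

end ChartMetric

/-! ### Velocities of curves in the tangent bundle -/

section Curve

variable {E : Type*} [NormedAddCommGroup E] [NormedSpace ℝ E]
  {M : Type*} [MetricSpace M] [ChartedSpace E M] [IsManifold 𝓘(ℝ, E) ∞ M]

theorem horizontalPart_eq (p : TangentBundle 𝓘(ℝ, E) M) (ξ : TangentSpace 𝓘(ℝ, E).tangent p) :
    horizontalPart p ξ = (ξ : E × E).1 := by
  have hproj : ContMDiff 𝓘(ℝ, E).tangent 𝓘(ℝ, E) 1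
      (TotalSpace.proj : TangentBundle 𝓘(ℝ, E) M → M) := contMDiff_proj _
  have hd : MDifferentiableAt 𝓘(ℝ, E).tangent 𝓘(ℝ, E)
    (TotalSpace.proj : TangentBundle 𝓘(ℝ, E) M → M) p := hproj.mdifferentiable one_ne_zero p
  rw [horizontalPart, hd.mfderiv]
  have hev : writtenInExtChartAt 𝓘(ℝ, E).tangent 𝓘(ℝ, E) p
      (TotalSpace.proj : TangentBundle 𝓘(ℝ, E) M → M) =ᶠ[nhds (extChartAt 𝓘(ℝ, E).tangent p p)]
      (Prod.fst : E × E → E) := by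
    filter_upwards [extChartAt_target_mem_nhds (I := 𝓘(ℝ, E).tangent) p] with y hy
    have h := (extChartAt 𝓘(ℝ, E).tangent p).right_inv hy
    rw [extChartAt_tangent] at h
    exact congrArg Prod.fst h
  have hr : range (𝓘(ℝ, E).tangent : E × E → E × E) = univ := by
    simp
  erw [hr, fderivWithin_univ, hev.fderiv_eq, fderiv_fst]
  rfl

theorem hasDerivAt_extChartAt_tangent {γ : ℝ → TangentBundle 𝓘(ℝ, E) M} {t : ℝ}
    (h : MDifferentiableAt 𝓘(ℝ, ℝ) 𝓘(ℝ, E).tangent γ t) :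
    HasDerivAt (fun s => (extChartAt 𝓘(ℝ, E) (γ t).1 (γ s).1, vecCoord (γ t).1 (γ s)))
      (show E × E from mfderiv 𝓘(ℝ, ℝ) 𝓘(ℝ, E).tangent γ t (1 : ℝ)) t := by
  have h1 : HasFDerivWithinAt
      (fun s => (extChartAt 𝓘(ℝ, E) (γ t).1 (γ s).1, vecCoord (γ t).1 (γ s)))
      (show ℝ →L[ℝ] E × E from mfderiv 𝓘(ℝ, ℝ) 𝓘(ℝ, E).tangent γ t) (range (𝓘(ℝ, ℝ) : ℝ → ℝ)) t :=
    h.hasMFDerivAt.2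
  rw [modelWithCornersSelf_coe, range_id] at h1
  exact (hasFDerivWithinAt_univ.1 h1).hasDerivAt

theorem hasDerivAt_transition {ψ : E → E} {Y V : ℝ → E} {a b : E} {t : ℝ}
    (hψ : ContDiffAt ℝ 2 ψ (Y t)) (hY : HasDerivAt Y a t) (hV : HasDerivAt V b t) :
    HasDerivAt (fun s => ψ (Y s)) (fderiv ℝ ψ (Y t) a) t ∧
      HasDerivAt (fun s => fderiv ℝ ψ (Y s) (V s))
        (fderiv ℝ (fderiv ℝ ψ) (Y t) a (V t) + fderiv ℝ ψ (Y t) b) t := by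
  have hD : DifferentiableAt ℝ (fderiv ℝ ψ) (Y t) :=
    (hψ.fderiv_right (m := 1) le_rfl).differentiableAt one_ne_zero
  exact ⟨(hψ.differentiableAt two_ne_zero).hasFDerivAt.comp_hasDerivAt t hY,
    (hD.hasFDerivAt.comp_hasDerivAt t hY).clm_apply hV⟩

variable [RiemannianBundle (fun x : M => TangentSpace 𝓘(ℝ, E) x)]

theorem chartMetric_self (x : M) (a b : E) :
    chartMetric x (extChartAt 𝓘(ℝ, E) x x) a b =
      inner ℝ (E := TangentSpace 𝓘(ℝ, E) x) a b := by
  have e : ∀ a : E, tangentCoordChange 𝓘(ℝ, E) x x x a = a := fun a =>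
    tangentCoordChange_self (mem_extChartAt_source x)
  have h := chartMetric_apply (mem_extChartAt_source (I := 𝓘(ℝ, E)) x) a b
  rwa [e, e] at h

/-- The vertical part, tested against a vector `u`: the Christoffel term was defined by duality. -/
theorem inner_verticalPart [FiniteDimensional ℝ E] (p : TangentBundle 𝓘(ℝ, E) M)
    (ξ : TangentSpace 𝓘(ℝ, E).tangent p) (u : E) :
    inner ℝ (E := TangentSpace 𝓘(ℝ, E) p.1) (verticalPart p ξ) u =
      chartMetric p.1 (extChartAt 𝓘(ℝ, E) p.1 p.1) (ξ : E × E).2 u +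
        christoffelFirst (chartMetric p.1) (extChartAt 𝓘(ℝ, E) p.1 p.1) (ξ : E × E).1 p.2 u := by
  have hc : CompleteSpace (TangentSpace 𝓘(ℝ, E) p.1) := FiniteDimensional.complete ℝ _
  have h1 : inner ℝ (E := TangentSpace 𝓘(ℝ, E) p.1)
      (christoffel p.1 (horizontalPart p ξ) p.2) u =
      christoffelForm p.1 (horizontalPart p ξ) p.2 u := by
    rw [christoffel]
    exact InnerProductSpace.toDual_symm_apply
  rw [christoffelForm, horizontalPart_eq] at h1
  exact (inner_add_left (𝕜 := ℝ) (E := TangentSpace 𝓘(ℝ, E) p.1) (ξ : E × E).2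
    (christoffel p.1 (horizontalPart p ξ) p.2) u).trans
      (congrArg₂ (· + ·) (chartMetric_self p.1 _ _).symm (by rw [horizontalPart_eq, h1]; rfl))

/-- The metrics in two charts are related by pullback under the transition map. -/
theorem chartMetric_transition {x₀ x₁ x : M} (h₀ : x ∈ (extChartAt 𝓘(ℝ, E) x₀).source)
    (h₁ : x ∈ (extChartAt 𝓘(ℝ, E) x₁).source) :
    ∀ᶠ z in nhds (extChartAt 𝓘(ℝ, E) x₁ x), ∀ a b, chartMetric x₁ z a b =
      chartMetric x₀ ((extChartAt 𝓘(ℝ, E) x₀ ∘ (extChartAt 𝓘(ℝ, E) x₁).symm) z)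
        (fderiv ℝ (extChartAt 𝓘(ℝ, E) x₀ ∘ (extChartAt 𝓘(ℝ, E) x₁).symm) z a)
        (fderiv ℝ (extChartAt 𝓘(ℝ, E) x₀ ∘ (extChartAt 𝓘(ℝ, E) x₁).symm) z b) := by
  have hl : (extChartAt 𝓘(ℝ, E) x₁).symm (extChartAt 𝓘(ℝ, E) x₁ x) = x :=
    (extChartAt 𝓘(ℝ, E) x₁).left_inv h₁
  have hs : (extChartAt 𝓘(ℝ, E) x₁).symm ⁻¹' (extChartAt 𝓘(ℝ, E) x₀).source ∈
      nhds (extChartAt 𝓘(ℝ, E) x₁ x) := by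
    refine (continuousAt_extChartAt_symm' h₁).preimage_mem_nhds ?_
    rw [hl]
    exact (isOpen_extChartAt_source x₀).mem_nhds h₀
  filter_upwards [hs, (isOpen_extChartAt_target x₁).mem_nhds
    ((extChartAt 𝓘(ℝ, E) x₁).map_source h₁)] with z hz hzt a b
  obtain ⟨x', rfl⟩ : ∃ x', x' = (extChartAt 𝓘(ℝ, E) x₁).symm z := ⟨_, rfl⟩
  have hx₁ := (extChartAt 𝓘(ℝ, E) x₁).map_target hzt
  have hx₀ : (extChartAt 𝓘(ℝ, E) x₁).symm z ∈ (extChartAt 𝓘(ℝ, E) x₀).source := hz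
  rw [← (extChartAt 𝓘(ℝ, E) x₁).right_inv hzt]
  generalize (extChartAt 𝓘(ℝ, E) x₁).symm z = x' at hx₁ hx₀ ⊢
  have key : ∀ c : E, tangentCoordChange 𝓘(ℝ, E) x₁ x₀ x' c =
      tangentCoordChange 𝓘(ℝ, E) x' x₀ x' (tangentCoordChange 𝓘(ℝ, E) x₁ x' x' c) := fun c =>
    (tangentCoordChange_comp ⟨⟨hx₁, mem_extChartAt_source x'⟩, hx₀⟩).symm
  rw [fderiv_transition, key, key, Function.comp_apply, (extChartAt 𝓘(ℝ, E) x₁).left_inv hx₁]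
  have e₀ := chartMetric_apply hx₀ (tangentCoordChange 𝓘(ℝ, E) x₁ x' x' a)
    (tangentCoordChange 𝓘(ℝ, E) x₁ x' x' b)
  have e₁ := chartMetric_apply hx₁ (tangentCoordChange 𝓘(ℝ, E) x₁ x' x' a)
    (tangentCoordChange 𝓘(ℝ, E) x₁ x' x' b)
  rw [tangentCoordChange_rightInv hx₁, tangentCoordChange_rightInv hx₁] at e₁
  exact e₁.trans e₀.symm

variable [IsContMDiffRiemannianBundle 𝓘(ℝ, E) ∞ E (fun x : M => TangentSpace 𝓘(ℝ, E) x)]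
  [FiniteDimensional ℝ E]

theorem differentiableAt_chartMetric {x₀ x : M} (h : x ∈ (extChartAt 𝓘(ℝ, E) x₀).source) :
    DifferentiableAt ℝ (chartMetric x₀) (extChartAt 𝓘(ℝ, E) x₀ x) :=
  ((contDiffOn_chartMetric x₀).contDiffAt ((isOpen_extChartAt_target x₀).mem_nhds
    ((extChartAt 𝓘(ℝ, E) x₀).map_source h))).differentiableAt one_ne_zero

/-- The velocity of a curve in `TM`, in the coordinates of an arbitrary chart. The Riemannian scalar
product of the vertical part with a vector is given by the same formula as in the chart by which the
vertical part is defined. -/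
theorem exists_hasDerivAt_coord {γ : ℝ → TangentBundle 𝓘(ℝ, E) M} {t : ℝ}
    (hγ : MDifferentiableAt 𝓘(ℝ, ℝ) 𝓘(ℝ, E).tangent γ t) {x₀ : M}
    (h₀ : (γ t).1 ∈ (extChartAt 𝓘(ℝ, E) x₀).source) :
    ∃ a b : E, HasDerivAt (fun s => extChartAt 𝓘(ℝ, E) x₀ (γ s).1) a t ∧
      HasDerivAt (fun s => vecCoord x₀ (γ s)) b t ∧
      tangentCoordChange 𝓘(ℝ, E) (γ t).1 x₀ (γ t).1
        (horizontalPart (γ t) (mfderiv 𝓘(ℝ, ℝ) 𝓘(ℝ, E).tangent γ t (1 : ℝ))) = a ∧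
      ∀ u : E,
        inner ℝ (E := TangentSpace 𝓘(ℝ, E) (γ t).1)
          (verticalPart (γ t) (mfderiv 𝓘(ℝ, ℝ) 𝓘(ℝ, E).tangent γ t (1 : ℝ))) u =
          chartMetric x₀ (extChartAt 𝓘(ℝ, E) x₀ (γ t).1) b
            (tangentCoordChange 𝓘(ℝ, E) (γ t).1 x₀ (γ t).1 u) +
          christoffelFirst (chartMetric x₀) (extChartAt 𝓘(ℝ, E) x₀ (γ t).1) a (vecCoord x₀ (γ t))
            (tangentCoordChange 𝓘(ℝ, E) (γ t).1 x₀ (γ t).1 u) := by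
  have h₁ : (γ t).1 ∈ (extChartAt 𝓘(ℝ, E) (γ t).1).source := mem_extChartAt_source (γ t).1
  have hd := hasDerivAt_extChartAt_tangent hγ
  generalize hξ : mfderiv 𝓘(ℝ, ℝ) 𝓘(ℝ, E).tangent γ t (1 : ℝ) = ξ at hd ⊢
  obtain ⟨a₁, b₁⟩ : E × E := ξ
  have hY₁ : HasDerivAt (fun s => extChartAt 𝓘(ℝ, E) (γ t).1 (γ s).1) a₁ t := hd.fst
  have hV₁ : HasDerivAt (fun s => vecCoord (γ t).1 (γ s)) b₁ t := hd.snd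
  have hcont : ContinuousAt (fun s => (γ s).1) t :=
    (FiberBundle.continuous_proj E (TangentSpace 𝓘(ℝ, E))).continuousAt.comp hγ.continuousAt
  have hsource : ∀ᶠ s in nhds t, (γ s).1 ∈ (extChartAt 𝓘(ℝ, E) x₀).source ∧
      (γ s).1 ∈ (extChartAt 𝓘(ℝ, E) (γ t).1).source :=
    (hcont.eventually ((isOpen_extChartAt_source x₀).mem_nhds h₀)).and
      (hcont.eventually ((isOpen_extChartAt_source (γ t).1).mem_nhds h₁))
  have hψ : ContDiffAt ℝ 2 (extChartAt 𝓘(ℝ, E) x₀ ∘ (extChartAt 𝓘(ℝ, E) (γ t).1).symm)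
      (extChartAt 𝓘(ℝ, E) (γ t).1 (γ t).1) :=
    contDiffAt_infty.1 (contDiffAt_transition h₀ h₁) 2
  have hT : ∀ c : E, fderiv ℝ (extChartAt 𝓘(ℝ, E) x₀ ∘ (extChartAt 𝓘(ℝ, E) (γ t).1).symm)
      (extChartAt 𝓘(ℝ, E) (γ t).1 (γ t).1) c =
      tangentCoordChange 𝓘(ℝ, E) (γ t).1 x₀ (γ t).1 c := fun c => by
    rw [fderiv_transition]
  have hv : vecCoord (γ t).1 (γ t) = (γ t).2 := vecCoord_self (γ t)
  obtain ⟨hY₀, hV₀⟩ := hasDerivAt_transition (ψ := extChartAt 𝓘(ℝ, E) x₀ ∘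
    (extChartAt 𝓘(ℝ, E) (γ t).1).symm) hψ hY₁ hV₁
  refine ⟨_, _, hY₀.congr_of_eventuallyEq (hsource.mono fun s hs => ?_),
    hV₀.congr_of_eventuallyEq (hsource.mono fun s hs => ?_), ?_, fun u => ?_⟩
  · dsimp only
    rw [Function.comp_apply, (extChartAt 𝓘(ℝ, E) (γ t).1).left_inv hs.2]
  · dsimp only
    rw [fderiv_transition, vecCoord_change hs.1 hs.2]
  · exact (congrArg _ (horizontalPart_eq (γ t) (a₁, b₁))).trans (hT a₁).symm
  · have hpull := chartMetric_transition h₀ h₁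
    have hψt : (extChartAt 𝓘(ℝ, E) x₀ ∘ (extChartAt 𝓘(ℝ, E) (γ t).1).symm)
        (extChartAt 𝓘(ℝ, E) (γ t).1 (γ t).1) = extChartAt 𝓘(ℝ, E) x₀ (γ t).1 := by
      rw [Function.comp_apply, (extChartAt 𝓘(ℝ, E) (γ t).1).left_inv h₁]
    have hg₀ := differentiableAt_chartMetric h₀
    rw [← hψt] at hg₀
    have hchr := christoffelFirst_pullback hψ hg₀ (differentiableAt_chartMetric h₁)
      (fun _ _ => real_inner_comm (F := TangentSpace 𝓘(ℝ, E) ((extChartAt 𝓘(ℝ, E) x₀).symm _)) _ _)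
      hpull a₁ (vecCoord (γ t).1 (γ t)) u
    have hin := inner_verticalPart (γ t) (a₁, b₁) u
    rw [← hv, hchr, hpull.self_of_nhds, hψt] at hin
    rw [hin, vecCoord_change h₀ h₁, map_add]
    simp only [add_apply, hT]
    ring

end Curve

section Bounds

variable {E : Type*} [NormedAddCommGroup E] [NormedSpace ℝ E] [FiniteDimensional ℝ E]
  {M : Type*} [MetricSpace M] [ChartedSpace E M] [IsManifold 𝓘(ℝ, E) ∞ M]
  [RiemannianBundle (fun x : M => TangentSpace 𝓘(ℝ, E) x)]
  [IsContMDiffRiemannianBundle 𝓘(ℝ, E) ∞ E (fun x : M => TangentSpace 𝓘(ℝ, E) x)]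

/-- Near the fibre over `x₀`, the horizontal and vertical parts of the velocity of a curve in `TM`
are comparable with the derivatives `a`, `b` of the coordinates of the curve in the chart at `x₀`,
up to a Christoffel term of size `‖a‖ ‖v‖`. -/
theorem exists_velocity_bounds (x₀ : M) :
    ∃ C : ℝ, 0 < C ∧ ∀ᶠ x in nhds x₀, x ∈ (extChartAt 𝓘(ℝ, E) x₀).source ∧
      (∀ u : TangentSpace 𝓘(ℝ, E) x, ‖u‖ ≤ C * ‖tangentCoordChange 𝓘(ℝ, E) x x₀ x u‖) ∧
      (∀ u : TangentSpace 𝓘(ℝ, E) x, ‖tangentCoordChange 𝓘(ℝ, E) x x₀ x u‖ ≤ C * ‖u‖) ∧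
      ∀ (γ : ℝ → TangentBundle 𝓘(ℝ, E) M) (t : ℝ), (γ t).1 = x →
        MDifferentiableAt 𝓘(ℝ, ℝ) 𝓘(ℝ, E).tangent γ t →
        ∃ a b : E, HasDerivAt (fun s => extChartAt 𝓘(ℝ, E) x₀ (γ s).1) a t ∧
          HasDerivAt (fun s => vecCoord x₀ (γ s)) b t ∧
          ‖horizontalPart (γ t) (mfderiv 𝓘(ℝ, ℝ) 𝓘(ℝ, E).tangent γ t (1 : ℝ))‖ ≤ C * ‖a‖ ∧
          ‖verticalPart (γ t) (mfderiv 𝓘(ℝ, ℝ) 𝓘(ℝ, E).tangent γ t (1 : ℝ))‖ ≤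
            C * (‖b‖ + ‖a‖ * ‖vecCoord x₀ (γ t)‖) ∧
          ‖a‖ ≤ C * ‖horizontalPart (γ t) (mfderiv 𝓘(ℝ, ℝ) 𝓘(ℝ, E).tangent γ t (1 : ℝ))‖ ∧
          ‖b‖ ≤ C * (‖verticalPart (γ t) (mfderiv 𝓘(ℝ, ℝ) 𝓘(ℝ, E).tangent γ t (1 : ℝ))‖ +
            ‖a‖ * ‖vecCoord x₀ (γ t)‖) := by
  obtain ⟨C, hC, hev⟩ := eventually_chartMetric_bounds (E := E) x₀
  refine ⟨C + C ^ 2 + C ^ 3, by positivity, hev.mono ?_⟩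
  rintro x ⟨hx, h₁, h₂, h₃, h₄⟩
  have hC₁ : C ≤ C + C ^ 2 + C ^ 3 := by nlinarith [pow_pos hC 2, pow_pos hC 3]
  have hC₂ : C ^ 2 ≤ C + C ^ 2 + C ^ 3 := by nlinarith [pow_pos hC 2, pow_pos hC 3]
  have hC₃ : C ^ 3 ≤ C + C ^ 2 + C ^ 3 := by nlinarith [pow_pos hC 2, pow_pos hC 3]
  refine ⟨hx, fun u => (h₁ u).trans (by gcongr), fun u => (h₂ u).trans (by gcongr), ?_⟩
  rintro γ t rfl hγ
  obtain ⟨a, b, ha, hb, hhor, hvert⟩ := exists_hasDerivAt_coord hγ hx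
  refine ⟨a, b, ha, hb, ?_⟩
  generalize horizontalPart (γ t) (mfderiv 𝓘(ℝ, ℝ) 𝓘(ℝ, E).tangent γ t (1 : ℝ)) = hor at hhor ⊢
  generalize verticalPart (γ t) (mfderiv 𝓘(ℝ, ℝ) 𝓘(ℝ, E).tangent γ t (1 : ℝ)) = vert at hvert ⊢
  have hvnn := norm_nonneg (vecCoord x₀ (γ t))
  generalize hV : vecCoord x₀ (γ t) = V at hvert hvnn ⊢
  have e₁ : ‖hor‖ ≤ C * ‖a‖ := hhor ▸ h₁ hor
  have e₂ : ‖a‖ ≤ C * ‖hor‖ := hhor ▸ h₂ hor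
  -- test the formula for the vertical part against the vertical part itself
  have e₃ : ‖vert‖ ≤ C ^ 2 * (‖b‖ + ‖a‖ * ‖V‖) := by
    have i₁ := real_inner_self_eq_norm_sq vert
    have i₂ := hvert vert
    have i₃ := h₃ b (tangentCoordChange 𝓘(ℝ, E) (γ t).1 x₀ (γ t).1 vert)
    have i₄ := h₄ a V (tangentCoordChange 𝓘(ℝ, E) (γ t).1 x₀ (γ t).1 vert)
    have i₅ := h₂ vert
    have i₆ : ‖vert‖ ^ 2 ≤ C * (‖b‖ + ‖a‖ * ‖V‖) * (C * ‖vert‖) := by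
      calc ‖vert‖ ^ 2 = _ := i₁.symm.trans i₂
        _ ≤ _ := add_le_add ((le_abs_self _).trans i₃) ((le_abs_self _).trans i₄)
        _ = C * (‖b‖ + ‖a‖ * ‖V‖) * ‖tangentCoordChange 𝓘(ℝ, E) (γ t).1 x₀ (γ t).1 vert‖ := by
          ring
        _ ≤ _ := by gcongr
    rcases (norm_nonneg vert).eq_or_lt with h0 | h0
    · rw [← h0]; positivity
    · exact le_of_mul_le_mul_right (by linarith) h0
  -- test the formula for the vertical part against the vector with coordinates `b`
  have e₄ : ‖b‖ ≤ C * ‖vert‖ + C ^ 3 * (‖a‖ * ‖V‖) := by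
    obtain ⟨u, hu⟩ : ∃ u : TangentSpace 𝓘(ℝ, E) (γ t).1,
        tangentCoordChange 𝓘(ℝ, E) (γ t).1 x₀ (γ t).1 u = b :=
      ⟨_, tangentCoordChange_rightInv hx b⟩
    have i₁ := chartMetric_apply hx u u
    have i₂ := hvert u
    have i₃ := h₄ a V b
    have i₄ := h₂ u
    have i₅ := real_inner_le_norm vert u
    rw [hu] at i₁ i₂ i₄
    rw [real_inner_self_eq_norm_sq] at i₁
    have i₇ : ‖u‖ ^ 2 ≤ ‖vert‖ * ‖u‖ + C * ‖a‖ * ‖V‖ * (C * ‖u‖) := by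
      have i₈ : C * ‖a‖ * ‖V‖ * ‖b‖ ≤ C * ‖a‖ * ‖V‖ * (C * ‖u‖) := by gcongr
      have i₉ := neg_le_of_abs_le i₃
      have i₁₀ : ‖u‖ ^ 2 = inner ℝ vert u -
          christoffelFirst (chartMetric x₀) (extChartAt 𝓘(ℝ, E) x₀ (γ t).1) a V b := by
        rw [← i₁]; exact (sub_eq_of_eq_add i₂).symm
      linarith
    have i₈ : ‖u‖ ≤ ‖vert‖ + C ^ 2 * (‖a‖ * ‖V‖) := by
      rcases (norm_nonneg u).eq_or_lt with h0 | h0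
      · rw [← h0]; positivity
      · exact le_of_mul_le_mul_right (by linarith) h0
    calc ‖b‖ ≤ C * ‖u‖ := i₄
      _ ≤ C * (‖vert‖ + C ^ 2 * (‖a‖ * ‖V‖)) := by gcongr
      _ = _ := by ring
  refine ⟨e₁.trans (by gcongr), e₃.trans (by gcongr), e₂.trans (by gcongr), e₄.trans ?_⟩
  rw [mul_add]
  gcongr

end Bounds

/-! ### The Sasaki length and the triangle inequality -/

section Sasaki

variable {E : Type*} [NormedAddCommGroup E] [NormedSpace ℝ E] [FiniteDimensional ℝ E]
  {M : Type*} [MetricSpace M] [ChartedSpace E M] [IsManifold 𝓘(ℝ, E) ∞ M]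
  [RiemannianBundle (fun x : M => TangentSpace 𝓘(ℝ, E) x)]

theorem sasakiENorm_smul (p : TangentBundle 𝓘(ℝ, E) M) (r : ℝ)
    (ξ : TangentSpace 𝓘(ℝ, E).tangent p) : sasakiENorm p (r • ξ) = ‖r‖ₑ * sasakiENorm p ξ := by
  have hh : horizontalPart p (r • ξ) = r • horizontalPart p ξ := by
    simp only [horizontalPart, map_smul]
  have hv : verticalPart p (r • ξ) = r • verticalPart p ξ := by
    refine ext_inner_right ℝ fun u => ?_
    have h : ∀ a b v u : E,
        chartMetric p.1 (extChartAt 𝓘(ℝ, E) p.1 p.1) (r • b) u +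
          christoffelFirst (chartMetric p.1) (extChartAt 𝓘(ℝ, E) p.1 p.1) (r • a) v u =
        r * (chartMetric p.1 (extChartAt 𝓘(ℝ, E) p.1 p.1) b u +
          christoffelFirst (chartMetric p.1) (extChartAt 𝓘(ℝ, E) p.1 p.1) a v u) :=
      fun a b v u => by
      rw [christoffelFirst_apply, christoffelFirst_apply]
      simp only [map_smul, smul_apply, smul_eq_mul]
      ring
    rw [real_inner_smul_left, inner_verticalPart p ξ u]
    exact (inner_verticalPart p (r • ξ) u).trans (h (ξ : E × E).1 (ξ : E × E).2 p.2 u)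
  rw [sasakiENorm, sasakiENorm, hh, hv, enorm_smul, enorm_smul, mul_pow, mul_pow, ← mul_add,
    ENNReal.mul_rpow_of_nonneg _ _ (by norm_num), ENNReal.sqrt_sq]

theorem sasakiEDist_self (p : TangentBundle 𝓘(ℝ, E) M) : sasakiEDist p p = 0 :=
  letI : ∀ p : TangentBundle 𝓘(ℝ, E) M, ENorm (TangentSpace 𝓘(ℝ, E).tangent p) :=
    fun p => ⟨sasakiENorm p⟩
  letI : ∀ p : TangentBundle 𝓘(ℝ, E) M, ENormSMulClass ℝ (TangentSpace 𝓘(ℝ, E).tangent p) :=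
    fun p => ⟨sasakiENorm_smul p⟩
  riemannianEDist_self

theorem sasakiEDist_comm (p q : TangentBundle 𝓘(ℝ, E) M) : sasakiEDist p q = sasakiEDist q p :=
  letI : ∀ p : TangentBundle 𝓘(ℝ, E) M, ENorm (TangentSpace 𝓘(ℝ, E).tangent p) :=
    fun p => ⟨sasakiENorm p⟩
  letI : ∀ p : TangentBundle 𝓘(ℝ, E) M, ENormSMulClass ℝ (TangentSpace 𝓘(ℝ, E).tangent p) :=
    fun p => ⟨sasakiENorm_smul p⟩
  riemannianEDist_comm

theorem sasakiEDist_triangle (p q r : TangentBundle 𝓘(ℝ, E) M) :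
    sasakiEDist p r ≤ sasakiEDist p q + sasakiEDist q r :=
  letI : ∀ p : TangentBundle 𝓘(ℝ, E) M, ENorm (TangentSpace 𝓘(ℝ, E).tangent p) :=
    fun p => ⟨sasakiENorm p⟩
  letI : ∀ p : TangentBundle 𝓘(ℝ, E) M, ENormSMulClass ℝ (TangentSpace 𝓘(ℝ, E).tangent p) :=
    fun p => ⟨sasakiENorm_smul p⟩
  riemannianEDist_triangle

theorem sasakiEDist_le_lintegral {γ : ℝ → TangentBundle 𝓘(ℝ, E) M} {a b : ℝ} (hab : a ≤ b)
    (hγ : ContMDiffOn 𝓘(ℝ, ℝ) 𝓘(ℝ, E).tangent 1 γ (Icc a b)) :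
    sasakiEDist (γ a) (γ b) ≤
      ∫⁻ t in Icc a b, sasakiENorm (γ t) (mfderiv 𝓘(ℝ, ℝ) 𝓘(ℝ, E).tangent γ t (1 : ℝ)) := by
  let _ : ∀ p : TangentBundle 𝓘(ℝ, E) M, ENorm (TangentSpace 𝓘(ℝ, E).tangent p) :=
    fun p => ⟨sasakiENorm p⟩
  let _ : ∀ p : TangentBundle 𝓘(ℝ, E) M, ENormSMulClass ℝ (TangentSpace 𝓘(ℝ, E).tangent p) :=
    fun p => ⟨sasakiENorm_smul p⟩
  exact (riemannianEDist_le_pathELength hγ rfl rfl hab).trans_eq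
    (pathELength_eq_lintegral_mfderiv_Icc ..)

theorem exists_path_of_sasakiEDist_lt {p q : TangentBundle 𝓘(ℝ, E) M} {r : ℝ≥0∞}
    (h : sasakiEDist p q < r) :
    ∃ γ : ℝ → TangentBundle 𝓘(ℝ, E) M, γ 0 = p ∧ γ 1 = q ∧
      ContMDiff 𝓘(ℝ, ℝ) 𝓘(ℝ, E).tangent 1 γ ∧
      ∫⁻ t in Icc 0 1, sasakiENorm (γ t) (mfderiv 𝓘(ℝ, ℝ) 𝓘(ℝ, E).tangent γ t (1 : ℝ)) < r := by
  let _ : ∀ p : TangentBundle 𝓘(ℝ, E) M, ENorm (TangentSpace 𝓘(ℝ, E).tangent p) :=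
    fun p => ⟨sasakiENorm p⟩
  let _ : ∀ p : TangentBundle 𝓘(ℝ, E) M, ENormSMulClass ℝ (TangentSpace 𝓘(ℝ, E).tangent p) :=
    fun p => ⟨sasakiENorm_smul p⟩
  obtain ⟨γ, h0, h1, hγ, hlt, -⟩ := exists_lt_locally_constant_of_riemannianEDist_lt h zero_lt_one
  rw [pathELength_eq_lintegral_mfderiv_Icc] at hlt
  exact ⟨γ, h0, h1, hγ, hlt⟩

theorem enorm_horizontalPart_le (p : TangentBundle 𝓘(ℝ, E) M)
    (ξ : TangentSpace 𝓘(ℝ, E).tangent p) : ‖horizontalPart p ξ‖ₑ ≤ sasakiENorm p ξ :=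
  le_sqrt_sq_add_sq_left _ _

theorem enorm_verticalPart_le (p : TangentBundle 𝓘(ℝ, E) M)
    (ξ : TangentSpace 𝓘(ℝ, E).tangent p) : ‖verticalPart p ξ‖ₑ ≤ sasakiENorm p ξ :=
  le_sqrt_sq_add_sq_right _ _

theorem sasakiENorm_le (p : TangentBundle 𝓘(ℝ, E) M) (ξ : TangentSpace 𝓘(ℝ, E).tangent p) :
    sasakiENorm p ξ ≤ ‖horizontalPart p ξ‖ₑ + ‖verticalPart p ξ‖ₑ := by
  rw [sasakiENorm, ENNReal.sqrt_le_iff, add_sq]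
  gcongr
  exact le_self_add

end Sasaki

/-! ### The norm is nonexpansive for the Sasaki distance -/

section SasakiNorm

variable {E : Type*} [NormedAddCommGroup E] [NormedSpace ℝ E]
  {M : Type*} [MetricSpace M] [ChartedSpace E M] [IsManifold 𝓘(ℝ, E) ∞ M]
  [RiemannianBundle (fun x : M => TangentSpace 𝓘(ℝ, E) x)]
  [IsContMDiffRiemannianBundle 𝓘(ℝ, E) ∞ E (fun x : M => TangentSpace 𝓘(ℝ, E) x)]

theorem contDiff_inner_self {γ : ℝ → TangentBundle 𝓘(ℝ, E) M}
    (hγ : ContMDiff 𝓘(ℝ, ℝ) 𝓘(ℝ, E).tangent 1 γ) :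
    ContDiff ℝ 1 (fun s => inner ℝ (γ s).2 (γ s).2) := by
  rw [← contMDiff_iff_contDiff]
  exact ContMDiff.inner_bundle (IB := 𝓘(ℝ, E)) (F := E)
    (E := fun x : M => TangentSpace 𝓘(ℝ, E) x) (b := fun s => (γ s).1)
    (v := fun s => (γ s).2) (w := fun s => (γ s).2) hγ hγ

variable [FiniteDimensional ℝ E]

/-- Compatibility of the covariant derivative with the metric: the squared norm of a vector field
`X` along a curve has derivative `2 ⟪∇X, X⟫`. -/
theorem hasDerivAt_inner_self {γ : ℝ → TangentBundle 𝓘(ℝ, E) M} {t : ℝ}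
    (hγ : MDifferentiableAt 𝓘(ℝ, ℝ) 𝓘(ℝ, E).tangent γ t) :
    HasDerivAt (fun s => inner ℝ (γ s).2 (γ s).2)
      (2 * inner ℝ (verticalPart (γ t) (mfderiv 𝓘(ℝ, ℝ) 𝓘(ℝ, E).tangent γ t (1 : ℝ))) (γ t).2)
      t := by
  have h₁ : (γ t).1 ∈ (extChartAt 𝓘(ℝ, E) (γ t).1).source := mem_extChartAt_source (γ t).1
  obtain ⟨a, b, ha, hb, -, hvert⟩ := exists_hasDerivAt_coord hγ h₁
  have hcont : ContinuousAt (fun s => (γ s).1) t :=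
    (FiberBundle.continuous_proj E (TangentSpace 𝓘(ℝ, E))).continuousAt.comp hγ.continuousAt
  have hsource : ∀ᶠ s in nhds t, (γ s).1 ∈ (extChartAt 𝓘(ℝ, E) (γ t).1).source :=
    hcont.eventually ((isOpen_extChartAt_source (γ t).1).mem_nhds h₁)
  have hg := (differentiableAt_chartMetric h₁).hasFDerivAt.comp_hasDerivAt t ha
  have hd := (hg.clm_apply hb).clm_apply hb
  have hev : (fun s => inner ℝ (γ s).2 (γ s).2) =ᶠ[nhds t] fun s =>
      chartMetric (γ t).1 (extChartAt 𝓘(ℝ, E) (γ t).1 (γ s).1) (vecCoord (γ t).1 (γ s))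
        (vecCoord (γ t).1 (γ s)) :=
    hsource.mono fun s hs => (chartMetric_apply hs (γ s).2 (γ s).2).symm
  have hd' := HasDerivAt.congr_of_eventuallyEq hd hev
  refine hd'.congr_deriv ?_
  rw [hvert (γ t).2]
  change _ = 2 * (chartMetric (γ t).1 (extChartAt 𝓘(ℝ, E) (γ t).1 (γ t).1) b
    (vecCoord (γ t).1 (γ t)) + christoffelFirst (chartMetric (γ t).1)
      (extChartAt 𝓘(ℝ, E) (γ t).1 (γ t).1) a (vecCoord (γ t).1 (γ t)) (vecCoord (γ t).1 (γ t)))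
  rw [christoffelFirst_apply]
  have hs : chartMetric (γ t).1 (extChartAt 𝓘(ℝ, E) (γ t).1 (γ t).1) (vecCoord (γ t).1 (γ t)) b =
      chartMetric (γ t).1 (extChartAt 𝓘(ℝ, E) (γ t).1 (γ t).1) b (vecCoord (γ t).1 (γ t)) :=
    real_inner_comm (F := TangentSpace 𝓘(ℝ, E) ((extChartAt 𝓘(ℝ, E) (γ t).1).symm _)) _ _
  simp only [Function.comp_apply, add_apply]
  rw [hs]
  ring

/-- The norm `(x, v) ↦ ‖v‖_x` is nonexpansive for the Sasaki distance. -/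
theorem enorm_snd_le_add_sasakiEDist (p q : TangentBundle 𝓘(ℝ, E) M) :
    ‖q.2‖ₑ ≤ ‖p.2‖ₑ + sasakiEDist p q := by
  refine ENNReal.le_of_forall_pos_le_add fun ε hε hfin => ?_
  have hε2 : (0 : ℝ≥0∞) < (ε / 2 : NNReal) := by exact_mod_cast half_pos hε
  have hS : sasakiEDist p q ≠ ⊤ := (ENNReal.add_lt_top.1 hfin).2.ne
  obtain ⟨γ, rfl, rfl, hγ, hlt⟩ := exists_path_of_sasakiEDist_lt
    (ENNReal.lt_add_right hS hε2.ne')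
  -- the norm is not differentiable at zero vectors, hence the regularization by `δ`
  set δ : ℝ := ((ε / 2 : NNReal) : ℝ)
  have hδ : 0 < δ := by exact_mod_cast half_pos hε
  set f : ℝ → ℝ := fun s => inner ℝ (γ s).2 (γ s).2
  have hf : ∀ s, f s = ‖(γ s).2‖ ^ 2 := fun s => real_inner_self_eq_norm_sq _
  have hpos : ∀ s, 0 < f s + δ ^ 2 := fun s => by rw [hf]; positivity
  have hC : ContDiff ℝ 1 (fun s => √(f s + δ ^ 2)) :=
    ((contDiff_inner_self hγ).add contDiff_const).sqrt fun s => (hpos s).ne'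
  have hle : ∀ s, ‖(γ s).2‖ ≤ √(f s + δ ^ 2) := fun s => by
    rw [hf]; exact Real.le_sqrt_of_sq_le (by nlinarith)
  have hub : ∀ s, √(f s + δ ^ 2) ≤ ‖(γ s).2‖ + δ := fun s => by
    rw [hf, Real.sqrt_le_left (by positivity)]
    nlinarith [norm_nonneg (γ s).2]
  have hder : ∀ s, ‖deriv (fun s => √(f s + δ ^ 2)) s‖ₑ ≤
      sasakiENorm (γ s) (mfderiv 𝓘(ℝ, ℝ) 𝓘(ℝ, E).tangent γ s (1 : ℝ)) := fun s => by
    have h := ((hasDerivAt_inner_self (hγ.mdifferentiable one_ne_zero s)).add_const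
      (δ ^ 2)).sqrt (hpos s).ne'
    rw [h.deriv]
    refine le_trans ?_ (enorm_verticalPart_le _ _)
    have hs := Real.sqrt_pos.2 (hpos s)
    rw [← ofReal_norm, ← ofReal_norm]
    refine ENNReal.ofReal_le_ofReal ?_
    rw [Real.norm_eq_abs, abs_div, abs_of_pos (mul_pos two_pos hs), abs_mul, abs_two,
      mul_div_mul_left _ _ two_ne_zero, div_le_iff₀ hs]
    exact (abs_real_inner_le_norm _ _).trans (by gcongr; exact hle s)
  have hint := (enorm_sub_le_lintegral_deriv_of_contDiffOn_Icc hC.contDiffOn zero_le_one).trans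
    ((lintegral_mono fun s => hder s).trans hlt.le)
  calc ‖(γ 1).2‖ₑ ≤ ENNReal.ofReal √(f 1 + δ ^ 2) := by
        rw [← ofReal_norm]; exact ENNReal.ofReal_le_ofReal (hle 1)
    _ ≤ ENNReal.ofReal (√(f 0 + δ ^ 2) + ‖√(f 1 + δ ^ 2) - √(f 0 + δ ^ 2)‖) := by
        refine ENNReal.ofReal_le_ofReal ?_
        have := le_abs_self (√(f 1 + δ ^ 2) - √(f 0 + δ ^ 2))
        rw [Real.norm_eq_abs]; linarith
    _ ≤ ENNReal.ofReal (‖(γ 0).2‖ + δ) + ‖√(f 1 + δ ^ 2) - √(f 0 + δ ^ 2)‖ₑ := by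
        rw [ENNReal.ofReal_add (Real.sqrt_nonneg _) (norm_nonneg _), ofReal_norm]
        gcongr
        exact hub 0
    _ ≤ (‖(γ 0).2‖ₑ + (ε / 2 : NNReal)) + (sasakiEDist (γ 0) (γ 1) + (ε / 2 : NNReal)) := by
        refine add_le_add ?_ hint
        rw [ENNReal.ofReal_add (norm_nonneg _) hδ.le, ofReal_norm, ENNReal.ofReal_coe_nnreal]
    _ = ‖(γ 0).2‖ₑ + sasakiEDist (γ 0) (γ 1) + ε := by
        rw [add_add_add_comm, ← ENNReal.coe_add, add_halves]

end SasakiNorm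

/-! ### The topology of the Sasaki distance -/

section SasakiTopology

variable {E : Type*} [NormedAddCommGroup E] [NormedSpace ℝ E] [FiniteDimensional ℝ E]
  {M : Type*} [MetricSpace M] [ChartedSpace E M] [IsManifold 𝓘(ℝ, E) ∞ M]
  [RiemannianBundle (fun x : M => TangentSpace 𝓘(ℝ, E) x)]
  [IsContMDiffRiemannianBundle 𝓘(ℝ, E) ∞ E (fun x : M => TangentSpace 𝓘(ℝ, E) x)]

/-- A short curve starting at `p` stays in the chart at the base point of `p`, and the vector
component of its end point in this chart is close to that of `p`. -/
theorem exists_enorm_vecCoord_sub_le [IsRiemannianManifold 𝓘(ℝ, E) M]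
    (p : TangentBundle 𝓘(ℝ, E) M) :
    ∃ (K : NNReal) (r : ℝ≥0∞), 0 < r ∧ ∀ q : TangentBundle 𝓘(ℝ, E) M, ∀ r' ≤ r,
      sasakiEDist p q < r' → q.1 ∈ (extChartAt 𝓘(ℝ, E) p.1).source ∧
        ‖vecCoord p.1 q - vecCoord p.1 p‖ₑ ≤ K * r' := by
  obtain ⟨C, hC, hev⟩ := exists_velocity_bounds (E := E) p.1
  obtain ⟨r, hr, hball⟩ := EMetric.mem_nhds_iff.1 hev
  set B : ℝ := C * (‖p.2‖ + 1) with hB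
  have hBpos : 0 < B := by positivity
  refine ⟨(C * (1 + C * B)).toNNReal, min r 1, lt_min hr one_pos, fun q r' hr' hlt => ?_⟩
  obtain ⟨γ, rfl, rfl, hγ, hlen⟩ := exists_path_of_sasakiEDist_lt hlt
  have hdist : ∀ t ∈ Icc (0 : ℝ) 1, sasakiEDist (γ 0) (γ t) < r' := fun t ht =>
    ((sasakiEDist_le_lintegral ht.1 hγ.contMDiffOn).trans
      (lintegral_mono_set (Icc_subset_Icc_right ht.2))).trans_lt hlen
  -- base points move no faster than the curve, hence stay in the chart
  have hin : ∀ t ∈ Icc (0 : ℝ) 1, (γ t).1 ∈ Metric.eball (γ 0).1 r := fun t ht => by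
    rw [Metric.mem_eball, edist_comm, IsRiemannianManifold.out (I := 𝓘(ℝ, E)) (γ 0).1 (γ t).1]
    exact (riemannianEDist_proj_le _ _).trans_lt
      ((hdist t ht).trans_le (hr'.trans (min_le_left _ _)))
  -- the norm is nonexpansive, so that the Christoffel terms are bounded along the curve
  have hV : ∀ t ∈ Icc (0 : ℝ) 1, ‖vecCoord (γ 0).1 (γ t)‖ ≤ B := fun t ht => by
    have h1 : ‖(γ t).2‖ ≤ ‖(γ 0).2‖ + 1 := by
      have h := (enorm_snd_le_add_sasakiEDist (γ 0) (γ t)).trans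
        (add_le_add_right ((hdist t ht).le.trans (hr'.trans (min_le_right _ _))) _)
      rw [← ofReal_norm, ← ofReal_norm, ← ENNReal.ofReal_one,
        ← ENNReal.ofReal_add (norm_nonneg _) zero_le_one] at h
      exact (ENNReal.ofReal_le_ofReal_iff (by positivity)).1 h
    exact ((hball (hin t ht)).2.2.1 (γ t).2).trans (by rw [hB]; gcongr)
  have hsmooth : ContDiffOn ℝ 1 (fun t => vecCoord (γ 0).1 (γ t)) (Icc 0 1) := by
    have h := (contMDiffOn_extChartAt (I := 𝓘(ℝ, E).tangent) (x := γ 0) (n := 1)).comp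
      (hγ.contMDiffOn (s := Icc (0 : ℝ) 1)) fun t ht => by
        rw [mem_preimage, TangentBundle.mem_chart_source_iff]
        simpa using (hball (hin t ht)).1
    exact (contMDiffOn_iff_contDiffOn.1 h).snd
  refine ⟨(hball (hin 1 (right_mem_Icc.2 zero_le_one))).1, ?_⟩
  refine (enorm_sub_le_lintegral_deriv_of_contDiffOn_Icc hsmooth zero_le_one).trans ?_
  calc ∫⁻ t in Icc (0 : ℝ) 1, ‖deriv (fun t => vecCoord (γ 0).1 (γ t)) t‖ₑ
      ≤ ∫⁻ t in Icc (0 : ℝ) 1, ENNReal.ofReal (C * (1 + C * B)) *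
          sasakiENorm (γ t) (mfderiv 𝓘(ℝ, ℝ) 𝓘(ℝ, E).tangent γ t (1 : ℝ)) := by
        refine setLIntegral_mono' measurableSet_Icc fun t ht => ?_
        obtain ⟨a, b, -, hb, -, -, ha', hb'⟩ :=
          (hball (hin t ht)).2.2.2 γ t rfl (hγ.mdifferentiable one_ne_zero t)
        rw [hb.deriv]
        have hv := hV t ht
        have h1 : ‖b‖ ≤ C * ‖verticalPart (γ t)
            (mfderiv 𝓘(ℝ, ℝ) 𝓘(ℝ, E).tangent γ t (1 : ℝ))‖ + C * (C * B) * ‖horizontalPart (γ t)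
            (mfderiv 𝓘(ℝ, ℝ) 𝓘(ℝ, E).tangent γ t (1 : ℝ))‖ := by
          refine hb'.trans ?_
          rw [mul_add, mul_assoc C (C * B)]
          gcongr C * _ + C * ?_
          calc ‖a‖ * ‖vecCoord (γ 0).1 (γ t)‖ ≤ (C * ‖horizontalPart (γ t)
              (mfderiv 𝓘(ℝ, ℝ) 𝓘(ℝ, E).tangent γ t (1 : ℝ))‖) * B := by gcongr
            _ = _ := by ring
        have h2 : ‖b‖ₑ ≤ ENNReal.ofReal C * ‖verticalPart (γ t)
            (mfderiv 𝓘(ℝ, ℝ) 𝓘(ℝ, E).tangent γ t (1 : ℝ))‖ₑ +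
            ENNReal.ofReal (C * (C * B)) * ‖horizontalPart (γ t)
            (mfderiv 𝓘(ℝ, ℝ) 𝓘(ℝ, E).tangent γ t (1 : ℝ))‖ₑ := by
          rw [← ofReal_norm, ← ofReal_norm, ← ofReal_norm, ← ENNReal.ofReal_mul hC.le,
            ← ENNReal.ofReal_mul (by positivity), ← ENNReal.ofReal_add (by positivity)
              (by positivity)]
          exact ENNReal.ofReal_le_ofReal h1
        refine h2.trans ?_
        have hK : ENNReal.ofReal (C * (1 + C * B)) =
            ENNReal.ofReal C + ENNReal.ofReal (C * (C * B)) := by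
          rw [← ENNReal.ofReal_add hC.le (by positivity)]
          congr 1
          ring
        rw [hK, add_mul]
        gcongr
        · exact enorm_verticalPart_le _ _
        · exact enorm_horizontalPart_le _ _
    _ ≤ _ := by
        rw [lintegral_const_mul' _ _ ENNReal.ofReal_ne_top]
        exact mul_le_mul_right hlen.le _

/-- Points close to `p` in `TM` are close to `p` for the Sasaki distance: they are joined to `p` by
a segment in the chart at `p`, whose Sasaki length is controlled. -/
theorem eventually_sasakiEDist_lt (p : TangentBundle 𝓘(ℝ, E) M) {ε : ℝ≥0∞} (hε : 0 < ε) :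
    ∀ᶠ q in nhds p, sasakiEDist p q < ε := by
  obtain ⟨C, hC, hev⟩ := exists_velocity_bounds (E := E) p.1
  obtain ⟨N, hN, hbounds⟩ := Filter.eventually_iff_exists_mem.1 hev
  set e := extChartAt 𝓘(ℝ, E).tangent p with he
  obtain ⟨r, hr, hball⟩ : ∃ r > 0, Metric.ball (e p) r ⊆
      e.target ∩ {z | (e.symm z).1 ∈ N} := by
    refine Metric.mem_nhds_iff.1 (Filter.inter_mem (extChartAt_target_mem_nhds p) ?_)
    have hcont : ContinuousAt (fun z => (e.symm z).1) (e p) :=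
      (FiberBundle.continuous_proj E (TangentSpace 𝓘(ℝ, E))).continuousAt.comp
        (continuousAt_extChartAt_symm p)
    refine hcont.preimage_mem_nhds ?_
    rw [he, extChartAt_to_inv]
    exact hN
  set K : ℝ := C * (2 + r + ‖vecCoord p.1 p‖) with hK
  have hK0 : 0 ≤ K := by positivity
  have hcont : ContinuousAt e p := continuousAt_extChartAt p
  have hbound : ∀ q ∈ e.source, e q ∈ Metric.ball (e p) r →
      sasakiEDist p q ≤ ENNReal.ofReal (K * ‖e q - e p‖) := by
    intro q hq hqr
    set η : ℝ → E × E := fun t => e p + t • (e q - e p) with hη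
    have hηd : ∀ t, HasDerivAt η (e q - e p) t := fun t => by
      have h := ((hasDerivAt_id t).smul_const (e q - e p)).const_add (e p)
      rwa [one_smul] at h
    have hηs : ContDiff ℝ 1 η := contDiff_const.add (contDiff_id.smul contDiff_const)
    have hηr : ∀ t ∈ Icc (0 : ℝ) 1, η t ∈ Metric.ball (e p) r := fun t ht => by
      rw [mem_ball_iff_norm] at hqr ⊢
      rw [hη]
      simp only [add_sub_cancel_left, norm_smul, Real.norm_eq_abs, abs_of_nonneg ht.1]
      exact (mul_le_of_le_one_left (norm_nonneg _) ht.2).trans_lt hqr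
    have hγ : ContMDiffOn 𝓘(ℝ, ℝ) 𝓘(ℝ, E).tangent 1 (fun t => e.symm (η t)) (Icc 0 1) :=
      (contMDiffOn_extChartAt_symm (I := 𝓘(ℝ, E).tangent) p).comp
        (contMDiff_iff_contDiff.2 hηs).contMDiffOn fun t ht => (hball (hηr t ht)).1
    have h0 : e.symm (η 0) = p := by
      simp only [hη, zero_smul, add_zero]
      exact extChartAt_to_inv p
    have h1 : e.symm (η 1) = q := by
      simp only [hη, one_smul, add_sub_cancel]
      exact e.left_inv hq
    have h := sasakiEDist_le_lintegral zero_le_one hγ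
    -- `e.symm ∘ η` need not be differentiable at the end points of the interval
    rw [h0, h1, ← restrict_Ioo_eq_restrict_Icc] at h
    refine h.trans ?_
    calc _ ≤ ∫⁻ t in Ioo (0 : ℝ) 1, ENNReal.ofReal (K * ‖e q - e p‖) := by
          refine setLIntegral_mono' measurableSet_Ioo fun t ht => ?_
          have ht' := Ioo_subset_Icc_self ht
          have hmd : MDifferentiableAt 𝓘(ℝ, ℝ) 𝓘(ℝ, E).tangent (fun t => e.symm (η t)) t :=
            ((hγ t ht').contMDiffAt (Icc_mem_nhds ht.1 ht.2)).mdifferentiableAt one_ne_zero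
          obtain ⟨a, b, ha, hb, hhor, hvert, -, -⟩ :=
            (hbounds _ (hball (hηr t ht')).2).2.2.2 (fun t => e.symm (η t)) t rfl hmd
          have hcoord : ∀ s ∈ Icc (0 : ℝ) 1, (extChartAt 𝓘(ℝ, E) p.1 (e.symm (η s)).1,
              vecCoord p.1 (e.symm (η s))) = η s := fun s hs =>
            e.right_inv (hball (hηr s hs)).1
          have hev' : (fun s => (extChartAt 𝓘(ℝ, E) p.1 (e.symm (η s)).1,
              vecCoord p.1 (e.symm (η s)))) =ᶠ[nhds t] η := by
            filter_upwards [Icc_mem_nhds ht.1 ht.2] with s hs using hcoord s hs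
          have hab : (a, b) = e q - e p :=
            (ha.prodMk hb).unique ((hηd t).congr_of_eventuallyEq hev')
          have hna : ‖a‖ ≤ ‖e q - e p‖ := hab ▸ norm_fst_le (a, b)
          have hnb : ‖b‖ ≤ ‖e q - e p‖ := hab ▸ norm_snd_le (a, b)
          have hnv : ‖vecCoord p.1 (e.symm (η t))‖ ≤ ‖vecCoord p.1 p‖ + r := by
            have e1 : vecCoord p.1 (e.symm (η t)) = (η t).2 := congrArg Prod.snd (hcoord t ht')
            have e2 : vecCoord p.1 p = (e p).2 := rfl
            have e3 : ‖(η t).2 - (e p).2‖ < r :=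
              (norm_snd_le (η t - e p)).trans_lt (mem_ball_iff_norm.1 (hηr t ht'))
            rw [e1, e2]
            linarith [norm_le_norm_add_norm_sub' (η t).2 (e p).2]
          refine (sasakiENorm_le _ _).trans ?_
          rw [← ofReal_norm, ← ofReal_norm, ← ENNReal.ofReal_add (norm_nonneg _) (norm_nonneg _)]
          refine ENNReal.ofReal_le_ofReal ((add_le_add hhor hvert).trans ?_)
          calc C * ‖a‖ + C * (‖b‖ + ‖a‖ * ‖vecCoord p.1 (e.symm (η t))‖)
              ≤ C * ‖e q - e p‖ + C * (‖e q - e p‖ + ‖e q - e p‖ * (‖vecCoord p.1 p‖ + r)) := by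
                gcongr
            _ = K * ‖e q - e p‖ := by rw [hK]; ring
      _ = _ := by simp
  have hlim : Filter.Tendsto (fun q => ENNReal.ofReal (K * ‖e q - e p‖)) (nhds p) (nhds 0) := by
    have h1 : Filter.Tendsto (fun q => K * ‖e q - e p‖) (nhds p) (nhds (K * ‖e p - e p‖)) :=
      ((hcont.sub continuousAt_const).norm).const_mul K
    have h2 := ENNReal.tendsto_ofReal h1
    simpa using h2
  filter_upwards [hlim.eventually_lt_const hε, extChartAt_source_mem_nhds (I := 𝓘(ℝ, E).tangent) p,
    hcont.preimage_mem_nhds (Metric.ball_mem_nhds _ hr)] with q h1 h2 h3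
  exact (hbound q h2 h3).trans_lt h1

end SasakiTopology

/-! ### Separation, finiteness and completeness of the Sasaki distance -/

section SasakiPolish

variable {E : Type*} [NormedAddCommGroup E] [NormedSpace ℝ E]
  {M : Type*} [MetricSpace M] [ChartedSpace E M] [IsManifold 𝓘(ℝ, E) ∞ M]

theorem secondCountableTopology_tangentBundle [FiniteDimensional ℝ E] [SecondCountableTopology M] :
    SecondCountableTopology (TangentBundle 𝓘(ℝ, E) M) := by
  have : SecondCountableTopology E := by
    have := FiniteDimensional.proper_real E
    infer_instance
  have : SecondCountableTopology (ModelProd E E) :=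
    inferInstanceAs (SecondCountableTopology (E × E))
  obtain ⟨s, hs, hsU⟩ :=
    TopologicalSpace.countable_cover_nhds fun x : M => chart_source_mem_nhds E x
  refine ChartedSpace.secondCountable_of_countable_cover (ModelProd E E)
    (s := (fun x => (⟨x, 0⟩ : TangentBundle 𝓘(ℝ, E) M)) '' s) ?_ (hs.image _)
  refine eq_univ_of_forall fun p => ?_
  obtain ⟨x, hx, hp⟩ := mem_iUnion₂.1 (hsU.symm ▸ mem_univ p.1)
  exact mem_iUnion₂.2 ⟨_, mem_image_of_mem _ hx, (TangentBundle.mem_chart_source_iff _ _).2 hp⟩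

variable [FiniteDimensional ℝ E] [RiemannianBundle (fun x : M => TangentSpace 𝓘(ℝ, E) x)]

theorem edist_proj_le_sasakiEDist [IsRiemannianManifold 𝓘(ℝ, E) M]
    (p q : TangentBundle 𝓘(ℝ, E) M) : edist p.1 q.1 ≤ sasakiEDist p q :=
  (projBase E M).edist_le p q

variable [IsContMDiffRiemannianBundle 𝓘(ℝ, E) ∞ E (fun x : M => TangentSpace 𝓘(ℝ, E) x)]

/-- Two points of `TM` are at finite Sasaki distance: points at finite distance from a given one
form a clopen set, which contains the zero section and then every fibre. -/
theorem sasakiEDist_ne_top [ConnectedSpace M] (p q : TangentBundle 𝓘(ℝ, E) M) :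
    sasakiEDist p q ≠ ⊤ := by
  have hclopen : ∀ p : TangentBundle 𝓘(ℝ, E) M, IsClopen {q | sasakiEDist p q < ⊤} := fun p => by
    constructor
    · rw [← isOpen_compl_iff, isOpen_iff_mem_nhds]
      intro q hq
      filter_upwards [eventually_sasakiEDist_lt q one_pos] with q' hq' hcon
      refine hq ((sasakiEDist_triangle p q' q).trans_lt (ENNReal.add_lt_top.2 ⟨hcon, ?_⟩))
      rw [sasakiEDist_comm]
      exact hq'.trans ENNReal.one_lt_top
    · rw [isOpen_iff_mem_nhds]
      intro q hq
      filter_upwards [eventually_sasakiEDist_lt q one_pos] with q' hq'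
      exact (sasakiEDist_triangle p q q').trans_lt
        (ENNReal.add_lt_top.2 ⟨hq, hq'.trans ENNReal.one_lt_top⟩)
  have hfib : ∀ (x : M) (v w : E),
      sasakiEDist (⟨x, v⟩ : TangentBundle 𝓘(ℝ, E) M) ⟨x, w⟩ < ⊤ := fun x v w => by
    have hc : Continuous fun w : E => (⟨x, w⟩ : TangentBundle 𝓘(ℝ, E) M) :=
      FiberBundle.continuous_totalSpaceMk E (TangentSpace 𝓘(ℝ, E)) x
    have h := ((hclopen ⟨x, v⟩).preimage hc).eq_univ
      ⟨v, by simp only [mem_preimage, mem_ofPred_eq, sasakiEDist_self, ENNReal.zero_lt_top]⟩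
    exact (h.symm ▸ mem_univ w :)
  have hzero : ∀ x y : M, sasakiEDist (⟨x, 0⟩ : TangentBundle 𝓘(ℝ, E) M) ⟨y, 0⟩ < ⊤ :=
    fun x y => by
    have hc : Continuous fun y : M => (⟨y, 0⟩ : TangentBundle 𝓘(ℝ, E) M) :=
      Trivialization.continuous_zeroSection ℝ
    have h := ((hclopen ⟨x, 0⟩).preimage hc).eq_univ
      ⟨x, by simp only [mem_preimage, mem_ofPred_eq, sasakiEDist_self, ENNReal.zero_lt_top]⟩
    exact (h.symm ▸ mem_univ y :)
  refine ((sasakiEDist_triangle p ⟨p.1, 0⟩ q).trans_lt (ENNReal.add_lt_top.2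
    ⟨hfib p.1 p.2 0, (sasakiEDist_triangle _ ⟨q.1, 0⟩ q).trans_lt (ENNReal.add_lt_top.2
      ⟨hzero p.1 q.1, hfib q.1 0 q.2⟩)⟩)).ne

variable [IsRiemannianManifold 𝓘(ℝ, E) M]

theorem eq_of_sasakiEDist_eq_zero {p q : TangentBundle 𝓘(ℝ, E) M} (h : sasakiEDist p q = 0) :
    p = q := by
  obtain ⟨K, r, hr, hK⟩ := exists_enorm_vecCoord_sub_le p
  have hbase : p.1 = q.1 :=
    edist_le_zero.1 ((edist_proj_le_sasakiEDist p q).trans_eq h)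
  have hvec : vecCoord p.1 q = vecCoord p.1 p := by
    rw [← sub_eq_zero, ← enorm_eq_zero]
    by_contra hne
    have hpos : 0 < ‖vecCoord p.1 q - vecCoord p.1 p‖ₑ := pos_iff_ne_zero.2 hne
    obtain ⟨δ, hδ, hδlt⟩ := ENNReal.exists_nnreal_pos_mul_lt (ENNReal.coe_ne_top (r := K)) hne
    have hmin : 0 < min r (δ : ℝ≥0∞) := lt_min hr (by exact_mod_cast hδ)
    have h1 := (hK q _ (min_le_left _ _) (h.trans_lt hmin)).2
    refine (h1.trans_lt (lt_of_le_of_lt ?_ hδlt)).false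
    rw [mul_comm]
    gcongr
    exact min_le_right _ _
  obtain ⟨x, v⟩ := p
  obtain ⟨y, w⟩ := q
  obtain rfl : x = y := hbase
  have h1 := vecCoord_self (⟨x, v⟩ : TangentBundle 𝓘(ℝ, E) M)
  have h2 := vecCoord_self (⟨x, w⟩ : TangentBundle 𝓘(ℝ, E) M)
  have h3 : v = w := h1.symm.trans (hvec.symm.trans h2)
  rw [h3]

/-- Every neighbourhood in `TM` contains a ball of the Sasaki distance. -/
theorem exists_sasakiEDist_ball_subset {p : TangentBundle 𝓘(ℝ, E) M}
    {U : Set (TangentBundle 𝓘(ℝ, E) M)} (hU : U ∈ nhds p) :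
    ∃ r : ℝ≥0∞, 0 < r ∧ {q | sasakiEDist p q < r} ⊆ U := by
  obtain ⟨K, r, hr, hK⟩ := exists_enorm_vecCoord_sub_le p
  set e := extChartAt 𝓘(ℝ, E).tangent p with he
  have hV : e.symm ⁻¹' U ∈ nhds (e p) := by
    refine (continuousAt_extChartAt_symm p).preimage_mem_nhds ?_
    rwa [extChartAt_to_inv]
  obtain ⟨ε, hε, hball⟩ := EMetric.mem_nhds_iff.1 hV
  have hbase : extChartAt 𝓘(ℝ, E) p.1 ⁻¹' Metric.eball (extChartAt 𝓘(ℝ, E) p.1 p.1) ε ∈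
      nhds p.1 := (continuousAt_extChartAt p.1).preimage_mem_nhds (Metric.eball_mem_nhds _ hε)
  obtain ⟨r₁, hr₁, hball₁⟩ := EMetric.mem_nhds_iff.1 hbase
  obtain ⟨δ, hδ, hδlt⟩ := ENNReal.exists_nnreal_pos_mul_lt (ENNReal.coe_ne_top (r := K)) hε.ne'
  refine ⟨min (min r δ) r₁, lt_min (lt_min hr (by exact_mod_cast hδ)) hr₁, fun q hq => ?_⟩
  rw [mem_ofPred_eq, lt_min_iff] at hq
  obtain ⟨hsource, hvec⟩ := hK q _ (min_le_left _ _) hq.1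
  have h1 : e q ∈ Metric.eball (e p) ε := by
    rw [Metric.mem_eball, he, extChartAt_tangent, extChartAt_tangent, Prod.edist_eq, max_lt_iff]
    constructor
    · refine hball₁ ?_
      rw [Metric.mem_eball, edist_comm]
      exact (edist_proj_le_sasakiEDist p q).trans_lt hq.2
    · rw [edist_eq_enorm_sub]
      refine hvec.trans_lt (lt_of_le_of_lt ?_ hδlt)
      rw [mul_comm]
      gcongr
      exact min_le_right _ _
  have h2 := hball h1
  rwa [mem_preimage, he, (extChartAt 𝓘(ℝ, E).tangent p).left_inv] at h2
  rw [extChartAt_source, TangentBundle.mem_chart_source_iff]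
  simpa using hsource

/-- Completeness of the Sasaki distance: the base points of a Cauchy sequence converge and the
norms of its vectors are bounded, so that a subsequence converges in a chart. -/
theorem exists_limit_sasakiEDist [CompleteSpace M] (u : ℕ → TangentBundle 𝓘(ℝ, E) M)
    (hu : ∀ ε > 0, ∃ N, ∀ m ≥ N, ∀ n ≥ N, sasakiEDist (u m) (u n) < ε) :
    ∃ p, ∀ ε > 0, ∃ N, ∀ n ≥ N, sasakiEDist (u n) p < ε := by
  have hcauchy : CauchySeq fun n => (u n).1 := EMetric.cauchySeq_iff.2 fun ε hε => by
    obtain ⟨N, hN⟩ := hu ε hε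
    exact ⟨N, fun m hm n hn => (edist_proj_le_sasakiEDist _ _).trans_lt (hN m hm n hn)⟩
  obtain ⟨x₀, hx₀⟩ := cauchySeq_tendsto_of_complete hcauchy
  obtain ⟨C, hC, hev⟩ := eventually_chartMetric_bounds (E := E) x₀
  obtain ⟨N₁, hN₁⟩ := hu 1 one_pos
  have hnorm : ∀ n ≥ N₁, ‖(u n).2‖ ≤ ‖(u N₁).2‖ + 1 := fun n hn => by
    have h := (enorm_snd_le_add_sasakiEDist (u N₁) (u n)).trans
      (add_le_add_right (hN₁ N₁ le_rfl n hn).le _)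
    rw [← ofReal_norm, ← ofReal_norm, ← ENNReal.ofReal_one,
      ← ENNReal.ofReal_add (norm_nonneg _) zero_le_one] at h
    exact (ENNReal.ofReal_le_ofReal_iff (by positivity)).1 h
  have hbdd : ∀ᶠ n in Filter.atTop, vecCoord x₀ (u n) ∈
      Metric.closedBall (0 : E) (C * (‖(u N₁).2‖ + 1)) := by
    filter_upwards [hx₀.eventually hev, Filter.eventually_ge_atTop N₁] with n hn hn'
    rw [mem_closedBall_zero_iff]
    exact (hn.2.2.1 (u n).2).trans (by gcongr; exact hnorm n hn')
  have := FiniteDimensional.proper_real E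
  obtain ⟨a, -, φ, hφ, hlim⟩ :=
    tendsto_subseq_of_frequently_bounded Metric.isBounded_closedBall hbdd.frequently
  set p : TangentBundle 𝓘(ℝ, E) M := ⟨x₀, a⟩ with hp
  set e := extChartAt 𝓘(ℝ, E).tangent p with he
  have hlim₁ : Filter.Tendsto (fun n => (u (φ n)).1) Filter.atTop (nhds x₀) :=
    hx₀.comp hφ.tendsto_atTop
  have hep : e p = (extChartAt 𝓘(ℝ, E) x₀ x₀, a) := by
    rw [he, extChartAt_tangent, vecCoord_self]
  have hlime : Filter.Tendsto (fun n => e (u (φ n))) Filter.atTop (nhds (e p)) := by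
    rw [hep]
    exact ((continuousAt_extChartAt x₀).tendsto.comp hlim₁).prodMk_nhds hlim
  have hlimp : Filter.Tendsto (fun n => u (φ n)) Filter.atTop (nhds p) := by
    have h1 := (continuousAt_extChartAt_symm (I := 𝓘(ℝ, E).tangent) p).tendsto.comp hlime
    rw [extChartAt_to_inv] at h1
    refine h1.congr' ?_
    filter_upwards [hlim₁.eventually (chart_source_mem_nhds E x₀)] with n hn
    refine (extChartAt 𝓘(ℝ, E).tangent p).left_inv ?_
    rw [extChartAt_source, TangentBundle.mem_chart_source_iff]
    exact hn
  refine ⟨p, fun ε hε => ?_⟩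
  obtain ⟨N, hN⟩ := hu (ε / 2) (ENNReal.half_pos hε.ne')
  obtain ⟨k, hk₁, hk₂⟩ := ((hlimp.eventually (eventually_sasakiEDist_lt p
    (ENNReal.half_pos hε.ne'))).and (hφ.tendsto_atTop.eventually_ge_atTop N)).exists
  refine ⟨N, fun n hn => ?_⟩
  calc sasakiEDist (u n) p ≤ sasakiEDist (u n) (u (φ k)) + sasakiEDist (u (φ k)) p :=
        sasakiEDist_triangle _ _ _
    _ < ε / 2 + ε / 2 := by
        rw [sasakiEDist_comm _ p]
        exact ENNReal.add_lt_add (hN n hn _ hk₂) hk₁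
    _ = ε := ENNReal.add_halves ε

end SasakiPolish

/-! ### The tangent bundle and its fibre square as Polish spaces -/

section Polish

open DistSpace

instance instIsPolishBaseSpace {M : Type*} [MetricSpace M] [CompleteSpace M]
    [SecondCountableTopology M] : (baseSpace M).IsPolish where
  edist_self x := PseudoEMetricSpace.edist_self (show M from x)
  edist_comm x y := PseudoEMetricSpace.edist_comm (show M from x) y
  edist_triangle x y z := PseudoEMetricSpace.edist_triangle (show M from x) y z
  eq_of_edist_eq_zero {x y} h := EMetricSpace.eq_of_edist_eq_zero (α := M) h
  edist_ne_top x y := _root_.edist_ne_top (show M from x) y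
  exists_dense := by
    obtain ⟨s, hs, hd⟩ := TopologicalSpace.exists_countable_dense M
    exact ⟨s, hs, fun x ε hε => EMetric.mem_closure_iff.1 (hd x) ε hε⟩
  exists_limit u hu := by
    obtain ⟨x, hx⟩ := cauchySeq_tendsto_of_complete
      (show CauchySeq (α := M) u from EMetric.cauchySeq_iff.2 hu)
    exact ⟨x, EMetric.tendsto_atTop.1 hx⟩

variable {E : Type*} [NormedAddCommGroup E] [NormedSpace ℝ E] [FiniteDimensional ℝ E]
  {M : Type*} [MetricSpace M] [ChartedSpace E M] [IsManifold 𝓘(ℝ, E) ∞ M]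
  [RiemannianBundle (fun x : M => TangentSpace 𝓘(ℝ, E) x)]

theorem tangentPairSpace_ext {z z' : tangentPairSpace E M}
    (h₁ : (projFst E M).toFun z = (projFst E M).toFun z')
    (h₂ : (projSnd E M).toFun z = (projSnd E M).toFun z') : z = z' := by
  obtain ⟨x, v, w⟩ := z
  obtain ⟨x', v', w'⟩ := z'
  obtain ⟨rfl, h₁⟩ := TotalSpace.mk.inj h₁
  obtain ⟨-, h₂⟩ := TotalSpace.mk.inj h₂
  obtain rfl := eq_of_heq h₁
  obtain rfl := eq_of_heq h₂
  rfl

theorem edist_tangentPairSpace_le (z z' : tangentPairSpace E M) :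
    (tangentPairSpace E M).edist z z' ≤
      (tangentBundleSpace E M).edist ((projFst E M).toFun z) ((projFst E M).toFun z') +
        (tangentBundleSpace E M).edist ((projSnd E M).toFun z) ((projSnd E M).toFun z') := by
  change (sasakiEDist _ _ ^ 2 + sasakiEDist _ _ ^ 2) ^ (1 / 2 : ℝ) ≤
    sasakiEDist _ _ + sasakiEDist _ _
  rw [ENNReal.sqrt_le_iff, add_sq]
  gcongr
  · exact le_self_add
  · exact le_rfl

theorem exists_tangentPairSpace_of_base_eq [IsRiemannianManifold 𝓘(ℝ, E) M]
    {y y' : tangentBundleSpace E M}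
    (h : (projBase E M).toFun y = (projBase E M).toFun y') :
    ∃ z, (projFst E M).toFun z = y ∧ (projSnd E M).toFun z = y' := by
  obtain ⟨x, v⟩ := y
  obtain ⟨x', w⟩ := y'
  obtain rfl : x = x' := h
  exact ⟨⟨x, v, w⟩, rfl, rfl⟩

variable [IsContMDiffRiemannianBundle 𝓘(ℝ, E) ∞ E (fun x : M => TangentSpace 𝓘(ℝ, E) x)]
  [IsRiemannianManifold 𝓘(ℝ, E) M]

/-- The topology of the Sasaki distance is finer than the topology of `TM` (they are in fact equal,
by `eventually_sasakiEDist_lt`). -/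
theorem continuous_tangentBundleSpace :
    Continuous (Y := TangentBundle 𝓘(ℝ, E) M) fun p : tangentBundleSpace E M => p := by
  refine continuous_def.2 fun U hU p hp => ?_
  obtain ⟨r, hr, hrU⟩ := exists_sasakiEDist_ball_subset
    (IsOpen.mem_nhds (X := TangentBundle 𝓘(ℝ, E) M) hU hp)
  exact ⟨r, hr, hrU⟩

variable [CompleteSpace M] [ConnectedSpace M]
  [SecondCountableTopology M]

instance instIsPolishTangentBundleSpace : (tangentBundleSpace E M).IsPolish where
  edist_self := sasakiEDist_self
  edist_comm := sasakiEDist_comm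
  edist_triangle := sasakiEDist_triangle
  eq_of_edist_eq_zero := eq_of_sasakiEDist_eq_zero
  edist_ne_top := sasakiEDist_ne_top
  exists_dense := by
    have := secondCountableTopology_tangentBundle (E := E) (M := M)
    obtain ⟨s, hs, hd⟩ := TopologicalSpace.exists_countable_dense (TangentBundle 𝓘(ℝ, E) M)
    refine ⟨s, hs, fun p ε hε => ?_⟩
    obtain ⟨q, hq, hqs⟩ := mem_closure_iff_nhds.1 (hd p) _ (eventually_sasakiEDist_lt p hε)
    exact ⟨q, hqs, hq⟩
  exists_limit := exists_limit_sasakiEDist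

instance instIsPolishTangentPairSpace : (tangentPairSpace E M).IsPolish where
  edist_self z := by
    refine le_antisymm ((edist_tangentPairSpace_le z z).trans_eq ?_) zero_le
    rw [IsPolish.edist_self, IsPolish.edist_self, add_zero]
  edist_comm z z' := by
    change (sasakiEDist _ _ ^ 2 + sasakiEDist _ _ ^ 2) ^ (1 / 2 : ℝ) = _
    rw [sasakiEDist_comm, sasakiEDist_comm (⟨z.1, z.2.2⟩ : TangentBundle 𝓘(ℝ, E) M)]
    rfl
  edist_triangle z₁ z₂ z₃ := by
    have h : ∀ a b : ℝ≥0∞, (a ^ 2 + b ^ 2) ^ (1 / 2 : ℝ) =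
        (a ^ (2 : ℝ) + b ^ (2 : ℝ)) ^ (1 / (2 : ℝ)) := fun a b => by norm_num
    change (sasakiEDist _ _ ^ 2 + sasakiEDist _ _ ^ 2) ^ (1 / 2 : ℝ) ≤
      (sasakiEDist _ _ ^ 2 + sasakiEDist _ _ ^ 2) ^ (1 / 2 : ℝ) +
        (sasakiEDist _ _ ^ 2 + sasakiEDist _ _ ^ 2) ^ (1 / 2 : ℝ)
    refine (ENNReal.rpow_le_rpow (add_le_add
      (pow_le_pow_left' (sasakiEDist_triangle _ ⟨z₂.1, z₂.2.1⟩ _) 2)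
      (pow_le_pow_left' (sasakiEDist_triangle _ ⟨z₂.1, z₂.2.2⟩ _) 2)) (by norm_num)).trans ?_
    have := ENNReal.Lp_add_le (Finset.univ : Finset (Fin 2))
      ![sasakiEDist (⟨z₁.1, z₁.2.1⟩ : TangentBundle 𝓘(ℝ, E) M) ⟨z₂.1, z₂.2.1⟩,
        sasakiEDist (⟨z₁.1, z₁.2.2⟩ : TangentBundle 𝓘(ℝ, E) M) ⟨z₂.1, z₂.2.2⟩]
      ![sasakiEDist (⟨z₂.1, z₂.2.1⟩ : TangentBundle 𝓘(ℝ, E) M) ⟨z₃.1, z₃.2.1⟩,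
        sasakiEDist (⟨z₂.1, z₂.2.2⟩ : TangentBundle 𝓘(ℝ, E) M) ⟨z₃.1, z₃.2.2⟩]
      one_le_two
    simp only [Fin.sum_univ_two, Matrix.cons_val_zero, Matrix.cons_val_one] at this
    rw [h, h, h]
    exact this
  eq_of_edist_eq_zero {z z'} h := by
    refine tangentPairSpace_ext (IsPolish.eq_of_edist_eq_zero ?_)
      (IsPolish.eq_of_edist_eq_zero ?_)
    · exact le_antisymm (((projFst E M).edist_le z z').trans_eq h) zero_le
    · exact le_antisymm (((projSnd E M).edist_le z z').trans_eq h) zero_le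
  edist_ne_top z z' := by
    refine ne_top_of_le_ne_top ?_ (edist_tangentPairSpace_le z z')
    exact ENNReal.add_ne_top.2 ⟨IsPolish.edist_ne_top _ _, IsPolish.edist_ne_top _ _⟩
  exists_dense := by
    -- separability is inherited from `TM × TM`
    let i : tangentPairSpace E M → tangentBundleSpace E M × tangentBundleSpace E M :=
      fun z => ((projFst E M).toFun z, (projSnd E M).toFun z)
    let _ : TopologicalSpace (tangentPairSpace E M) := TopologicalSpace.induced i inferInstance
    have : SecondCountableTopology (tangentPairSpace E M) :=
      TopologicalSpace.secondCountableTopology_induced _ _ i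
    obtain ⟨s, hs, hd⟩ := TopologicalSpace.exists_countable_dense (tangentPairSpace E M)
    refine ⟨s, hs, fun z ε hε => ?_⟩
    have hnhds : {z' | i z' ∈ Metric.eball (i z).1 (ε / 2) ×ˢ Metric.eball (i z).2 (ε / 2)} ∈
        nhds z := by
      rw [nhds_induced]
      exact Filter.preimage_mem_comap (prod_mem_nhds
        (Metric.eball_mem_nhds _ (ENNReal.half_pos hε.ne'))
        (Metric.eball_mem_nhds _ (ENNReal.half_pos hε.ne')))
    obtain ⟨z', ⟨h₁, h₂⟩, hs'⟩ := mem_closure_iff_nhds.1 (hd z) _ hnhds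
    rw [Metric.mem_eball, PseudoEMetricSpace.edist_comm] at h₁ h₂
    refine ⟨z', hs', (edist_tangentPairSpace_le z z').trans_lt ?_⟩
    exact (ENNReal.add_lt_add h₁ h₂).trans_eq (ENNReal.add_halves ε)
  exists_limit u hu := by
    obtain ⟨y, hy⟩ := IsPolish.exists_limit (fun n => (projFst E M).toFun (u n)) fun ε hε =>
      (hu ε hε).imp fun N hN m hm n hn => ((projFst E M).edist_le _ _).trans_lt (hN m hm n hn)
    obtain ⟨y', hy'⟩ := IsPolish.exists_limit (fun n => (projSnd E M).toFun (u n)) fun ε hε =>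
      (hu ε hε).imp fun N hN m hm n hn => ((projSnd E M).edist_le _ _).trans_lt (hN m hm n hn)
    have hbase : (projBase E M).toFun y = (projBase E M).toFun y' := by
      refine IsPolish.eq_of_edist_eq_zero (le_antisymm (le_of_forall_gt fun ε hε => ?_) zero_le)
      obtain ⟨N, hN⟩ := hy (ε / 2) (ENNReal.half_pos hε.ne')
      obtain ⟨N', hN'⟩ := hy' (ε / 2) (ENNReal.half_pos hε.ne')
      have h₁ := ((projBase E M).edist_le _ _).trans_lt (hN (max N N') (le_max_left _ _))
      have h₂ := ((projBase E M).edist_le _ _).trans_lt (hN' (max N N') (le_max_right _ _))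
      rw [IsPolish.edist_comm] at h₁
      exact ((IsPolish.edist_triangle _ _ _).trans_lt (ENNReal.add_lt_add h₁ h₂)).trans_eq
        (ENNReal.add_halves ε)
    obtain ⟨z, rfl, rfl⟩ := exists_tangentPairSpace_of_base_eq hbase
    refine ⟨z, fun ε hε => ?_⟩
    obtain ⟨N, hN⟩ := hy (ε / 2) (ENNReal.half_pos hε.ne')
    obtain ⟨N', hN'⟩ := hy' (ε / 2) (ENNReal.half_pos hε.ne')
    exact ⟨max N N', fun n hn => ((edist_tangentPairSpace_le _ _).trans_lt (ENNReal.add_lt_add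
      (hN n (le_of_max_le_left hn)) (hN' n (le_of_max_le_right hn)))).trans_eq
        (ENNReal.add_halves ε)⟩

/-! ### The system of plans of a Riemannian manifold -/

/-- By the polarized formula `‖v - w‖² = ⟪v, v⟫ - 2 ⟪v, w⟫ + ⟪w, w⟫`, this follows from the
continuity of the scalar product on `TM`. -/
theorem continuous_sqDiff : Continuous (sqDiff E M) := by
  have := isContinuousRiemannianBundle_tangent (E := E) (M := M)
  have h₁ : Continuous (Y := TangentBundle 𝓘(ℝ, E) M) fun z : tangentPairSpace E M =>
      (projFst E M).toFun z :=
    continuous_tangentBundleSpace.comp (projFst E M).lipschitz.continuous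
  have h₂ : Continuous (Y := TangentBundle 𝓘(ℝ, E) M) fun z : tangentPairSpace E M =>
      (projSnd E M).toFun z :=
    continuous_tangentBundleSpace.comp (projSnd E M).lipschitz.continuous
  have key := fun (v w : ∀ z : Σ x : M, TangentSpace 𝓘(ℝ, E) x × TangentSpace 𝓘(ℝ, E) x,
      TangentSpace 𝓘(ℝ, E) z.1)
    (hv : Continuous fun z : tangentPairSpace E M => (⟨_, v z⟩ : TangentBundle 𝓘(ℝ, E) M))
    (hw : Continuous fun z : tangentPairSpace E M => (⟨_, w z⟩ : TangentBundle 𝓘(ℝ, E) M)) =>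
    Continuous.inner_bundle (F := E) (E := fun x : M => TangentSpace 𝓘(ℝ, E) x)
      (M := tangentPairSpace E M) (v := v) (w := w) hv hw
  have hcont := ENNReal.continuous_ofReal.comp
    (((key (fun z => z.2.1) (fun z => z.2.1) h₁ h₁).sub
    ((key (fun z => z.2.1) (fun z => z.2.2) h₁ h₂).const_mul 2)).add
    (key (fun z => z.2.2) (fun z => z.2.2) h₂ h₂))
  refine hcont.congr fun z => ?_
  obtain ⟨x, v, w⟩ := z
  change ENNReal.ofReal (inner ℝ v v - 2 * inner ℝ v w + inner ℝ w w) = ‖v - w‖ₑ ^ 2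
  rw [← ofReal_norm, ← ENNReal.ofReal_pow (norm_nonneg _), norm_sub_sq_real,
    real_inner_self_eq_norm_sq, real_inner_self_eq_norm_sq]

/-- `(π₁, π₂)` is a bi-Lipschitz embedding of `T²M` in `TM × TM`. -/
theorem totallyBounded_tangentPairSpace (A : Set (tangentBundleSpace E M))
    (hA : TotallyBounded A) :
    TotallyBounded {z | (projFst E M).toFun z ∈ A ∧ (projSnd E M).toFun z ∈ A} := by
  have hK : IsCompact (closure A) := hA.closure.isCompact_of_isClosed isClosed_closure
  have hanti : AntilipschitzWith 2 fun z : tangentPairSpace E M =>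
      ((projFst E M).toFun z, (projSnd E M).toFun z) := fun z z' => by
    refine (edist_tangentPairSpace_le z z').trans ?_
    rw [ENNReal.coe_ofNat, two_mul, Prod.edist_eq]
    exact add_le_add (le_max_left _ _) (le_max_right _ _)
  have hlip := (projFst E M).lipschitz.prodMk (projSnd E M).lipschitz
  refine TotallyBounded.subset (fun z hz => ?_) (totallyBounded_preimage
    (hanti.isUniformInducing hlip.uniformContinuous) (hK.prod hK).totallyBounded)
  exact ⟨subset_closure hz.1, subset_closure hz.2⟩

/-- The maps `M ← TM ⇇ T²M` with the cost `‖v₁ - v₂‖²` form a system of plans. -/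
theorem isPlanSystem_tangentPairSpace :
    IsPlanSystem (projBase E M) (projFst E M) (projSnd E M) (sqDiff E M) where
  totallyBounded := totallyBounded_tangentPairSpace
  growth := by
    obtain ⟨x₀⟩ : Nonempty M := inferInstance
    refine ⟨⟨x₀, 0, 0⟩, ⟨x₀, 0⟩, fun z => ⟨edist_tangentPairSpace_le _ _, ?_⟩⟩
    obtain ⟨x, v, w⟩ := z
    have h : ∀ v : TangentSpace 𝓘(ℝ, E) x, ‖v‖ₑ ≤
        sasakiEDist (⟨x₀, 0⟩ : TangentBundle 𝓘(ℝ, E) M) ⟨x, v⟩ := fun v => by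
      have h := enorm_snd_le_add_sasakiEDist (⟨x₀, 0⟩ : TangentBundle 𝓘(ℝ, E) M) ⟨x, v⟩
      rwa [enorm_zero, zero_add] at h
    change ‖v - w‖ₑ ^ 2 ≤ (sasakiEDist _ _ + sasakiEDist _ _) ^ 2
    exact pow_le_pow_left' (enorm_sub_le.trans (add_le_add (h v) (h w))) 2
  lowerSemicontinuous := continuous_sqDiff.lowerSemicontinuous
  exists_of_base_eq _ _ := exists_tangentPairSpace_of_base_eq
  diag := by
    rintro ⟨x, v⟩
    refine ⟨⟨x, v, v⟩, rfl, rfl, ?_⟩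
    change ‖v - v‖ₑ ^ 2 = 0
    simp
  swap := by
    rintro ⟨x, v, w⟩
    refine ⟨⟨x, w, v⟩, rfl, rfl, ?_⟩
    change ‖w - v‖ₑ ^ 2 ≤ ‖v - w‖ₑ ^ 2
    rw [enorm_sub_rev]
  comp := by
    rintro ⟨x, v, w⟩ ⟨x', v', w'⟩ h
    obtain ⟨rfl, h⟩ := TotalSpace.mk.inj h
    obtain rfl := eq_of_heq h
    refine ⟨⟨x, v, w'⟩, rfl, rfl, ?_⟩
    change ‖v - w'‖ₑ ^ 2 ≤ ((‖v - w‖ₑ ^ 2) ^ (1 / 2 : ℝ) + (‖w - w'‖ₑ ^ 2) ^ (1 / 2 : ℝ)) ^ 2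
    rw [ENNReal.sqrt_sq, ENNReal.sqrt_sq, ← sub_add_sub_cancel v w w']
    exact pow_le_pow_left' (enorm_add_le _ _) 2
  eq_of_cost_eq_zero := by
    rintro ⟨x, v, w⟩ h
    change ‖v - w‖ₑ ^ 2 = 0 at h
    obtain rfl : v = w := by simpa [sub_eq_zero] using h
    rfl

end Polish

theorem mainTheorem5 {E : Type*} [NormedAddCommGroup E] [NormedSpace ℝ E] [FiniteDimensional ℝ E]
    {M : Type*} [MetricSpace M] [ChartedSpace E M] [IsManifold 𝓘(ℝ, E) ∞ M]
    [RiemannianBundle (fun x : M => TangentSpace 𝓘(ℝ, E) x)]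
    [IsContMDiffRiemannianBundle 𝓘(ℝ, E) ∞ E (fun x : M => TangentSpace 𝓘(ℝ, E) x)]
    [IsRiemannianManifold 𝓘(ℝ, E) M] [CompleteSpace M] [ConnectedSpace M]
    [SecondCountableTopology M]
    (n : ℕ) (μ : DistSpace.hier n (baseSpace M)) :
    -- the couplings form a nonempty compact set, on which the infimum is finite and attained
    (∀ γ₁ ∈ velocityPlans (E := E) n μ, ∀ γ₂ ∈ velocityPlans (E := E) n μ,
      (planCouplings n γ₁ γ₂).Nonempty ∧ IsCompact (planCouplings n γ₁ γ₂) ∧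
      planDist n γ₁ γ₂ ≠ ⊤ ∧
      ∃ α ∈ planCouplings n γ₁ γ₂,
        planDist n γ₁ γ₂ ^ 2 = DistSpace.nExpect (sqDiff E M) n α) ∧
    -- `W_μ` is a distance on the set of velocity plans with base `μ`
    (∀ γ₁ ∈ velocityPlans (E := E) n μ, ∀ γ₂ ∈ velocityPlans (E := E) n μ,
      planDist n γ₁ γ₂ = 0 ↔ γ₁ = γ₂) ∧
    (∀ γ₁ ∈ velocityPlans (E := E) n μ, ∀ γ₂ ∈ velocityPlans (E := E) n μ,
      planDist n γ₁ γ₂ = planDist n γ₂ γ₁) ∧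
    (∀ γ₁ ∈ velocityPlans (E := E) n μ, ∀ γ₂ ∈ velocityPlans (E := E) n μ,
      ∀ γ₃ ∈ velocityPlans (E := E) n μ,
      planDist n γ₁ γ₃ ≤ planDist n γ₁ γ₂ + planDist n γ₂ γ₃) := by
  have hsys := (isPlanSystem_tangentPairSpace (E := E) (M := M)).hierPush n
  have hbase : ∀ γ₁ ∈ velocityPlans (E := E) n μ, ∀ γ₂ ∈ velocityPlans (E := E) n μ,
      ((projBase E M).hierPush n).toFun γ₁ = ((projBase E M).hierPush n).toFun γ₂ :=
    fun γ₁ h₁ γ₂ h₂ => h₁.trans h₂.symm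
  refine ⟨fun γ₁ h₁ γ₂ h₂ => ⟨hsys.exists_of_base_eq _ _ (hbase _ h₁ _ h₂),
    hsys.isCompact_couplings _ _, hsys.couplingDist_ne_top (hbase _ h₁ _ h₂),
    hsys.exists_optimal (hbase _ h₁ _ h₂)⟩, fun γ₁ h₁ γ₂ h₂ => hsys.couplingDist_eq_zero_iff
    (hbase _ h₁ _ h₂), fun γ₁ _ γ₂ _ => hsys.couplingDist_comm, fun γ₁ h₁ γ₂ h₂ γ₃ h₃ =>
    hsys.couplingDist_triangle (hbase _ h₁ _ h₂) (hbase _ h₂ _ h₃)⟩
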